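/- **Setting.** Let $M$ be a compact finite-dimensional smooth manifold, with or without boundary, and let $X_t$ be the flow of a $C^1$ vector field $X$ on $M$ (if $\partial M\neq\emptyset$, the flow is assumed to be defined on $M$ for $t\ge 0$, with injective time-$t$ maps). Let $U\subset M$ be a trapping region: $U$ is open, $X_t(U)\subset U$ for all $t>0$, and there is $T>0$ with $\overline{X_t(U)}\subset U$ for all $t>T$. Let $\Lambda=\bigcap_{t>0}\overline{X_t(U)}$ be the maximal invariant subset of $U$. Let $E_U$ be a $C^1$ real vector bundle of finite rank $n$ over $U$ with a continuous inner product on its fibers, inducing the norm $\|\cdot\|$. Let $A_t(x):E_x\to E_{X_t(x)}$ ($x\in U$, $t\ge 0$) be a linear multiplicative cocycle over $X_t$: linear bijections with $A_0(x)=\mathrm{Id}$ and $A_{t+s}(x)=A_t(X_s(x))\circ A_s(x)$, jointly continuous as a map $[0,\infty)\times E_U\to E_U$ and such that $t\mapsto A_t(x)v$ is a $C^1$ curve in $E_U$ for each $v\in E_x$. Write $A_{-t}(X_t(x))=A_t(x)^{-1}$. Let $p,q\ge 1$ be integers with $p+q=n$. A *field of non-degenerate quadratic forms of index $q$* on $E_U$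 is a continuous function $\mathcal J:E_U\to\mathbb R$ whose restriction $\mathcal J_x$ to each fiber $E_x$ is a non-degenerate quadratic form of index $q$ (the maximal dimension of a subspace of $E_x$ of non-positive vectors is $q$), and which is continuously differentiable along the flow: for each $x\in U$ and each $C^1$ section $Z$ of $E_U$ the function $t\mapsto\mathcal J_{X_t(x)}(Z(X_t(x)))$ is $C^1$ for $t\ge 0$. With $C_+(x)=\{0\}\cup\{v\in E_x:\mathcal J_x(v)>0\}$ and $C_0(x)=\mathcal J_x^{-1}(0)$, the cocycle is *strictly $\mathcal J$-separated* if $A_t(x)(C_+(x)\cup C_0(x))\subset C_+(X_t(x))$ for all $t>0$ and $x\in U$. A *dominated splitting* over $\Lambda$ is a continuous splitting $E_x=F_-(x)\oplus F_+(x)$, $x\in\Lambda$, into non-zero subspaces which is invariant, $A_t(x)F_\pm(x)=F_\pm(X_t(x))$, and for which there are constants $K,\lambda>0$ with $$\|A_t(x)|_{F_-(x)}\|\cdot\|A_{-t}(X_t(x))|_{F_+(X_t(x))}\|<Ke^{-\lambda t}\qquad\text{for all }x\in\Lambda,\ t>0.$$ **Theorem.** There is a field $\mathcal J$ of non-degenerate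 quadratic forms of index $q$ on $E_U$ such that $A_t$ is strictly $\mathcal J$-separated if and only if $E_U$ admits a dominated splitting $F_-\oplus F_+$ with respect to $A_t$ over $\Lambda$ with constant dimensions $\dim F_-(x)=q$ and $\dim F_+(x)=p$ for all $x\in\Lambda$. (In particular, whenever $A_t$ is strictly $\mathcal J$-separated for a given field $\mathcal J$ of index $q$, such a splitting exists.) -/

import Mathlib

open Set Bundle Manifold Topology TopologicalSpace
open scoped NNReal ContDiff

namespace JSeparation

section Flow

variable {EM : Type*} [NormedAddCommGroup EM] [NormedSpace ℝ EM]
  {H : Type*} [TopologicalSpace H] (I : ModelWithCorners ℝ EM H)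
  {M : Type*} [TopologicalSpace M] [ChartedSpace H M]

/-- `φ` is the flow of the vector field `X`, in forward time: the orbits are integral curves of `X`
and the time-`t` maps are injective. (On a manifold with boundary on which `X` points inwards, the
flow is defined on all of `M` in forward time only. On a closed manifold a flow `(X_t)`, `t ∈ ℝ`,
is determined by the maps `X_t`, `t ≥ 0`, and `X_{-t}` is the inverse of `X_t`.) -/
structure IsFlowOf (X : (x : M) → TangentSpace I x) (φ : Flow ℝ≥0 M) : Prop where
  isMIntegralCurveOn : ∀ x : M, IsMIntegralCurveOn (fun t : ℝ => φ t.toNNReal x) X (Ici 0)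
  injective : ∀ t : ℝ≥0, Function.Injective (φ t)

variable {I}

/-- A trapping region: an open set `U` with `X_t(U) ⊆ U` for all `t > 0`, such that for some `T > 0`
the closure of `X_t(U)` lies in `U` for all `t > T`. -/
structure IsTrappingRegion (φ : Flow ℝ≥0 M) (U : Opens M) : Prop where
  image_subset : ∀ t : ℝ≥0, 0 < t → φ t '' (U : Set M) ⊆ U
  closure_subset : ∃ T : ℝ≥0, 0 < T ∧ ∀ t : ℝ≥0, T < t → closure (φ t '' (U : Set M)) ⊆ U

theorem IsTrappingRegion.isInvariant {φ : Flow ℝ≥0 M} {U : Opens M} (h : IsTrappingRegion φ U) :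
    IsInvariant φ (U : Set M) := by
  intro t x hx
  rcases eq_or_lt_of_le (zero_le : (0 : ℝ≥0) ≤ t) with ht | ht
  · rw [← ht, φ.map_zero_apply]
    exact hx
  · exact h.image_subset t ht ⟨x, hx, rfl⟩

/-- The flow restricted to a trapping region. -/
def IsTrappingRegion.flow {φ : Flow ℝ≥0 M} {U : Opens M} (h : IsTrappingRegion φ U) :
    Flow ℝ≥0 U :=
  φ.restrict h.isInvariant

/-- `Λ(U) = ⋂_{t > 0} closure (X_t(U))`, the maximal invariant subset of `U`. -/
def maximalInvariantSet (φ : Flow ℝ≥0 M) (U : Opens M) : Set M :=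
  ⋂ t : {t : ℝ≥0 // 0 < t}, closure (φ t '' (U : Set M))

end Flow

section Cocycle

variable {EM : Type*} [NormedAddCommGroup EM] [NormedSpace ℝ EM]
  {H : Type*} [TopologicalSpace H] (I : ModelWithCorners ℝ EM H)
  {B : Type*} [TopologicalSpace B] [ChartedSpace H B]
  (F : Type*) [NormedAddCommGroup F] [NormedSpace ℝ F]
  (E : B → Type*) [TopologicalSpace (TotalSpace F E)] [∀ x, NormedAddCommGroup (E x)]
  [∀ x, InnerProductSpace ℝ (E x)] [FiberBundle F E]

/-- A linear multiplicative cocycle over the (forward) flow `ψ` on the base of the vector bundle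
`E`: linear bijections `A_t(x) : E_x → E_{ψ_t(x)}` with `A_0(x) = Id` and
`A_{t+s}(x) = A_t(ψ_s(x)) ∘ A_s(x)`, jointly continuous on the bundle and continuously
differentiable in time. The maps for negative times are the inverses
`A_{-t}(ψ_t(x)) = A_t(x)⁻¹`.
The two identities compare vectors in fibres over points that are only propositionally equal, so
they are stated in the total space. -/
structure LinearCocycle (ψ : Flow ℝ≥0 B) where
  toFun : ∀ (t : ℝ≥0) (x : B), E x ≃L[ℝ] E (ψ t x)
  map_zero : ∀ (x : B) (v : E x),
    (⟨ψ 0 x, toFun 0 x v⟩ : TotalSpace F E) = ⟨x, v⟩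
  map_add : ∀ (t s : ℝ≥0) (x : B) (v : E x),
    (⟨ψ (t + s) x, toFun (t + s) x v⟩ : TotalSpace F E) =
      ⟨ψ t (ψ s x), toFun t (ψ s x) (toFun s x v)⟩
  continuous : Continuous fun p : ℝ≥0 × TotalSpace F E =>
    (⟨ψ p.1 p.2.1, toFun p.1 p.2.1 p.2.2⟩ : TotalSpace F E)
  contMDiffOn_time : ∀ (x : B) (v : E x),
    ContMDiffOn 𝓘(ℝ, ℝ) (I.prod 𝓘(ℝ, F)) 1
      (fun t : ℝ => (⟨ψ t.toNNReal x, toFun t.toNNReal x v⟩ : TotalSpace F E)) (Ici 0)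

/-- A continuous field of non-degenerate quadratic forms of constant index `q` on the bundle `E`,
continuously differentiable along the flow: `t ↦ 𝓙_{ψ_t(x)}(Z(ψ_t(x)))` is `C¹` for every point `x`
and every `C¹` section `Z`. The index is the maximal dimension of a subspace of non-positive vectors. -/
structure IsQuadraticFormField (ψ : Flow ℝ≥0 B) (J : ∀ x : B, QuadraticForm ℝ (E x)) (q : ℕ) :
    Prop where
  continuous : Continuous fun v : TotalSpace F E => J v.1 v.2
  nondegenerate : ∀ x : B, (QuadraticMap.polarBilin (J x)).Nondegenerate
  index_eq : ∀ x : B, IsGreatest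
    {d : ℕ | ∃ W : Submodule ℝ (E x), (∀ v ∈ W, J x v ≤ 0) ∧ Module.finrank ℝ W = d} q
  contDiffOn_flow : ∀ Z : ∀ x : B, E x,
    ContMDiff I (I.prod 𝓘(ℝ, F)) 1 (fun x : B => (⟨x, Z x⟩ : TotalSpace F E)) →
      ∀ x : B, ContDiffOn ℝ 1
        (fun t : ℝ => J (ψ t.toNNReal x) (Z (ψ t.toNNReal x))) (Ici 0)

variable {F E}

/-- The positive cone `C_+ = {0} ∪ {𝓙 > 0}` of a quadratic form. -/
def positiveCone {V : Type*} [AddCommGroup V] [Module ℝ V] (Q : QuadraticForm ℝ V) : Set V :=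
  {0} ∪ {v | 0 < Q v}

/-- The cone `C_0 = {𝓙 = 0}` of zero vectors of a quadratic form. -/
def zeroCone {V : Type*} [AddCommGroup V] [Module ℝ V] (Q : QuadraticForm ℝ V) : Set V :=
  {v | Q v = 0}

variable {I}

/-- The cocycle is strictly `𝓙`-separated:
`A_t(x)(C_+(x) ∪ C_0(x)) ⊆ C_+(ψ_t(x))` for all `t > 0` and all `x`. -/
def LinearCocycle.IsStrictlySeparated {ψ : Flow ℝ≥0 B} (A : LinearCocycle I F E ψ)
    (J : ∀ x : B, QuadraticForm ℝ (E x)) : Prop :=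
  ∀ (t : ℝ≥0) (x : B), 0 < t →
    A.toFun t x '' (positiveCone (J x) ∪ zeroCone (J x)) ⊆ positiveCone (J (ψ t x))

variable (F) in
/-- `W` is a continuous subbundle over the set `S`: locally on `S`, it has a continuous frame. -/
def IsContinuousSubbundleOn (S : Set B) (W : ∀ x : B, Submodule ℝ (E x)) : Prop :=
  ∀ x ∈ S, ∃ N ∈ 𝓝[S] x, ∃ (k : ℕ) (σ : Fin k → ∀ y : B, E y),
    (∀ i, ContinuousOn (fun y : B => (⟨y, σ i y⟩ : TotalSpace F E)) N) ∧
    ∀ y ∈ N, LinearIndependent ℝ (fun i => σ i y) ∧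
      Submodule.span ℝ (Set.range fun i => σ i y) = W y

/-- `Fm ⊕ Fp` is a dominated splitting over the invariant set `S` for the cocycle: a continuous
invariant splitting of the bundle over `S` into non-zero subbundles with
`‖A_t(x)|_{Fm(x)}‖ · ‖A_{-t}(ψ_t(x))|_{Fp(ψ_t(x))}‖ < K e^{-λ t}` for all `x ∈ S` and `t > 0`.
Only the subspaces over the points of `S` matter. -/
structure LinearCocycle.IsDominatedSplittingOn {ψ : Flow ℝ≥0 B} (A : LinearCocycle I F E ψ)
    (S : Set B) (Fm Fp : ∀ x : B, Submodule ℝ (E x)) : Prop where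
  isCompl : ∀ x ∈ S, IsCompl (Fm x) (Fp x)
  left_ne_bot : ∀ x ∈ S, Fm x ≠ ⊥
  right_ne_bot : ∀ x ∈ S, Fp x ≠ ⊥
  left_continuous : IsContinuousSubbundleOn F S Fm
  right_continuous : IsContinuousSubbundleOn F S Fp
  left_invariant : ∀ x ∈ S, ∀ t : ℝ≥0,
    (A.toFun t x : E x → E (ψ t x)) '' (Fm x : Set (E x)) = Fm (ψ t x)
  right_invariant : ∀ x ∈ S, ∀ t : ℝ≥0,
    (A.toFun t x : E x → E (ψ t x)) '' (Fp x : Set (E x)) = Fp (ψ t x)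
  dominated : ∃ K lam : ℝ, 0 < K ∧ 0 < lam ∧ ∀ x ∈ S, ∀ t : ℝ≥0, 0 < t →
    ‖(A.toFun t x : E x →L[ℝ] E (ψ t x)).comp (Fm x).subtypeL‖ *
      ‖((A.toFun t x).symm : E (ψ t x) →L[ℝ] E x).comp (Fp (ψ t x)).subtypeL‖ <
        K * Real.exp (-lam * t)

end Cocycle

end JSeparation

/-!
# Strictly separated cocycles and dominated splittings over a trapping region

**From a form to a splitting.** Let `Λ` be the maximal invariant set. It is compact, and the flow is
invertible on it. Call a vector over `Λ` unstable if its whole past lies in the cone `𝓙 ≥ 0`, and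
stable if its whole future lies in `𝓙 ≤ 0`. Over each point, the unstable vectors contain a
`p`-dimensional subspace, a limit of images of positive subspaces from further and further in the
past, and the stable ones contain a `q`-dimensional subspace
(`exists_submodule_subset_unstableCone`, `exists_submodule_subset_stableCone`). By compactness,
`𝓙 (A_1 v) ≥ η ‖v‖²` wherever `𝓙 v ≥ 0`, for some `η > 0`. So `𝓙 ∘ A_1 - η ‖·‖²` is non-negative
where `𝓙` is, and the comparison of quadratic forms behind the S-lemma
(`mul_le_mul_of_nonneg_imp_nonneg`) shows that one unit of time contracts the ratio of `|𝓙|` on a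
stable and on an unstable vector by a uniform factor (`exists_ratio_contraction`). On the stable and
unstable vectors `|𝓙|` is comparable to the square of the norm, whence exponential domination
(`exists_domination`). Domination forces the stable and the unstable vectors over a point to form
complementary subspaces (`exists_isCompl_submodules`); these depend continuously on the point
because the sets of stable and of unstable vectors are closed and the dimensions are constant.

**From a splitting to a form.** A partition of unity and an averaging argument give a continuous
function `δ` on the base such that, up to constants, `A_t` stretches the vectors of `Fm` by at most
`exp (∫ δ - κ t)` and those of `Fp` by at least `exp (∫ δ + κ t)`, the integral being taken along
the orbit (`LinearCocycle.IsDominatedSplittingOn.exists_orbitIntegral`). Take any continuous field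
`J` over the trapping region that is negative on `Fm` and positive on `Fp` over `Λ`. After rescaling by
`exp (-∫ δ)`, the cocycle contracts `Fm` and expands `Fp`, so for a large time `S` the rescaled
pull-back of `J` by `A_S` exceeds `J`, first over `Λ` and then over a neighbourhood of `Λ`, which
absorbs the trapping region after some time `τ`. Write `h s` for the rescaled pull-back of `J` by
`A_s`. The field `∫ s in τ..(τ + S), h s` has the required properties: along an orbit it becomes, up
to a positive factor, `∫ s in (t + τ)..(t + τ + S), h s`, whose derivative in `t` is
`h (t + τ + S) - h (t + τ) > 0`. This gives strict separation (`averagedForm_lt`) and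
differentiability along the flow (`contDiffOn_averagedForm`) although `J` is only continuous. The
signature is `(p, q)` near `Λ`, and elsewhere because the cocycle carries every fibre into a
neighbourhood of `Λ`.
-/

set_option linter.unusedSectionVars false

namespace JSeparation

/-! ### Compactness in Riemannian vector bundles -/

section Bundle

variable {B : Type*} [TopologicalSpace B]
  {F : Type*} [NormedAddCommGroup F] [NormedSpace ℝ F]
  {E : B → Type*} [TopologicalSpace (TotalSpace F E)] [∀ x, NormedAddCommGroup (E x)]
  [∀ x, InnerProductSpace ℝ (E x)] [FiberBundle F E] [VectorBundle ℝ F E]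

variable (F E) in
/-- A local trivialization at `x₀`, as a family of linear equivalences `F ≃ E x` that is
jointly continuous, in both directions, over an open neighbourhood `N` of `x₀`. Off `N` the
equivalences are arbitrary. -/
theorem exists_local_coordinates (x₀ : B) :
    ∃ N : Set B, IsOpen N ∧ x₀ ∈ N ∧ ∃ L : ∀ x, F ≃L[ℝ] E x,
      ContinuousOn (fun p : B × F => (⟨p.1, L p.1 p.2⟩ : TotalSpace F E)) (N ×ˢ univ) ∧
      ContinuousOn (fun v : TotalSpace F E => (L v.1).symm v.2) {v | v.1 ∈ N} := by
  classical
  set e := trivializationAt F E x₀ with he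
  refine ⟨e.baseSet, e.open_baseSet, FiberBundle.mem_baseSet_trivializationAt' x₀,
    fun x => if h : x ∈ e.baseSet then (e.continuousLinearEquivAt ℝ x h).symm
      else ((trivializationAt F E x).continuousLinearEquivAt ℝ x
        (FiberBundle.mem_baseSet_trivializationAt' x)).symm, ?_, ?_⟩
  · have h : ContinuousOn e.toOpenPartialHomeomorph.symm (e.baseSet ×ˢ univ) := by
      have := e.toOpenPartialHomeomorph.continuousOn_symm
      rwa [e.target_eq] at this
    refine h.congr ?_
    rintro ⟨x, y⟩ ⟨hx, -⟩
    have hx' : x ∈ e.baseSet := hx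
    simp only [hx', dif_pos]
    exact (e.symm_apply_eq_mk_continuousLinearEquivAt_symm (R := ℝ) x hx' y).symm
  · have h : ContinuousOn e e.source := e.continuousOn
    rw [e.source_eq] at h
    refine (continuous_snd.comp_continuousOn h).congr ?_
    intro v hv
    have hv' : v.1 ∈ e.baseSet := hv
    simp only [hv', dif_pos]
    simp

theorem t2Space_totalSpace [T2Space B] : T2Space (TotalSpace F E) := by
  refine ⟨fun v w hvw => ?_⟩
  by_cases h : v.1 = w.1
  · obtain ⟨N, hN, hvN, L, -, hL⟩ := exists_local_coordinates F E v.1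
    have hS : IsOpen {u : TotalSpace F E | u.1 ∈ N} :=
      hN.preimage (FiberBundle.continuous_proj F E)
    have hne : (L v.1).symm v.2 ≠ (L w.1).symm w.2 := by
      obtain ⟨x, v⟩ := v
      obtain ⟨y, w⟩ := w
      obtain rfl : x = y := h
      intro h
      exact hvw (congrArg _ ((L x).symm.injective h))
    obtain ⟨a, b, ha, hb, hva, hwb, hab⟩ := t2_separation hne
    refine ⟨_, _, hL.isOpen_inter_preimage hS ha, hL.isOpen_inter_preimage hS hb,
      ⟨hvN, hva⟩, ⟨show w.1 ∈ N from h ▸ hvN, hwb⟩, ?_⟩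
    rw [Set.disjoint_left]
    rintro u ⟨-, hua⟩ ⟨-, hub⟩
    exact Set.disjoint_left.1 hab hua hub
  · obtain ⟨a, b, ha, hb, hva, hwb, hab⟩ := t2_separation h
    exact ⟨_, _, ha.preimage (FiberBundle.continuous_proj F E),
      hb.preimage (FiberBundle.continuous_proj F E), hva, hwb, hab.preimage _⟩

theorem continuous_norm_snd [IsContinuousRiemannianBundle F E] :
    Continuous fun v : TotalSpace F E => ‖v.2‖ := by
  have h : Continuous fun v : TotalSpace F E => inner ℝ v.2 v.2 :=
    Continuous.inner_bundle (F := F) (b := fun v : TotalSpace F E => v.1)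
      (v := fun v => v.2) (w := fun v => v.2) continuous_id continuous_id
  have h' : (fun v : TotalSpace F E => ‖v.2‖) = fun v => √(inner ℝ v.2 v.2) := by
    ext v
    rw [real_inner_self_eq_norm_sq, Real.sqrt_sq (norm_nonneg _)]
  rw [h']
  exact h.sqrt

/-- The bundle of balls of radius `R` over a compact set is compact. -/
theorem isCompact_ball_over [FiniteDimensional ℝ F] [IsContinuousRiemannianBundle F E]
    [T2Space B] [LocallyCompactSpace B] {K : Set B} (hK : IsCompact K) (R : ℝ) :
    IsCompact {v : TotalSpace F E | v.1 ∈ K ∧ ‖v.2‖ ≤ R} := by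
  have hclosed : IsClosed {v : TotalSpace F E | v.1 ∈ K ∧ ‖v.2‖ ≤ R} :=
    (hK.isClosed.preimage (FiberBundle.continuous_proj F E)).inter
      (isClosed_le continuous_norm_snd continuous_const)
  suffices h : ∃ C : Set (TotalSpace F E), IsCompact C ∧
      {v : TotalSpace F E | v.1 ∈ K ∧ ‖v.2‖ ≤ R} ⊆ C by
    obtain ⟨C, hC, hsub⟩ := h
    exact hC.of_isClosed_subset hclosed hsub
  refine hK.induction_on
    (p := fun s => ∃ C : Set (TotalSpace F E), IsCompact C ∧ {v | v.1 ∈ s ∧ ‖v.2‖ ≤ R} ⊆ C)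
    ⟨∅, isCompact_empty, by rintro v ⟨hv, -⟩; exact hv.elim⟩ ?_ ?_ ?_
  · rintro s t hst ⟨C, hC, hsub⟩
    exact ⟨C, hC, fun v hv => hsub ⟨hst hv.1, hv.2⟩⟩
  · rintro s t ⟨C, hC, hsub⟩ ⟨C', hC', hsub'⟩
    refine ⟨C ∪ C', hC.union hC', ?_⟩
    rintro v ⟨hv | hv, hv'⟩
    · exact Or.inl (hsub ⟨hv, hv'⟩)
    · exact Or.inr (hsub' ⟨hv, hv'⟩)
  · intro x _
    obtain ⟨N, hN, hxN, L, hL, -⟩ := exists_local_coordinates F E x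
    obtain ⟨N', hN', hsub, hcomp⟩ := local_compact_nhds (hN.mem_nhds hxN)
    have hL' : ContinuousOn (fun p : B × F => ‖L p.1 p.2‖) (N ×ˢ univ) :=
      (continuous_norm_snd (F := F) (E := E)).comp_continuousOn hL
    obtain ⟨m, hm, hmin⟩ : ∃ m > (0 : ℝ), ∀ p ∈ N' ×ˢ Metric.sphere (0 : F) 1,
        m ≤ ‖L p.1 p.2‖ := by
      refine (hcomp.prod (isCompact_sphere 0 1)).exists_forall_le'
        (hL'.mono (prod_mono hsub (subset_univ _))) ?_
      rintro ⟨y, u⟩ ⟨-, hu⟩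
      rw [norm_pos_iff]
      intro h0
      have : u = 0 := (L y).injective (by simpa using h0)
      simp [this] at hu
    refine ⟨N', mem_nhdsWithin_of_mem_nhds hN', _,
      (hcomp.prod (isCompact_closedBall (0 : F) (R / m))).image_of_continuousOn
        (hL.mono (prod_mono hsub (subset_univ _))), ?_⟩
    rintro ⟨y, v⟩ ⟨hy, hv⟩
    refine ⟨(y, (L y).symm v), ⟨hy, ?_⟩, by simp⟩
    rw [mem_closedBall_zero_iff]
    set u := (L y).symm v with hu
    have hv' : ‖L y u‖ ≤ R := by simpa [hu] using hv
    rcases eq_or_ne u 0 with h0 | h0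
    · rw [h0, norm_zero]
      exact div_nonneg ((norm_nonneg _).trans hv') hm.le
    · have h1 := hmin (y, ‖u‖⁻¹ • u) ⟨hy, by
        simp [norm_smul, inv_mul_cancel₀ (norm_ne_zero_iff.2 h0)]⟩
      simp only [map_smul, norm_smul, norm_inv, norm_norm] at h1
      have hpos : 0 < ‖u‖ := norm_pos_iff.2 h0
      rw [le_div_iff₀ hm]
      rw [inv_mul_eq_div, le_div_iff₀ hpos] at h1
      linarith

variable (F E) in
/-- The unit vectors of the bundle with base point in `K`. -/
def sphereOver (K : Set B) : Set (TotalSpace F E) := {v | v.1 ∈ K ∧ ‖v.2‖ = 1}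

theorem isCompact_sphereOver [FiniteDimensional ℝ F] [IsContinuousRiemannianBundle F E]
    [T2Space B] [LocallyCompactSpace B] {K : Set B} (hK : IsCompact K) :
    IsCompact (sphereOver F E K) := by
  refine (isCompact_ball_over hK 1).of_isClosed_subset
    ((hK.isClosed.preimage (FiberBundle.continuous_proj F E)).inter
      (isClosed_eq continuous_norm_snd continuous_const)) ?_
  rintro v ⟨h, h'⟩
  exact ⟨h, h'.le⟩

/-- Positivity on the fibre of a compact set over `x₀` propagates to the nearby fibres. -/
theorem eventually_forall_pos_of_isCompact [T2Space B] {S : Set (TotalSpace F E)}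
    (hS : IsCompact S) {g : TotalSpace F E → ℝ} (hg : ContinuousOn g S) {x₀ : B}
    (h : ∀ v ∈ S, v.1 = x₀ → 0 < g v) :
    ∀ᶠ x in 𝓝 x₀, ∀ v ∈ S, v.1 = x → 0 < g v := by
  have hC : IsCompact (S ∩ g ⁻¹' Iic 0) := by
    obtain ⟨t, ht, hteq⟩ := continuousOn_iff_isClosed.1 hg _ isClosed_Iic
    rw [inter_comm, hteq, inter_comm]
    exact hS.inter_right ht
  have hcl := (hC.image (FiberBundle.continuous_proj F E)).isClosed
  have hx : x₀ ∈ (TotalSpace.proj '' (S ∩ g ⁻¹' Iic 0))ᶜ := by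
    rintro ⟨v, ⟨hv, hv'⟩, hvx⟩
    exact absurd (h v hv hvx) (not_lt.2 hv')
  filter_upwards [hcl.isOpen_compl.mem_nhds hx] with x hx v hv hvx
  by_contra hcon
  exact hx ⟨v, ⟨hv, not_lt.1 hcon⟩, hvx⟩

/-- Positivity on the unit sphere of the fibre over `x₀` propagates to the nearby fibres. -/
theorem eventually_forall_pos [FiniteDimensional ℝ F] [IsContinuousRiemannianBundle F E]
    [T2Space B] [LocallyCompactSpace B] {g : TotalSpace F E → ℝ} (hg : Continuous g) {x₀ : B}
    (h : ∀ v : E x₀, ‖v‖ = 1 → 0 < g ⟨x₀, v⟩) :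
    ∀ᶠ x in 𝓝 x₀, ∀ v : E x, ‖v‖ = 1 → 0 < g ⟨x, v⟩ := by
  obtain ⟨N, hN, hNx⟩ := exists_compact_mem_nhds x₀
  have := eventually_forall_pos_of_isCompact (isCompact_sphereOver (F := F) (E := E) hN)
    hg.continuousOn (x₀ := x₀) (by
      rintro ⟨x, v⟩ ⟨-, hv⟩ hx
      obtain rfl : x = x₀ := hx
      exact h v hv)
  filter_upwards [this, hNx] with x hx hxN v hv
  exact hx ⟨x, v⟩ ⟨hxN, hv⟩ rfl

theorem finrank_fiber [FiniteDimensional ℝ F] (x : B) :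
    Module.finrank ℝ (E x) = Module.finrank ℝ F :=
  (((trivializationAt F E x).continuousLinearEquivAt ℝ x
    (FiberBundle.mem_baseSet_trivializationAt' x)).toLinearEquiv).finrank_eq

variable (F) in
theorem finiteDimensional_fiber [FiniteDimensional ℝ F] (x : B) : FiniteDimensional ℝ (E x) :=
  (((trivializationAt F E x).continuousLinearEquivAt ℝ x
    (FiberBundle.mem_baseSet_trivializationAt' x)).symm.toLinearEquiv).finiteDimensional

end Bundle

/-! ### Quadratic forms and subspaces of finite-dimensional spaces -/

section QuadraticForms

variable {V : Type*} [AddCommGroup V] [Module ℝ V]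

/-- The comparison behind the S-lemma: if `R ≥ 0` wherever `Q ≥ 0`, then the ratio `R / Q` at any
`Q`-positive vector is at least its value at any `Q`-negative vector. The proof evaluates `R` at the
two isotropic vectors `v + s w` of `Q` in the plane of `v` and `w`, whose parameters `s` have
opposite signs. -/
theorem mul_le_mul_of_nonneg_imp_nonneg {Q R : QuadraticForm ℝ V}
    (h : ∀ v, 0 ≤ Q v → 0 ≤ R v) {v w : V} (hv : 0 < Q v) (hw : Q w < 0) :
    R v * Q w ≤ R w * Q v := by
  obtain ⟨β, hβ⟩ : ∃ β, β = QuadraticMap.polar Q v w := ⟨_, rfl⟩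
  obtain ⟨γ, hγ⟩ : ∃ γ, γ = QuadraticMap.polar R v w := ⟨_, rfl⟩
  have hQ : ∀ s : ℝ, Q (v + s • w) = Q v + s * β + s ^ 2 * Q w := by
    intro s
    rw [QuadraticMap.map_add Q, QuadraticMap.polar_smul_right, QuadraticMap.map_smul, hβ,
      smul_eq_mul, smul_eq_mul]
    ring
  have hR : ∀ s : ℝ, R (v + s • w) = R v + s * γ + s ^ 2 * R w := by
    intro s
    rw [QuadraticMap.map_add R, QuadraticMap.polar_smul_right, QuadraticMap.map_smul, hγ,
      smul_eq_mul, smul_eq_mul]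
    ring
  obtain ⟨b, hb⟩ : ∃ b, b = -Q w := ⟨_, rfl⟩
  have hb0 : 0 < b := by linarith
  obtain ⟨D, hD⟩ : ∃ D, D = √(β ^ 2 + 4 * b * Q v) := ⟨_, rfl⟩
  have hpos : β ^ 2 < β ^ 2 + 4 * b * Q v := by nlinarith [mul_pos hv hb0]
  have hDsq : D ^ 2 = β ^ 2 + 4 * b * Q v := by
    rw [hD]; exact Real.sq_sqrt ((sq_nonneg β).trans hpos.le)
  have hDβ : |β| < D := by
    rw [hD, ← Real.sqrt_sq_eq_abs]
    exact Real.sqrt_lt_sqrt (sq_nonneg _) hpos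
  obtain ⟨h1, h2⟩ := abs_lt.1 hDβ
  have key : ∀ s : ℝ, s ^ 2 * b = Q v + s * β →
      0 ≤ b * R v + Q v * R w + s * (γ * b + β * R w) := by
    intro s hs
    have h0 : s ^ 2 * Q w = -(s ^ 2 * b) := by rw [hb]; ring
    have := h (v + s • w) (by rw [hQ]; linarith)
    rw [hR] at this
    have h3 : b * (R v + s * γ + s ^ 2 * R w) =
        b * R v + Q v * R w + s * (γ * b + β * R w) := by
      linear_combination R w * hs
    rw [← h3]
    exact mul_nonneg hb0.le this
  have hroot : ∀ σ : ℝ, σ ^ 2 = D ^ 2 →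
      ((β + σ) / (2 * b)) ^ 2 * b = Q v + (β + σ) / (2 * b) * β := by
    intro σ hσ
    field_simp
    nlinarith
  have k1 := key _ (hroot D rfl)
  have k2 := key _ (hroot (-D) (by ring))
  have s1 : 0 < (β + D) / (2 * b) := by apply div_pos <;> linarith
  have s2 : (β + -D) / (2 * b) < 0 := by apply div_neg_of_neg_of_pos <;> linarith
  have : 0 ≤ b * R v + Q v * R w := by
    rcases le_total 0 (γ * b + β * R w) with h0 | h0
    · nlinarith [mul_nonpos_of_nonpos_of_nonneg s2.le h0]
    · nlinarith [mul_nonpos_of_nonneg_of_nonpos s1.le h0]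
  rw [hb] at this
  linarith

/-- `Q` is positive definite on a subspace of dimension `p` and negative definite on a subspace of
dimension `q`. -/
def HasSignature (Q : QuadraticForm ℝ V) (p q : ℕ) : Prop :=
  (∃ P : Submodule ℝ V, Module.finrank ℝ P = p ∧ ∀ v ∈ P, v ≠ 0 → 0 < Q v) ∧
    ∃ N : Submodule ℝ V, Module.finrank ℝ N = q ∧ ∀ v ∈ N, v ≠ 0 → Q v < 0

theorem HasSignature.comp_equiv {W : Type*} [AddCommGroup W] [Module ℝ W]
    {Q : QuadraticForm ℝ W} {p q : ℕ} (h : HasSignature Q p q) (e : V ≃ₗ[ℝ] W) :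
    HasSignature (Q.comp (e : V →ₗ[ℝ] W)) p q := by
  obtain ⟨⟨P, hP, hP'⟩, N, hN, hN'⟩ := h
  refine ⟨⟨P.map (e.symm : W →ₗ[ℝ] V), ?_, ?_⟩, N.map (e.symm : W →ₗ[ℝ] V), ?_, ?_⟩
  · rw [← hP]; exact LinearEquiv.finrank_map_eq e.symm P
  · rintro _ ⟨v, hv, rfl⟩ hne
    simpa using hP' v hv (by rintro rfl; simp at hne)
  · rw [← hN]; exact LinearEquiv.finrank_map_eq e.symm N
  · rintro _ ⟨v, hv, rfl⟩ hne
    simpa using hN' v hv (by rintro rfl; simp at hne)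

variable [FiniteDimensional ℝ V] {Q : QuadraticForm ℝ V} {p q : ℕ}

theorem HasSignature.le_sig (h : HasSignature Q p q) :
    p ≤ sigPos Q ∧ q ≤ sigNeg Q := by
  obtain ⟨⟨P, hP, hP'⟩, N, hN, hN'⟩ := h
  constructor
  · rw [← hP]
    refine le_sigPos_of_posDef Q fun v hv => ?_
    simpa using hP' v v.2 (by simpa using hv)
  · rw [← hN]
    refine le_sigNeg_of_negDef Q fun v hv => ?_
    simpa using hN' v v.2 (by simpa using hv)

theorem HasSignature.nondegenerate (h : HasSignature Q p q)
    (hn : p + q = Module.finrank ℝ V) : (QuadraticMap.polarBilin Q).Nondegenerate := by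
  have h1 := QuadraticForm.sigPos_add_sigNeg_add_radical (Q := Q)
  have h2 := h.le_sig
  have h3 : Module.finrank ℝ Q.radical = 0 := by omega
  rw [QuadraticMap.nondegenerate_polar_iff, QuadraticMap.nondegenerate_iff_radical_eq_bot]
  exact Submodule.finrank_eq_zero.1 h3

theorem HasSignature.isGreatest (h : HasSignature Q p q) (hn : p + q = Module.finrank ℝ V) :
    IsGreatest {d : ℕ | ∃ W : Submodule ℝ V, (∀ v ∈ W, Q v ≤ 0) ∧ Module.finrank ℝ W = d} q := by
  have h2 := h.le_sig
  refine ⟨?_, ?_⟩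
  · obtain ⟨-, N, hN, hN'⟩ := h
    refine ⟨N, fun v hv => ?_, hN⟩
    rcases eq_or_ne v 0 with rfl | h0
    · simp
    · exact (hN' v hv h0).le
  · rintro d ⟨W, hW, rfl⟩
    have := QuadraticForm.sigPos_add_finrank_le_of_nonpos hW
    omega

/-- For a non-degenerate form, the maximal dimension of a non-positive subspace is the number of
negative squares. -/
theorem exists_posDef_of_isGreatest (hQ : (QuadraticMap.polarBilin Q).Nondegenerate)
    (hq : IsGreatest
      {d : ℕ | ∃ W : Submodule ℝ V, (∀ v ∈ W, Q v ≤ 0) ∧ Module.finrank ℝ W = d} q)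
    (hn : p + q = Module.finrank ℝ V) :
    ∃ P : Submodule ℝ V, Module.finrank ℝ P = p ∧ ∀ v ∈ P, v ≠ 0 → 0 < Q v := by
  have h1 := QuadraticForm.sigPos_add_sigNeg_add_radical (Q := Q)
  rw [QuadraticMap.nondegenerate_polar_iff, QuadraticMap.nondegenerate_iff_radical_eq_bot] at hQ
  rw [hQ, finrank_bot] at h1
  obtain ⟨N, hN, hN'⟩ := exists_finrank_eq_sigNeg_and_negDef Q
  obtain ⟨⟨W, hW, hWq⟩, hmax⟩ := hq
  have h2 := QuadraticForm.sigPos_add_finrank_le_of_nonpos hW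
  have h3 : Module.finrank ℝ N ≤ q := by
    refine hmax ⟨N, fun v hv => ?_, rfl⟩
    rcases eq_or_ne v 0 with rfl | h0
    · simp
    · have := hN' ⟨v, hv⟩ (by simpa using h0)
      simp at this
      exact this.le
  obtain ⟨P, hP, hP'⟩ := exists_finrank_eq_sigPos_and_posDef Q
  refine ⟨P, by omega, fun v hv h0 => ?_⟩
  simpa using hP' ⟨v, hv⟩ (by simpa using h0)

end QuadraticForms

section Limits

/-- A decreasing sequence of closed sets, each containing a `d`-dimensional subspace, has an
intersection containing a `d`-dimensional subspace: the sets of orthonormal `d`-frames spanning a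
subspace of the `k`-th set are compact and nested. -/
theorem exists_submodule_subset_iInter {V : Type*} [NormedAddCommGroup V] [InnerProductSpace ℝ V]
    [FiniteDimensional ℝ V] {C : ℕ → Set V} (hC : ∀ k, IsClosed (C k))
    (hanti : ∀ k, C (k + 1) ⊆ C k) {d : ℕ}
    (h : ∀ k, ∃ L : Submodule ℝ V, Module.finrank ℝ L = d ∧ (L : Set V) ⊆ C k) :
    ∃ L : Submodule ℝ V, Module.finrank ℝ L = d ∧ (L : Set V) ⊆ ⋂ k, C k := by
  set K : ℕ → Set (Fin d → V) := fun k =>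
    {b | Orthonormal ℝ b ∧ ∀ a : Fin d → ℝ, ∑ i, a i • b i ∈ C k} with hK
  have hcl : ∀ k, IsClosed (K k) := by
    intro k
    have h1 : IsClosed {b : Fin d → V | Orthonormal ℝ b} := by
      classical
      simp only [orthonormal_iff_ite, Set.ofPred_forall]
      refine isClosed_iInter fun i => isClosed_iInter fun j => ?_
      exact isClosed_eq (by fun_prop) continuous_const
    have h2 : IsClosed {b : Fin d → V | ∀ a : Fin d → ℝ, ∑ i, a i • b i ∈ C k} := by
      simp only [Set.ofPred_forall]
      refine isClosed_iInter fun a => ?_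
      exact (hC k).preimage (by fun_prop)
    exact h1.inter h2
  have hne : ∀ k, (K k).Nonempty := by
    intro k
    obtain ⟨L, hL, hLC⟩ := h k
    let b := (stdOrthonormalBasis ℝ L).reindex (finCongr hL)
    refine ⟨fun i => (b i : V), ?_, fun a => hLC ?_⟩
    · exact b.orthonormal.comp_linearIsometry L.subtypeₗᵢ
    · exact Submodule.sum_mem _ fun i _ => Submodule.smul_mem _ _ (b i).2
  have hcomp : IsCompact (K 0) := by
    refine (isCompact_univ_pi fun _ : Fin d => isCompact_closedBall (0 : V) 1).of_isClosed_subset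
      (hcl 0) ?_
    rintro b ⟨hb, -⟩ i -
    simp [hb.1 i]
  obtain ⟨b, hb⟩ := IsCompact.nonempty_iInter_of_sequence_nonempty_isCompact_isClosed K
    (fun k b hb => ⟨hb.1, fun a => hanti k (hb.2 a)⟩) hne hcomp hcl
  rw [mem_iInter] at hb
  refine ⟨Submodule.span ℝ (range b), ?_, fun v hv => mem_iInter.2 fun k => ?_⟩
  · simpa using finrank_span_eq_card (hb 0).1.linearIndependent
  · obtain ⟨a, rfl⟩ := (Submodule.mem_span_range_iff_exists_fun ℝ).1 hv
    exact (hb k).2 a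

end Limits

/-! ### The maximal invariant set of a trapping region -/

section Trapping

variable {M : Type*} [TopologicalSpace M] {φ : Flow ℝ≥0 M} {U : Opens M}

theorem IsTrappingRegion.maximalInvariantSet_subset (hU : IsTrappingRegion φ U) :
    maximalInvariantSet φ U ⊆ U := by
  obtain ⟨T, hT, h⟩ := hU.closure_subset
  intro x hx
  exact h (T + 1) (lt_add_one T) (mem_iInter.1 hx ⟨T + 1, by positivity⟩)

theorem isClosed_maximalInvariantSet : IsClosed (maximalInvariantSet φ U) :=
  isClosed_iInter fun _ => isClosed_closure

theorem IsTrappingRegion.closure_image_anti (hU : IsTrappingRegion φ U) {s t : ℝ≥0}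
    (hst : s ≤ t) : closure (φ t '' (U : Set M)) ⊆ closure (φ s '' (U : Set M)) := by
  refine closure_mono ?_
  rintro _ ⟨x, hx, rfl⟩
  obtain ⟨r, rfl⟩ := exists_add_of_le hst
  exact ⟨φ r x, hU.isInvariant r hx, (φ.map_add s r x).symm⟩

theorem IsTrappingRegion.isCompact_preimage [T2Space M] [CompactSpace M]
    (hU : IsTrappingRegion φ U) :
    IsCompact {x : U | (x : M) ∈ maximalInvariantSet φ U} := by
  rw [Subtype.isCompact_iff]
  have : ((↑) : U → M) '' {x : U | (x : M) ∈ maximalInvariantSet φ U} =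
      maximalInvariantSet φ U := by
    ext x
    constructor
    · rintro ⟨y, hy, rfl⟩
      exact hy
    · intro hx
      exact ⟨⟨x, hU.maximalInvariantSet_subset hx⟩, hx, rfl⟩
  rw [this]
  exact isClosed_maximalInvariantSet.isCompact

theorem maximalInvariantSet_map_mem (hU : IsTrappingRegion φ U) (t : ℝ≥0) {x : M}
    (hx : x ∈ maximalInvariantSet φ U) : φ t x ∈ maximalInvariantSet φ U := by
  refine mem_iInter.2 fun s => ?_
  have h1 : φ t x ∈ closure (φ t '' (φ s '' (U : Set M))) :=
    image_closure_subset_closure_image (φ.continuous_toFun t) ⟨x, mem_iInter.1 hx s, rfl⟩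
  refine closure_mono ?_ h1
  rintro _ ⟨_, ⟨y, hy, rfl⟩, rfl⟩
  exact ⟨φ t y, hU.isInvariant t hy, by rw [← φ.map_add, ← φ.map_add, add_comm]⟩

/-- The time-`t` map is onto the maximal invariant set: by compactness, a point of the set has
preimages in all the closures `closure (φ s '' U)`, and they agree by injectivity. -/
theorem exists_map_eq_of_mem_maximalInvariantSet [T2Space M] [CompactSpace M] {t : ℝ≥0}
    (hinj : Function.Injective (φ t)) {x : M} (hx : x ∈ maximalInvariantSet φ U) :
    ∃ y ∈ maximalInvariantSet φ U, φ t y = x := by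
  have h : ∀ s : {s : ℝ≥0 // 0 < s}, ∃ y ∈ closure (φ s '' (U : Set M)), φ t y = x := by
    intro s
    have h1 : x ∈ closure (φ (t + s) '' (U : Set M)) :=
      mem_iInter.1 hx ⟨t + s, add_pos_of_nonneg_of_pos (zero_le) s.2⟩
    have h2 : IsClosed (φ t '' closure (φ s '' (U : Set M))) :=
      (isClosed_closure.isCompact.image (φ.continuous_toFun t)).isClosed
    refine closure_minimal ?_ h2 h1
    rintro _ ⟨y, hy, rfl⟩
    exact ⟨φ s y, subset_closure ⟨y, hy, rfl⟩, (φ.map_add _ _ _).symm⟩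
  obtain ⟨y, -, hy⟩ := h ⟨1, one_pos⟩
  refine ⟨y, mem_iInter.2 fun s => ?_, hy⟩
  obtain ⟨z, hz, hzx⟩ := h s
  rwa [hinj (hy.trans hzx.symm)]

/-- Every neighbourhood of the maximal invariant set absorbs the trapping region in a uniform
time. -/
theorem IsTrappingRegion.exists_forall_flow_mem [T2Space M] [CompactSpace M]
    (hU : IsTrappingRegion φ U) {V : Set U} (hV : IsOpen V)
    (hΛ : {x : U | (x : M) ∈ maximalInvariantSet φ U} ⊆ V) :
    ∃ τ : ℝ≥0, ∀ t, τ ≤ t → ∀ x : U, hU.flow t x ∈ V := by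
  have hV' : IsOpen (((↑) : U → M) '' V) := U.isOpen.isOpenMap_subtype_val _ hV
  have hsub : (⋂ t : {t : ℝ≥0 // 0 < t}, closure (φ t '' (U : Set M))) ⊆ ((↑) : U → M) '' V :=
    fun x hx => ⟨⟨x, hU.maximalInvariantSet_subset hx⟩, hΛ hx, rfl⟩
  have : Nonempty {t : ℝ≥0 // 0 < t} := ⟨⟨1, one_pos⟩⟩
  obtain ⟨t, ht⟩ := exists_subset_nhds_of_isCompact'
    (V := fun t : {t : ℝ≥0 // 0 < t} => closure (φ t '' (U : Set M)))
    (fun s t => ⟨⟨max s t, lt_max_of_lt_left s.2⟩,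
      hU.closure_image_anti (le_max_left _ _), hU.closure_image_anti (le_max_right _ _)⟩)
    (fun _ => isClosed_closure.isCompact) (fun _ => isClosed_closure)
    (fun x hx => hV'.mem_nhds (hsub hx))
  refine ⟨t, fun s hs x => ?_⟩
  obtain ⟨y, hy, hyx⟩ := ht (hU.closure_image_anti hs (subset_closure ⟨x, x.2, rfl⟩))
  have : y = hU.flow s x := Subtype.ext hyx
  rwa [← this]

end Trapping

/-! ### The flow of a linear cocycle on the total space -/

section Scaling

variable {B : Type*} {F : Type*} {E : B → Type*} [∀ x, NormedAddCommGroup (E x)]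
  [∀ x, InnerProductSpace ℝ (E x)]

/-- The norm of the fibres, as a function on the total space. -/
def fiberNorm (v : TotalSpace F E) : ℝ := ‖v.2‖

/-- A field of quadratic forms, as a function on the total space. -/
def fiberForm (J : ∀ x : B, QuadraticForm ℝ (E x)) (v : TotalSpace F E) : ℝ := J v.1 v.2

/-- Scalar multiplication in the fibres, as a self-map of the total space. -/
def fiberSMul (c : ℝ) (v : TotalSpace F E) : TotalSpace F E := ⟨v.1, c • v.2⟩

theorem fiberNorm_nonneg (v : TotalSpace F E) : 0 ≤ fiberNorm v := norm_nonneg _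

theorem fiberNorm_pos_iff {v : TotalSpace F E} : 0 < fiberNorm v ↔ v.2 ≠ 0 := norm_pos_iff

theorem fiberNorm_smul (c : ℝ) (v : TotalSpace F E) :
    fiberNorm (fiberSMul c v) = |c| * fiberNorm v := norm_smul c v.2

theorem fiberForm_smul (J : ∀ x : B, QuadraticForm ℝ (E x)) (c : ℝ) (v : TotalSpace F E) :
    fiberForm J (fiberSMul c v) = c ^ 2 * fiberForm J v := by
  rw [sq]
  exact (J v.1).map_smul c v.2

theorem fiberForm_of_fiberNorm_eq_zero (J : ∀ x : B, QuadraticForm ℝ (E x))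
    {v : TotalSpace F E} (h : fiberNorm v = 0) : fiberForm J v = 0 := by
  have : v.2 = 0 := norm_eq_zero.1 h
  simp [fiberForm, this]

theorem fiberNorm_normalize {v : TotalSpace F E} (h : 0 < fiberNorm v) :
    fiberNorm (fiberSMul (fiberNorm v)⁻¹ v) = 1 := by
  rw [fiberNorm_smul, abs_of_pos (inv_pos.2 h), inv_mul_cancel₀ h.ne']

end Scaling

section Cocycle

variable {EM : Type*} [NormedAddCommGroup EM] [NormedSpace ℝ EM]
  {H : Type*} [TopologicalSpace H] {I : ModelWithCorners ℝ EM H}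
  {B : Type*} [TopologicalSpace B] [ChartedSpace H B]
  {F : Type*} [NormedAddCommGroup F] [NormedSpace ℝ F]
  {E : B → Type*} [TopologicalSpace (TotalSpace F E)] [∀ x, NormedAddCommGroup (E x)]
  [∀ x, InnerProductSpace ℝ (E x)] [FiberBundle F E]
  {ψ : Flow ℝ≥0 B} (A : LinearCocycle I F E ψ)

/-- The semiflow that the cocycle induces on the total space of the bundle. -/
def LinearCocycle.totalFlow : Flow ℝ≥0 (TotalSpace F E) where
  toFun t v := ⟨ψ t v.1, A.toFun t v.1 v.2⟩
  cont' := A.continuous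
  map_add' t s v := A.map_add t s v.1 v.2
  map_zero' v := A.map_zero v.1 v.2

theorem LinearCocycle.totalFlow_mk (t : ℝ≥0) (x : B) (v : E x) :
    A.totalFlow t ⟨x, v⟩ = ⟨ψ t x, A.toFun t x v⟩ := rfl

theorem LinearCocycle.totalFlow_proj (t : ℝ≥0) (v : TotalSpace F E) :
    (A.totalFlow t v).1 = ψ t v.1 := rfl

theorem LinearCocycle.totalFlow_injective {t : ℝ≥0} (h : Function.Injective (ψ t)) :
    Function.Injective (A.totalFlow t) := by
  rintro ⟨x, v⟩ ⟨y, w⟩ hvw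
  obtain rfl : x = y := h (congrArg TotalSpace.proj hvw)
  rw [A.totalFlow_mk, A.totalFlow_mk, TotalSpace.mk_inj] at hvw
  rw [(A.toFun t x).injective hvw]

theorem LinearCocycle.totalFlow_smul (t : ℝ≥0) (c : ℝ) (v : TotalSpace F E) :
    A.totalFlow t (fiberSMul c v) = fiberSMul c (A.totalFlow t v) :=
  congrArg (TotalSpace.mk _) ((A.toFun t v.1).map_smul c v.2)

theorem LinearCocycle.fiberNorm_totalFlow_pos {t : ℝ≥0} {v : TotalSpace F E} :
    0 < fiberNorm (A.totalFlow t v) ↔ 0 < fiberNorm v := by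
  rw [fiberNorm_pos_iff, fiberNorm_pos_iff]
  exact (A.toFun t v.1).map_ne_zero_iff

/-- Strict separation: the nonzero vectors of the closed cone `𝓙 ≥ 0` are mapped to `𝓙 > 0`. -/
theorem LinearCocycle.isStrictlySeparated_iff {J : ∀ x : B, QuadraticForm ℝ (E x)} :
    A.IsStrictlySeparated J ↔ ∀ t : ℝ≥0, 0 < t → ∀ v : TotalSpace F E, 0 < fiberNorm v →
      0 ≤ fiberForm J v → 0 < fiberForm J (A.totalFlow t v) := by
  constructor
  · intro h t ht v hv hJ
    have hmem : v.2 ∈ positiveCone (J v.1) ∪ zeroCone (J v.1) := by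
      rcases hJ.eq_or_lt with h0 | h0
      · exact Or.inr h0.symm
      · exact Or.inl (Or.inr h0)
    rcases h t v.1 ht ⟨v.2, hmem, rfl⟩ with h0 | h0
    · exact absurd h0 (fiberNorm_pos_iff.1 (A.fiberNorm_totalFlow_pos.2 hv))
    · exact h0
  · rintro h t x ht _ ⟨v, hv, rfl⟩
    rcases eq_or_ne v 0 with rfl | hv0
    · left
      simp
    · right
      refine h t ht ⟨x, v⟩ (fiberNorm_pos_iff.2 hv0) ?_
      rcases hv with (hv | hv) | hv
      · exact absurd hv hv0
      · exact le_of_lt hv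
      · exact hv.ge

/-- Uniform two-sided bounds for the growth of vectors over a compact set, for times in a compact
set. -/
theorem LinearCocycle.exists_norm_bounds [VectorBundle ℝ F E] [FiniteDimensional ℝ F]
    [IsContinuousRiemannianBundle F E]
    [T2Space B] [LocallyCompactSpace B] {K : Set B} (hK : IsCompact K) (t₀ : ℝ≥0) :
    ∃ m C : ℝ, 0 < m ∧ 0 < C ∧ ∀ t ≤ t₀, ∀ v : TotalSpace F E, v.1 ∈ K →
      m * fiberNorm v ≤ fiberNorm (A.totalFlow t v) ∧
        fiberNorm (A.totalFlow t v) ≤ C * fiberNorm v := by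
  have hS : IsCompact (Iic t₀ ×ˢ sphereOver F E K) := by
    refine IsCompact.prod ?_ (isCompact_sphereOver hK)
    rw [← Icc_bot]
    exact isCompact_Icc
  have hcont : Continuous fun p : ℝ≥0 × TotalSpace F E => fiberNorm (A.totalFlow p.1 p.2) :=
    continuous_norm_snd.comp A.continuous
  obtain ⟨m, hm, hmin⟩ := hS.exists_forall_le' hcont.continuousOn (a := 0) (by
    rintro ⟨t, v⟩ ⟨-, -, hv⟩
    refine A.fiberNorm_totalFlow_pos.2 ?_
    rw [show fiberNorm v = 1 from hv]
    exact one_pos)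
  obtain ⟨C, hC⟩ := hS.bddAbove_image hcont.continuousOn
  refine ⟨m, max C 1, hm, by positivity, ?_⟩
  intro t ht v hx
  rcases (fiberNorm_nonneg v).eq_or_lt with hv | hv
  · have h0 : fiberNorm (A.totalFlow t v) = 0 := by
      by_contra h0
      exact hv.not_lt (A.fiberNorm_totalFlow_pos.1
        (lt_of_le_of_ne (fiberNorm_nonneg _) (Ne.symm h0)))
    simp [h0, ← hv]
  · have hmem : (t, fiberSMul (fiberNorm v)⁻¹ v) ∈ Iic t₀ ×ˢ sphereOver F E K :=
      ⟨ht, hx, fiberNorm_normalize hv⟩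
    have h1 : m ≤ fiberNorm (A.totalFlow t (fiberSMul (fiberNorm v)⁻¹ v)) := hmin _ hmem
    have h2 : fiberNorm (A.totalFlow t (fiberSMul (fiberNorm v)⁻¹ v)) ≤ max C 1 :=
      (hC ⟨_, hmem, rfl⟩).trans (le_max_left C 1)
    rw [A.totalFlow_smul, fiberNorm_smul, abs_of_pos (inv_pos.2 hv), inv_mul_eq_div] at h1 h2
    rw [le_div_iff₀ hv] at h1
    rw [div_le_iff₀ hv] at h2
    exact ⟨h1, h2⟩

end Cocycle

/-! ### The invariant cones of a strictly separated cocycle -/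

section Cones

variable {EM : Type*} [NormedAddCommGroup EM] [NormedSpace ℝ EM]
  {H : Type*} [TopologicalSpace H] {I : ModelWithCorners ℝ EM H}
  {B : Type*} [TopologicalSpace B] [ChartedSpace H B]
  {F : Type*} [NormedAddCommGroup F] [NormedSpace ℝ F]
  {E : B → Type*} [TopologicalSpace (TotalSpace F E)] [∀ x, NormedAddCommGroup (E x)]
  [∀ x, InnerProductSpace ℝ (E x)] [FiberBundle F E]
  {ψ : Flow ℝ≥0 B} {A : LinearCocycle I F E ψ}

/-- A compact set on which the semiflow `ψ`, whose time-`t` maps are injective, is onto: there `ψ`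
restricts to a flow in both directions of time. -/
structure IsCompactInvariant (ψ : Flow ℝ≥0 B) (Λ : Set B) : Prop where
  isCompact : IsCompact Λ
  map_mem : ∀ t, ∀ x ∈ Λ, ψ t x ∈ Λ
  exists_map_eq : ∀ t, ∀ x ∈ Λ, ∃ y ∈ Λ, ψ t y = x
  injective : ∀ t, Function.Injective (ψ t)

/-- The form `J` is positive on the image under the cocycle, at any positive time, of any nonzero
vector on which it is non-negative. -/
def IsStrictlyPositiveFor (A : LinearCocycle I F E ψ) (J : ∀ x : B, QuadraticForm ℝ (E x)) : Prop :=
  ∀ t : ℝ≥0, 0 < t → ∀ v : TotalSpace F E, 0 < fiberNorm v → 0 ≤ fiberForm J v →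
    0 < fiberForm J (A.totalFlow t v)

/-- The vectors over `Λ` whose whole past lies in the cone `𝓙 ≥ 0`. -/
def unstableCone (A : LinearCocycle I F E ψ) (J : ∀ x : B, QuadraticForm ℝ (E x)) (Λ : Set B) :
    Set (TotalSpace F E) :=
  {v | v.1 ∈ Λ ∧ ∀ t u, u.1 ∈ Λ → A.totalFlow t u = v → 0 ≤ fiberForm J u}

/-- The vectors over `Λ` whose whole future lies in the cone `𝓙 ≤ 0`. -/
def stableCone (A : LinearCocycle I F E ψ) (J : ∀ x : B, QuadraticForm ℝ (E x)) (Λ : Set B) :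
    Set (TotalSpace F E) :=
  {v | v.1 ∈ Λ ∧ ∀ t, fiberForm J (A.totalFlow t v) ≤ 0}

variable {J : ∀ x : B, QuadraticForm ℝ (E x)} {Λ : Set B}

theorem IsCompactInvariant.exists_totalFlow_eq (hΛ : IsCompactInvariant ψ Λ)
    (A : LinearCocycle I F E ψ) (t : ℝ≥0) {v : TotalSpace F E} (hv : v.1 ∈ Λ) :
    ∃ u : TotalSpace F E, u.1 ∈ Λ ∧ A.totalFlow t u = v := by
  obtain ⟨x, v⟩ := v
  obtain ⟨y, hy, rfl⟩ := hΛ.exists_map_eq t x hv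
  refine ⟨⟨y, (A.toFun t y).symm v⟩, hy, ?_⟩
  rw [A.totalFlow_mk, ContinuousLinearEquiv.apply_symm_apply]

theorem IsStrictlyPositiveFor.nonneg (hJ : IsStrictlyPositiveFor A J) (t : ℝ≥0)
    {v : TotalSpace F E} (h : 0 ≤ fiberForm J v) : 0 ≤ fiberForm J (A.totalFlow t v) := by
  rcases eq_or_lt_of_le (zero_le : 0 ≤ t) with rfl | ht
  · rwa [A.totalFlow.map_zero_apply]
  rcases (fiberNorm_nonneg v).eq_or_lt with hv | hv
  · refine (fiberForm_of_fiberNorm_eq_zero J ?_).ge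
    by_contra h0
    exact hv.not_lt (A.fiberNorm_totalFlow_pos.1 (lt_of_le_of_ne (fiberNorm_nonneg _) (Ne.symm h0)))
  · exact (hJ t ht v hv h).le

theorem IsStrictlyPositiveFor.nonpos_of_totalFlow (hJ : IsStrictlyPositiveFor A J) (t : ℝ≥0)
    {v : TotalSpace F E} (h : fiberForm J (A.totalFlow t v) ≤ 0) : fiberForm J v ≤ 0 := by
  rcases eq_or_lt_of_le (zero_le : 0 ≤ t) with rfl | ht
  · rwa [A.totalFlow.map_zero_apply] at h
  by_contra h0
  rw [not_le] at h0
  have hv : 0 < fiberNorm v := by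
    refine lt_of_le_of_ne (fiberNorm_nonneg _) fun hv => ?_
    rw [fiberForm_of_fiberNorm_eq_zero J hv.symm] at h0
    exact lt_irrefl _ h0
  exact absurd (hJ t ht v hv h0.le) (not_lt.2 h)

theorem unstableCone_nonneg {v : TotalSpace F E} (hv : v ∈ unstableCone A J Λ) :
    0 ≤ fiberForm J v :=
  hv.2 0 v hv.1 (A.totalFlow.map_zero_apply v)

theorem stableCone_nonpos {v : TotalSpace F E} (hv : v ∈ stableCone A J Λ) :
    fiberForm J v ≤ 0 := by
  simpa using hv.2 0

theorem totalFlow_mem_unstableCone_iff (hΛ : IsCompactInvariant ψ Λ)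
    (hJ : IsStrictlyPositiveFor A J) (t : ℝ≥0) {v : TotalSpace F E} (hvΛ : v.1 ∈ Λ) :
    A.totalFlow t v ∈ unstableCone A J Λ ↔ v ∈ unstableCone A J Λ := by
  constructor
  · intro h
    refine ⟨hvΛ, fun s u hu hus => h.2 (t + s) u hu ?_⟩
    rw [A.totalFlow.map_add, hus]
  · intro h
    refine ⟨hΛ.map_mem t _ hvΛ, fun s u hu hus => ?_⟩
    rcases le_total s t with hst | hst
    · obtain ⟨r, rfl⟩ := exists_add_of_le hst
      rw [A.totalFlow.map_add] at hus
      rw [A.totalFlow_injective (hΛ.injective s) hus]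
      exact hJ.nonneg r (unstableCone_nonneg h)
    · obtain ⟨r, rfl⟩ := exists_add_of_le hst
      rw [A.totalFlow.map_add] at hus
      exact h.2 r u hu (A.totalFlow_injective (hΛ.injective t) hus)

theorem totalFlow_mem_stableCone_iff (hΛ : IsCompactInvariant ψ Λ)
    (hJ : IsStrictlyPositiveFor A J) (t : ℝ≥0) {v : TotalSpace F E} (hvΛ : v.1 ∈ Λ) :
    A.totalFlow t v ∈ stableCone A J Λ ↔ v ∈ stableCone A J Λ := by
  constructor
  · intro h
    refine ⟨hvΛ, fun s => hJ.nonpos_of_totalFlow t ?_⟩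
    rw [← A.totalFlow.map_add, add_comm, A.totalFlow.map_add]
    exact h.2 s
  · intro h
    refine ⟨hΛ.map_mem t _ hvΛ, fun s => ?_⟩
    rw [← A.totalFlow.map_add]
    exact h.2 _

variable [VectorBundle ℝ F E] [FiniteDimensional ℝ F] [IsContinuousRiemannianBundle F E]
  [T2Space B] [LocallyCompactSpace B]

/-- A continuous function, homogeneous of degree two on the fibres, is bounded over a compact set
by a multiple of the square of the norm. -/
theorem exists_abs_le_mul_sq {K : Set B} (hK : IsCompact K) {g : TotalSpace F E → ℝ}
    (hg : Continuous g) (hom : ∀ c v, g (fiberSMul c v) = c ^ 2 * g v) :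
    ∃ C : ℝ, 0 < C ∧ ∀ v : TotalSpace F E, v.1 ∈ K → |g v| ≤ C * fiberNorm v ^ 2 := by
  obtain ⟨C, hC⟩ := (isCompact_sphereOver hK).bddAbove_image hg.abs.continuousOn
  refine ⟨max C 1, by positivity, fun v hv => ?_⟩
  rcases (fiberNorm_nonneg v).eq_or_lt with h0 | h0
  · have h1 : fiberSMul 0 v = v := by
      refine congrArg (TotalSpace.mk v.1) ?_
      rw [zero_smul, eq_comm]
      exact norm_eq_zero.1 h0.symm
    have h3 := hom 0 v
    rw [h1, zero_pow two_ne_zero, zero_mul] at h3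
    simp [← h0, h3]
  · have h1 : |g (fiberSMul (fiberNorm v)⁻¹ v)| ≤ max C 1 :=
      (hC ⟨fiberSMul (fiberNorm v)⁻¹ v, ⟨hv, fiberNorm_normalize h0⟩, rfl⟩).trans (le_max_left _ _)
    rw [hom, abs_mul, abs_of_pos (by positivity : 0 < (fiberNorm v)⁻¹ ^ 2), inv_pow,
      inv_mul_eq_div, div_le_iff₀ (by positivity)] at h1
    exact h1

/-- If a continuous function `g`, homogeneous of degree two, is positive at the nonzero vectors of a
closed cone over a compact set, then it dominates a multiple of the square of the norm there. -/
theorem exists_mul_sq_le {K : Set B} (hK : IsCompact K) {g : TotalSpace F E → ℝ}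
    (hg : Continuous g) (hom : ∀ c v, g (fiberSMul c v) = c ^ 2 * g v)
    {S : Set (TotalSpace F E)} (hS : IsClosed (S ∩ sphereOver F E K))
    (hscale : ∀ v ∈ S, ∀ c : ℝ, 0 < c → fiberSMul c v ∈ S)
    (hpos : ∀ v ∈ S, v.1 ∈ K → 0 < fiberNorm v → 0 < g v) :
    ∃ a : ℝ, 0 < a ∧ ∀ v ∈ S, v.1 ∈ K → a * fiberNorm v ^ 2 ≤ g v := by
  have hcomp : IsCompact (S ∩ sphereOver F E K) :=
    (isCompact_sphereOver hK).of_isClosed_subset hS inter_subset_right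
  obtain ⟨a, ha, hmin⟩ := hcomp.exists_forall_le' hg.continuousOn (a := 0) (by
    rintro v ⟨hv, hvK, hv1⟩
    exact hpos v hv hvK (by rw [show fiberNorm v = 1 from hv1]; exact one_pos))
  refine ⟨a, ha, fun v hv hvK => ?_⟩
  rcases (fiberNorm_nonneg v).eq_or_lt with h0 | h0
  · obtain ⟨C, -, hC⟩ := exists_abs_le_mul_sq hK hg hom
    have := hC v hvK
    rw [← h0] at this ⊢
    have h2 : |g v| = 0 := le_antisymm (by simpa using this) (abs_nonneg _)
    rw [abs_eq_zero.1 h2]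
    simp
  · have h1 := hmin _ ⟨hscale v hv _ (inv_pos.2 h0), hvK, fiberNorm_normalize h0⟩
    rw [hom, inv_pow, inv_mul_eq_div, le_div_iff₀ (by positivity)] at h1
    exact h1

theorem continuous_fiberForm_totalFlow (hJc : Continuous (fiberForm (F := F) J)) (t : ℝ≥0) :
    Continuous fun v => fiberForm J (A.totalFlow t v) :=
  hJc.comp (A.totalFlow.continuous_toFun t)

theorem fiberForm_totalFlow_smul (t : ℝ≥0) (c : ℝ) (v : TotalSpace F E) :
    fiberForm J (A.totalFlow t (fiberSMul c v)) = c ^ 2 * fiberForm J (A.totalFlow t v) := by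
  rw [A.totalFlow_smul, fiberForm_smul]

theorem isClosed_sphereOver {K : Set B} (hK : IsCompact K) : IsClosed (sphereOver F E K) := by
  have := t2Space_totalSpace (F := F) (E := E)
  exact (isCompact_sphereOver hK).isClosed

/-- Strict separation is uniform over a compact set. -/
theorem IsStrictlyPositiveFor.exists_mul_sq_le (hΛ : IsCompact Λ)
    (hJ : IsStrictlyPositiveFor A J) (hJc : Continuous (fiberForm (F := F) J)) :
    ∃ η : ℝ, 0 < η ∧ ∀ v : TotalSpace F E, v.1 ∈ Λ → 0 ≤ fiberForm J v →
      η * fiberNorm v ^ 2 ≤ fiberForm J (A.totalFlow 1 v) := by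
  obtain ⟨η, hη, h⟩ := JSeparation.exists_mul_sq_le hΛ
    (continuous_fiberForm_totalFlow (A := A) hJc 1) (fiberForm_totalFlow_smul 1)
    (S := {v | 0 ≤ fiberForm J v})
    ((isClosed_le continuous_const hJc).inter (isClosed_sphereOver hΛ))
    (fun v hv c _ => by
      simp only [mem_ofPred_eq, fiberForm_smul] at hv ⊢
      positivity)
    (fun v hv _ h0 => hJ 1 one_pos v h0 hv)
  exact ⟨η, hη, fun v hv hv' => h v hv' hv⟩

/-- The form is uniformly positive on the unstable cone, whose vectors are images under `A_1` of
vectors with `𝓙 ≥ 0`. -/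
theorem exists_mul_sq_le_of_mem_unstableCone (hΛ : IsCompactInvariant ψ Λ)
    (hJ : IsStrictlyPositiveFor A J) (hJc : Continuous (fiberForm (F := F) J)) :
    ∃ a : ℝ, 0 < a ∧ ∀ v ∈ unstableCone A J Λ, a * fiberNorm v ^ 2 ≤ fiberForm J v := by
  obtain ⟨η, hη, h⟩ := hJ.exists_mul_sq_le hΛ.isCompact hJc
  obtain ⟨m, C, -, hC, hb⟩ := A.exists_norm_bounds hΛ.isCompact 1
  refine ⟨η / C ^ 2, by positivity, fun v hv => ?_⟩
  obtain ⟨u, hu, rfl⟩ := hΛ.exists_totalFlow_eq A 1 hv.1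
  refine le_trans ?_ (h u hu (hv.2 1 u hu rfl))
  have := (hb 1 le_rfl u hu).2
  have h2 : fiberNorm (A.totalFlow 1 u) ^ 2 ≤ C ^ 2 * fiberNorm u ^ 2 := by
    rw [← mul_pow]
    exact pow_le_pow_left₀ (fiberNorm_nonneg _) this 2
  rw [div_mul_eq_mul_div, div_le_iff₀ (by positivity)]
  nlinarith

/-- The form is uniformly negative on the stable cone, since `𝓙 w ≥ 0` with `w ≠ 0` would give
`𝓙 (A_1 w) > 0`. -/
theorem exists_le_neg_mul_sq_of_mem_stableCone (hΛ : IsCompactInvariant ψ Λ)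
    (hJ : IsStrictlyPositiveFor A J) (hJc : Continuous (fiberForm (F := F) J)) :
    ∃ b : ℝ, 0 < b ∧ ∀ v ∈ stableCone A J Λ, b * fiberNorm v ^ 2 ≤ -fiberForm J v := by
  obtain ⟨b, hb, h⟩ := JSeparation.exists_mul_sq_le hΛ.isCompact
    (g := fun v => -fiberForm J v) hJc.neg
    (fun c v => by rw [fiberForm_smul]; ring)
    (S := {v | fiberForm J (A.totalFlow 1 v) ≤ 0})
    ((isClosed_le (continuous_fiberForm_totalFlow hJc 1) continuous_const).inter
      (isClosed_sphereOver hΛ.isCompact))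
    (fun v hv c _ => by
      simp only [mem_ofPred_eq, fiberForm_totalFlow_smul] at hv ⊢
      exact mul_nonpos_of_nonneg_of_nonpos (by positivity) hv)
    (fun v hv _ h0 => by
      by_contra hcon
      rw [not_lt, neg_nonpos] at hcon
      exact absurd (hJ 1 one_pos v h0 hcon) (not_lt.2 hv))
  exact ⟨b, hb, fun v hv => h v (hv.2 1) hv.1⟩

/-- One unit of time contracts the ratio of `|𝓙|` on a stable and an unstable vector by a uniform
factor. Uniform strictness makes the form `v ↦ 𝓙 (A_1 v) - η ‖v‖²` non-negative where `𝓙 ≥ 0`, and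
the two forms can be compared by the S-lemma. -/
theorem exists_ratio_contraction (hΛ : IsCompactInvariant ψ Λ)
    (hJ : IsStrictlyPositiveFor A J) (hJc : Continuous (fiberForm (F := F) J)) :
    ∃ θ : ℝ, 0 < θ ∧ θ < 1 ∧ ∀ v ∈ unstableCone A J Λ, ∀ w ∈ stableCone A J Λ, v.1 = w.1 →
      -fiberForm J (A.totalFlow 1 w) * fiberForm J v ≤
        θ * (fiberForm J (A.totalFlow 1 v) * -fiberForm J w) := by
  obtain ⟨η, hη, h⟩ := hJ.exists_mul_sq_le hΛ.isCompact hJc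
  obtain ⟨a, ha, hua⟩ := exists_mul_sq_le_of_mem_unstableCone hΛ hJ hJc
  obtain ⟨b, hb, hsb⟩ := exists_le_neg_mul_sq_of_mem_stableCone hΛ hJ hJc
  obtain ⟨C, hC, hCb⟩ := exists_abs_le_mul_sq hΛ.isCompact
    (continuous_fiberForm_totalFlow (A := A) hJc 1) (fiberForm_totalFlow_smul 1)
  have hpos : 0 < C + η := by positivity
  refine ⟨1 - η / (C + η), ?_, ?_, ?_⟩
  · rw [sub_pos, div_lt_one hpos]
    linarith
  · have : 0 < η / (C + η) := by positivity
    linarith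
  rintro ⟨x, v⟩ hv ⟨y, w⟩ hw hxy
  obtain rfl : x = y := hxy
  rcases (fiberNorm_nonneg (⟨x, v⟩ : TotalSpace F E)).eq_or_lt with hv0 | hv0
  · have h1 := fiberForm_of_fiberNorm_eq_zero J hv0.symm
    have h2 := unstableCone_nonneg ((totalFlow_mem_unstableCone_iff hΛ hJ 1 hv.1).2 hv)
    have h3 := stableCone_nonpos hw
    rw [h1, mul_zero]
    refine mul_nonneg ?_ (mul_nonneg h2 (by linarith))
    rw [sub_nonneg, div_le_one hpos]
    linarith
  rcases (fiberNorm_nonneg (⟨x, w⟩ : TotalSpace F E)).eq_or_lt with hw0 | hw0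
  · have h1 := fiberForm_of_fiberNorm_eq_zero J hw0.symm
    have h2 : fiberForm J (A.totalFlow 1 ⟨x, w⟩) = 0 := by
      refine fiberForm_of_fiberNorm_eq_zero J ?_
      by_contra h0
      exact hw0.not_lt (A.fiberNorm_totalFlow_pos.1
        (lt_of_le_of_ne (fiberNorm_nonneg _) (Ne.symm h0)))
    rw [h1, h2]
    simp
  have hJv : 0 < fiberForm J (⟨x, v⟩ : TotalSpace F E) :=
    lt_of_lt_of_le (by positivity) (hua _ hv)
  have hJw : 0 < -fiberForm J (⟨x, w⟩ : TotalSpace F E) :=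
    lt_of_lt_of_le (by positivity) (hsb _ hw)
  set R : QuadraticForm ℝ (E x) := (J (ψ 1 x)).comp (A.toFun 1 x : E x →ₗ[ℝ] E (ψ 1 x)) -
    η • (LinearMap.BilinMap.toQuadraticMap (innerₗ (E x))) with hR
  have hRv : ∀ u : E x, R u = fiberForm J (A.totalFlow 1 ⟨x, u⟩) -
      η * fiberNorm (⟨x, u⟩ : TotalSpace F E) ^ 2 := by
    intro u
    simp only [hR, sub_apply, smul_apply, QuadraticMap.comp_apply,
      LinearMap.BilinMap.toQuadraticMap_apply, innerₗ_apply_apply, real_inner_self_eq_norm_sq]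
    rfl
  have key := mul_le_mul_of_nonneg_imp_nonneg (Q := J x) (R := R) (v := v) (w := w) (by
    intro u hu
    rw [hRv]
    linarith [h ⟨x, u⟩ hv.1 hu]) hJv (neg_pos.1 hJw)
  rw [hRv, hRv] at key
  have hbd := (le_abs_self _).trans (hCb ⟨x, v⟩ hv.1)
  change (_ - _) * fiberForm J (⟨x, w⟩ : TotalSpace F E) ≤
    (_ - _) * fiberForm J (⟨x, v⟩ : TotalSpace F E) at key
  have hfv := unstableCone_nonneg ((totalFlow_mem_unstableCone_iff hΛ hJ 1 hv.1).2 hv)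
  generalize fiberForm J (A.totalFlow 1 ⟨x, v⟩) = fv at *
  generalize fiberForm J (A.totalFlow 1 ⟨x, w⟩) = fw at *
  generalize fiberForm J (⟨x, v⟩ : TotalSpace F E) = jv at *
  generalize fiberForm J (⟨x, w⟩ : TotalSpace F E) = jw at *
  generalize fiberNorm (⟨x, v⟩ : TotalSpace F E) = nv at *
  generalize fiberNorm (⟨x, w⟩ : TotalSpace F E) = nw at *
  have h1 : η / (C + η) * fv ≤ η * nv ^ 2 := by
    rw [div_mul_eq_mul_div, div_le_iff₀ hpos]
    have : fv ≤ (C + η) * nv ^ 2 := by nlinarith [sq_nonneg nv]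
    nlinarith
  have h2 : 0 ≤ η * nw ^ 2 * jv := by positivity
  have h3 := mul_le_mul_of_nonneg_right h1 hJw.le
  nlinarith

end Cones

/-! ### Domination between the invariant cones, and subspaces contained in them -/

section Domination

variable {EM : Type*} [NormedAddCommGroup EM] [NormedSpace ℝ EM]
  {H : Type*} [TopologicalSpace H] {I : ModelWithCorners ℝ EM H}
  {B : Type*} [TopologicalSpace B] [ChartedSpace H B]
  {F : Type*} [NormedAddCommGroup F] [NormedSpace ℝ F]
  {E : B → Type*} [TopologicalSpace (TotalSpace F E)] [∀ x, NormedAddCommGroup (E x)]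
  [∀ x, InnerProductSpace ℝ (E x)] [FiberBundle F E]
  {ψ : Flow ℝ≥0 B} {A : LinearCocycle I F E ψ}
  {J : ∀ x : B, QuadraticForm ℝ (E x)} {Λ : Set B}
  [VectorBundle ℝ F E] [FiniteDimensional ℝ F] [IsContinuousRiemannianBundle F E]
  [T2Space B] [LocallyCompactSpace B]

/-- Exponential domination of the stable cone by the unstable cone, in integer time. -/
theorem exists_domination_nat (hΛ : IsCompactInvariant ψ Λ)
    (hJ : IsStrictlyPositiveFor A J) (hJc : Continuous (fiberForm (F := F) J)) :
    ∃ C θ : ℝ, 0 < C ∧ 0 < θ ∧ θ < 1 ∧ ∀ n : ℕ, ∀ v ∈ unstableCone A J Λ,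
      ∀ w ∈ stableCone A J Λ, v.1 = w.1 →
      fiberNorm (A.totalFlow n w) ^ 2 * fiberNorm v ^ 2 ≤
        C * θ ^ n * (fiberNorm (A.totalFlow n v) ^ 2 * fiberNorm w ^ 2) := by
  obtain ⟨θ, hθ, hθ1, hcon⟩ := exists_ratio_contraction hΛ hJ hJc
  obtain ⟨a, ha, hua⟩ := exists_mul_sq_le_of_mem_unstableCone hΛ hJ hJc
  obtain ⟨b, hb, hsb⟩ := exists_le_neg_mul_sq_of_mem_stableCone hΛ hJ hJc
  obtain ⟨C, hC, hCb⟩ := exists_abs_le_mul_sq hΛ.isCompact hJc (fiberForm_smul J)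
  have hJn : ∀ n : ℕ, ∀ v ∈ unstableCone A J Λ, ∀ w ∈ stableCone A J Λ, v.1 = w.1 →
      -fiberForm J (A.totalFlow n w) * fiberForm J v ≤
        θ ^ n * (fiberForm J (A.totalFlow n v) * -fiberForm J w) := by
    intro n v hv w hw hvw
    rcases (fiberNorm_nonneg v).eq_or_lt with hv0 | hv0
    · have h1 := fiberForm_of_fiberNorm_eq_zero J hv0.symm
      have h2 := unstableCone_nonneg ((totalFlow_mem_unstableCone_iff hΛ hJ n hv.1).2 hv)
      have h3 := stableCone_nonpos hw
      rw [h1, mul_zero]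
      exact mul_nonneg (by positivity) (mul_nonneg h2 (by linarith))
    induction n with
    | zero => simp [mul_comm]
    | succ n ih =>
      have hvn := (totalFlow_mem_unstableCone_iff hΛ hJ n hv.1).2 hv
      have hwn := (totalFlow_mem_stableCone_iff hΛ hJ n hw.1).2 hw
      have hstep := hcon _ hvn _ hwn (by rw [A.totalFlow_proj, A.totalFlow_proj, hvw])
      rw [← A.totalFlow.map_add, ← A.totalFlow.map_add, add_comm (1 : ℝ≥0)] at hstep
      push_cast
      have hpos : 0 < fiberForm J (A.totalFlow n v) :=
        lt_of_lt_of_le (mul_pos ha (pow_pos (A.fiberNorm_totalFlow_pos.2 hv0) 2)) (hua _ hvn)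
      have hpos' : 0 ≤ fiberForm J (A.totalFlow (n + 1) v) := by
        have := unstableCone_nonneg ((totalFlow_mem_unstableCone_iff hΛ hJ (n + 1) hv.1).2 hv)
        exact this
      have hposv : 0 ≤ fiberForm J v := unstableCone_nonneg hv
      generalize fiberForm J (A.totalFlow (n + 1) v) = v' at *
      generalize fiberForm J (A.totalFlow (n + 1) w) = w' at *
      generalize fiberForm J (A.totalFlow n v) = vn at *
      generalize fiberForm J (A.totalFlow n w) = wn at *
      generalize fiberForm J v = v0 at *
      generalize fiberForm J w = w0 at *
      refine le_of_mul_le_mul_right ?_ hpos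
      calc -w' * v0 * vn = (-w' * vn) * v0 := by ring
        _ ≤ θ * (v' * -wn) * v0 := mul_le_mul_of_nonneg_right hstep hposv
        _ = θ * v' * (-wn * v0) := by ring
        _ ≤ θ * v' * (θ ^ n * (vn * -w0)) :=
          mul_le_mul_of_nonneg_left ih (mul_nonneg hθ.le hpos')
        _ = θ ^ (n + 1) * (v' * -w0) * vn := by ring
  refine ⟨C * C / (a * b), θ, by positivity, hθ, hθ1, fun n v hv w hw hvw => ?_⟩
  have hvn := (totalFlow_mem_unstableCone_iff hΛ hJ n hv.1).2 hv
  have hwn := (totalFlow_mem_stableCone_iff hΛ hJ n hw.1).2 hw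
  have h0 := hJn n v hv w hw hvw
  have h1 := hua v hv
  have h2 := hsb _ hwn
  have h3 := (le_abs_self _).trans (hCb _ hvn.1)
  have h4 := (neg_le_abs _).trans (hCb _ hw.1)
  have h5 : (b * fiberNorm (A.totalFlow n w) ^ 2) * (a * fiberNorm v ^ 2) ≤
      θ ^ n * ((C * fiberNorm (A.totalFlow n v) ^ 2) * (C * fiberNorm w ^ 2)) := by
    refine (mul_le_mul h2 h1 (by positivity) ?_).trans (h0.trans ?_)
    · exact le_trans (by positivity) h2
    · refine mul_le_mul_of_nonneg_left ?_ (by positivity)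
      exact mul_le_mul h3 h4 (by linarith [stableCone_nonpos hw]) (by positivity)
  rw [div_mul_eq_mul_div, div_mul_eq_mul_div, le_div_iff₀ (by positivity)]
  nlinarith

/-- Exponential domination of the stable cone by the unstable cone. -/
theorem exists_domination (hΛ : IsCompactInvariant ψ Λ)
    (hJ : IsStrictlyPositiveFor A J) (hJc : Continuous (fiberForm (F := F) J)) :
    ∃ C lam : ℝ, 0 < C ∧ 0 < lam ∧ ∀ t : ℝ≥0, ∀ v ∈ unstableCone A J Λ,
      ∀ w ∈ stableCone A J Λ, v.1 = w.1 →
      fiberNorm (A.totalFlow t w) * fiberNorm v ≤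
        C * Real.exp (-lam * t) * (fiberNorm (A.totalFlow t v) * fiberNorm w) := by
  obtain ⟨C, θ, hC, hθ, hθ1, hn⟩ := exists_domination_nat hΛ hJ hJc
  obtain ⟨m, D, hm, hD, hmD⟩ := A.exists_norm_bounds hΛ.isCompact 1
  have hlog : Real.log θ < 0 := Real.log_neg hθ hθ1
  refine ⟨D / m * √(C / θ), -Real.log θ / 2, by positivity, by linarith, ?_⟩
  intro t v hv w hw hvw
  set n := ⌊t⌋₊ with hn'
  obtain ⟨s, hs⟩ : ∃ s, t = n + s := exists_add_of_le (Nat.floor_le (zero_le))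
  have hs1 : s ≤ 1 := by
    have := Nat.lt_floor_add_one t
    rw [← hn', hs] at this
    exact (lt_of_add_lt_add_left this).le
  have h1 := hn n v hv w hw hvw
  have hvn := (hmD s hs1 (A.totalFlow n v) (hΛ.map_mem n _ hv.1)).1
  have hwn := (hmD s hs1 (A.totalFlow n w) (hΛ.map_mem n _ hw.1)).2
  rw [← A.totalFlow.map_add, add_comm, ← hs] at hvn hwn
  have hpow : θ ^ n ≤ θ⁻¹ * Real.exp (Real.log θ * t) := by
    rw [← Real.rpow_natCast, Real.rpow_def_of_pos hθ, ← Real.exp_log (inv_pos.2 hθ), ← Real.exp_add,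
      Real.log_inv, Real.exp_le_exp]
    have h2 : (t : ℝ) ≤ n + 1 := by
      have : t ≤ (n : ℝ≥0) + 1 := (Nat.lt_floor_add_one t).le
      exact_mod_cast this
    nlinarith
  have h2 : fiberNorm (A.totalFlow n w) * fiberNorm v ≤
      √(C / θ) * Real.exp (-(-Real.log θ / 2) * t) *
        (fiberNorm (A.totalFlow n v) * fiberNorm w) := by
    have hnn : 0 ≤ √(C / θ) * Real.exp (-(-Real.log θ / 2) * t) *
        (fiberNorm (A.totalFlow n v) * fiberNorm w) :=
      mul_nonneg (by positivity) (mul_nonneg (fiberNorm_nonneg _) (fiberNorm_nonneg _))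
    refine le_of_sq_le_sq ?_ hnn
    have hexp : Real.exp (-(-Real.log θ / 2) * t) ^ 2 = Real.exp (Real.log θ * t) := by
      rw [sq, ← Real.exp_add]
      congr 1
      ring
    rw [mul_pow, mul_pow, mul_pow, mul_pow, Real.sq_sqrt (by positivity), hexp]
    refine h1.trans (mul_le_mul_of_nonneg_right ?_ (by positivity))
    rw [div_mul_eq_mul_div, mul_div_assoc, div_eq_inv_mul]
    exact mul_le_mul_of_nonneg_left hpow hC.le
  calc fiberNorm (A.totalFlow t w) * fiberNorm v
      ≤ D * fiberNorm (A.totalFlow n w) * fiberNorm v :=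
        mul_le_mul_of_nonneg_right hwn (fiberNorm_nonneg _)
    _ = D * (fiberNorm (A.totalFlow n w) * fiberNorm v) := by ring
    _ ≤ D * (√(C / θ) * Real.exp (-(-Real.log θ / 2) * t) *
        (fiberNorm (A.totalFlow n v) * fiberNorm w)) := mul_le_mul_of_nonneg_left h2 hD.le
    _ = D / m * √(C / θ) * Real.exp (-(-Real.log θ / 2) * t) *
        ((m * fiberNorm (A.totalFlow n v)) * fiberNorm w) := by
          field_simp
    _ ≤ _ := by
        refine mul_le_mul_of_nonneg_left ?_ (by positivity)
        exact mul_le_mul_of_nonneg_right hvn (fiberNorm_nonneg _)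

theorem continuous_fiberForm_mk (hJc : Continuous (fiberForm (F := F) J)) (x : B) :
    Continuous fun v : E x => J x v :=
  hJc.comp (FiberBundle.continuous_totalSpaceMk F E x)

/-- Over each point of `Λ` the unstable cone contains a subspace of the dimension of the positive
subspaces of the form: a limit of images of positive subspaces from further and further in the
past. -/
theorem exists_submodule_subset_unstableCone (hΛ : IsCompactInvariant ψ Λ)
    (hJ : IsStrictlyPositiveFor A J) (hJc : Continuous (fiberForm (F := F) J)) {p : ℕ}
    (hp : ∀ x ∈ Λ, ∃ P : Submodule ℝ (E x), Module.finrank ℝ P = p ∧ ∀ v ∈ P, 0 ≤ J x v)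
    {x : B} (hx : x ∈ Λ) :
    ∃ L : Submodule ℝ (E x), Module.finrank ℝ L = p ∧
      ∀ v ∈ L, (⟨x, v⟩ : TotalSpace F E) ∈ unstableCone A J Λ := by
  have := finiteDimensional_fiber F (E := E) x
  have key := exists_submodule_subset_iInter (V := E x) (d := p)
    (C := fun k : ℕ => {v | ∀ u : TotalSpace F E, u.1 ∈ Λ →
      A.totalFlow k u = ⟨x, v⟩ → 0 ≤ fiberForm J u})
  obtain ⟨L, hL, hLC⟩ := key (by
    intro k
    obtain ⟨y, hy, rfl⟩ := hΛ.exists_map_eq k x hx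
    have heq : {v : E (ψ k y) | ∀ u : TotalSpace F E, u.1 ∈ Λ →
        A.totalFlow k u = ⟨ψ k y, v⟩ → 0 ≤ fiberForm J u} =
        {v | 0 ≤ J y ((A.toFun k y).symm v)} := by
      ext v
      constructor
      · intro h
        exact h ⟨y, (A.toFun k y).symm v⟩ hy (by rw [A.totalFlow_mk]; simp)
      · intro h u hu huv
        have : u = ⟨y, (A.toFun k y).symm v⟩ := by
          refine A.totalFlow_injective (hΛ.injective k) (huv.trans ?_)
          rw [A.totalFlow_mk]
          simp
        rw [this]
        exact h
    change IsClosed {v : E (ψ k y) | ∀ u : TotalSpace F E, u.1 ∈ Λ →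
        A.totalFlow k u = ⟨ψ k y, v⟩ → 0 ≤ fiberForm J u}
    rw [heq]
    exact isClosed_le continuous_const
      ((continuous_fiberForm_mk hJc y).comp (A.toFun k y).symm.continuous)) (by
    intro k v hv u hu huv
    obtain ⟨u', hu', rfl⟩ := hΛ.exists_totalFlow_eq A 1 hu
    refine hJ.nonneg 1 (hv u' hu' ?_)
    rw [← huv, ← A.totalFlow.map_add]
    push_cast
    rfl) (by
    intro k
    obtain ⟨y, hy, rfl⟩ := hΛ.exists_map_eq k x hx
    obtain ⟨P, hP, hPpos⟩ := hp y hy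
    refine ⟨P.map ((A.toFun k y).toLinearEquiv : E y →ₗ[ℝ] E (ψ k y)), ?_, ?_⟩
    · rw [← hP]
      exact LinearEquiv.finrank_map_eq (A.toFun k y).toLinearEquiv P
    · rintro _ ⟨v, hv, rfl⟩ u hu huv
      have : u = ⟨y, v⟩ := A.totalFlow_injective (hΛ.injective k) huv
      rw [this]
      exact hPpos v hv)
  refine ⟨L, hL, fun v hv => ⟨hx, fun t u hu hut => ?_⟩⟩
  obtain ⟨k, hk⟩ := exists_nat_ge t
  obtain ⟨r, hr⟩ := exists_add_of_le hk
  obtain ⟨u', hu', rfl⟩ := hΛ.exists_totalFlow_eq A r hu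
  rw [← A.totalFlow.map_add, ← hr] at hut
  exact hJ.nonneg r (mem_iInter.1 (hLC hv) k u' hu' hut)

/-- Over each point of `Λ` the stable cone contains a subspace of the dimension of the non-positive
subspaces of the form: a limit of preimages of such subspaces from further and further in the
future. -/
theorem exists_submodule_subset_stableCone (hΛ : IsCompactInvariant ψ Λ)
    (hJ : IsStrictlyPositiveFor A J) (hJc : Continuous (fiberForm (F := F) J)) {q : ℕ}
    (hq : ∀ x ∈ Λ, ∃ N : Submodule ℝ (E x), Module.finrank ℝ N = q ∧ ∀ v ∈ N, J x v ≤ 0)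
    {x : B} (hx : x ∈ Λ) :
    ∃ L : Submodule ℝ (E x), Module.finrank ℝ L = q ∧
      ∀ v ∈ L, (⟨x, v⟩ : TotalSpace F E) ∈ stableCone A J Λ := by
  have := finiteDimensional_fiber F (E := E) x
  have key := exists_submodule_subset_iInter (V := E x) (d := q)
    (C := fun k : ℕ => {v | fiberForm J (A.totalFlow k ⟨x, v⟩) ≤ 0})
  obtain ⟨L, hL, hLC⟩ := key (by
    intro k
    exact isClosed_le ((continuous_fiberForm_totalFlow hJc k).comp
      (FiberBundle.continuous_totalSpaceMk F E x)) continuous_const) (by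
    intro k v hv
    refine hJ.nonpos_of_totalFlow 1 ?_
    rw [← A.totalFlow.map_add, add_comm]
    have hv' : fiberForm J (A.totalFlow ((k + 1 : ℕ) : ℝ≥0) ⟨x, v⟩) ≤ 0 := hv
    push_cast at hv'
    exact hv') (by
    intro k
    obtain ⟨P, hP, hPneg⟩ := hq _ (hΛ.map_mem k x hx)
    refine ⟨P.map ((A.toFun k x).symm.toLinearEquiv : E (ψ k x) →ₗ[ℝ] E x), ?_, ?_⟩
    · rw [← hP]
      exact LinearEquiv.finrank_map_eq (A.toFun k x).symm.toLinearEquiv P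
    · rintro _ ⟨v, hv, rfl⟩
      have : A.totalFlow k ⟨x, (A.toFun k x).symm v⟩ = ⟨ψ k x, v⟩ := by
        rw [A.totalFlow_mk]
        simp
      change fiberForm J (A.totalFlow k ⟨x, (A.toFun k x).symm v⟩) ≤ 0
      rw [this]
      exact hPneg v hv)
  refine ⟨L, hL, fun v hv => ⟨hx, fun t => ?_⟩⟩
  obtain ⟨k, hk⟩ := exists_nat_ge t
  obtain ⟨r, hr⟩ := exists_add_of_le hk
  refine hJ.nonpos_of_totalFlow r ?_
  rw [← A.totalFlow.map_add, add_comm, ← hr]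
  exact mem_iInter.1 (hLC hv) k

end Domination

/-! ### The splitting into stable and unstable subbundles -/

section Splitting

variable {EM : Type*} [NormedAddCommGroup EM] [NormedSpace ℝ EM]
  {H : Type*} [TopologicalSpace H] {I : ModelWithCorners ℝ EM H}
  {B : Type*} [TopologicalSpace B] [ChartedSpace H B]
  {F : Type*} [NormedAddCommGroup F] [NormedSpace ℝ F]
  {E : B → Type*} [TopologicalSpace (TotalSpace F E)] [∀ x, NormedAddCommGroup (E x)]
  [∀ x, InnerProductSpace ℝ (E x)] [FiberBundle F E]
  {ψ : Flow ℝ≥0 B} {A : LinearCocycle I F E ψ}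
  {J : ∀ x : B, QuadraticForm ℝ (E x)} {Λ : Set B}
  [VectorBundle ℝ F E] [FiniteDimensional ℝ F] [IsContinuousRiemannianBundle F E]
  [T2Space B] [LocallyCompactSpace B]

theorem sq_fiberNorm_sub_le (x : B) (v w : E x) :
    fiberNorm (⟨x, v - w⟩ : TotalSpace F E) ^ 2 ≤
      2 * fiberNorm (⟨x, v⟩ : TotalSpace F E) ^ 2 +
        2 * fiberNorm (⟨x, w⟩ : TotalSpace F E) ^ 2 := by
  have h1 : ‖v - w‖ ≤ ‖v‖ + ‖w‖ := norm_sub_le v w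
  have h2 : ‖v - w‖ ^ 2 ≤ (‖v‖ + ‖w‖) ^ 2 := pow_le_pow_left₀ (norm_nonneg _) h1 2
  change ‖v - w‖ ^ 2 ≤ 2 * ‖v‖ ^ 2 + 2 * ‖w‖ ^ 2
  nlinarith [sq_nonneg (‖v‖ - ‖w‖)]

theorem eq_zero_of_forall_sq_mul_le {m C θ D : ℝ} {r : ℕ → ℝ} (hθ : 0 ≤ θ) (hθ1 : θ < 1)
    (hr : m ≠ 0 → ∀ k, 0 < r k)
    (h : ∀ k, m ^ 2 * r k ≤ C * θ ^ k * D * r k) : m = 0 := by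
  by_contra hm
  have h1 : ∀ k : ℕ, m ^ 2 ≤ C * θ ^ k * D := fun k => le_of_mul_le_mul_right (h k) (hr hm k)
  have h2 : Filter.Tendsto (fun k : ℕ => C * θ ^ k * D) Filter.atTop (𝓝 (C * 0 * D)) :=
    ((tendsto_pow_atTop_nhds_zero_of_lt_one hθ hθ1).const_mul C).mul_const D
  have h3 := ge_of_tendsto' h2 h1
  have : 0 < m ^ 2 := by positivity
  simp only [mul_zero, zero_mul] at h3
  linarith

/-- A vector of the unstable cone that differs from a vector of the unstable cone by a vector `m` of
the stable cone is equal to it: going back in time, `m` would dominate both. -/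
theorem eq_of_sub_mem_stableCone (hΛ : IsCompactInvariant ψ Λ)
    (hJ : IsStrictlyPositiveFor A J) (hJc : Continuous (fiberForm (F := F) J)) {x : B}
    {v l : E x} (hv : (⟨x, v⟩ : TotalSpace F E) ∈ unstableCone A J Λ)
    (hl : (⟨x, l⟩ : TotalSpace F E) ∈ unstableCone A J Λ)
    (hm : (⟨x, v - l⟩ : TotalSpace F E) ∈ stableCone A J Λ) : v = l := by
  obtain ⟨C, θ, hC, hθ, hθ1, hn⟩ := exists_domination_nat hΛ hJ hJc
  have hxΛ : x ∈ Λ := hv.1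
  have key : ∀ k : ℕ, ∃ r : ℝ, (‖v - l‖ ≠ 0 → 0 < r) ∧
      ‖v - l‖ ^ 2 * r ≤ (2 * C) * θ ^ k * (‖v‖ ^ 2 + ‖l‖ ^ 2) * r := by
    intro k
    obtain ⟨y, hy, rfl⟩ := hΛ.exists_map_eq k x hxΛ
    obtain ⟨v, rfl⟩ := (A.toFun k y).surjective v
    obtain ⟨l, rfl⟩ := (A.toFun k y).surjective l
    rw [← map_sub] at hm ⊢
    have hv' : (⟨y, v⟩ : TotalSpace F E) ∈ unstableCone A J Λ :=
      (totalFlow_mem_unstableCone_iff hΛ hJ k hy).1 hv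
    have hl' : (⟨y, l⟩ : TotalSpace F E) ∈ unstableCone A J Λ :=
      (totalFlow_mem_unstableCone_iff hΛ hJ k hy).1 hl
    have hm' : (⟨y, v - l⟩ : TotalSpace F E) ∈ stableCone A J Λ :=
      (totalFlow_mem_stableCone_iff hΛ hJ k hy).1 hm
    have h1 : ‖A.toFun k y (v - l)‖ ^ 2 * ‖v‖ ^ 2 ≤
        C * θ ^ k * (‖A.toFun k y v‖ ^ 2 * ‖v - l‖ ^ 2) := hn k _ hv' _ hm' rfl
    have h2 : ‖A.toFun k y (v - l)‖ ^ 2 * ‖l‖ ^ 2 ≤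
        C * θ ^ k * (‖A.toFun k y l‖ ^ 2 * ‖v - l‖ ^ 2) := hn k _ hl' _ hm' rfl
    have h3 : ‖v - l‖ ^ 2 ≤ 2 * ‖v‖ ^ 2 + 2 * ‖l‖ ^ 2 := sq_fiberNorm_sub_le (F := F) y v l
    refine ⟨‖v - l‖ ^ 2, fun h => ?_, ?_⟩
    · have : v - l ≠ 0 := by
        rintro h0
        simp [h0] at h
      have := norm_pos_iff.2 this
      positivity
    · have h4 := mul_le_mul_of_nonneg_left h3 (sq_nonneg ‖A.toFun k y (v - l)‖)
      nlinarith
  choose r hr hle using key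
  exact sub_eq_zero.1 (norm_eq_zero.1 (eq_zero_of_forall_sq_mul_le hθ.le hθ1
    (fun h k => hr k h) hle))

/-- A vector of the stable cone that differs from a vector of the stable cone by a vector `l` of the
unstable cone is equal to it: going forward in time, `l` would dominate both. -/
theorem eq_of_sub_mem_unstableCone (hΛ : IsCompactInvariant ψ Λ)
    (hJ : IsStrictlyPositiveFor A J) (hJc : Continuous (fiberForm (F := F) J)) {x : B}
    {w m : E x} (hw : (⟨x, w⟩ : TotalSpace F E) ∈ stableCone A J Λ)
    (hm : (⟨x, m⟩ : TotalSpace F E) ∈ stableCone A J Λ)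
    (hl : (⟨x, w - m⟩ : TotalSpace F E) ∈ unstableCone A J Λ) : w = m := by
  obtain ⟨C, θ, hC, hθ, hθ1, hn⟩ := exists_domination_nat hΛ hJ hJc
  refine sub_eq_zero.1 (norm_eq_zero.1 (eq_zero_of_forall_sq_mul_le (C := 2 * C)
    (D := ‖w‖ ^ 2 + ‖m‖ ^ 2) (r := fun k => ‖A.toFun k x (w - m)‖ ^ 2) hθ.le hθ1
    (fun h k => ?_) fun k => ?_))
  · have h0 : A.toFun k x (w - m) ≠ 0 := by
      refine (A.toFun k x).map_ne_zero_iff.2 ?_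
      rintro h0
      simp [h0] at h
    have := norm_pos_iff.2 h0
    positivity
  · have h1 : ‖A.toFun k x w‖ ^ 2 * ‖w - m‖ ^ 2 ≤
        C * θ ^ k * (‖A.toFun k x (w - m)‖ ^ 2 * ‖w‖ ^ 2) := hn k _ hl _ hw rfl
    have h2 : ‖A.toFun k x m‖ ^ 2 * ‖w - m‖ ^ 2 ≤
        C * θ ^ k * (‖A.toFun k x (w - m)‖ ^ 2 * ‖m‖ ^ 2) := hn k _ hl _ hm rfl
    have h3 : ‖A.toFun k x (w - m)‖ ^ 2 ≤ 2 * ‖A.toFun k x w‖ ^ 2 + 2 * ‖A.toFun k x m‖ ^ 2 := by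
      rw [map_sub]
      exact sq_fiberNorm_sub_le (F := F) _ _ _
    have h4 := mul_le_mul_of_nonneg_left h3 (sq_nonneg ‖w - m‖)
    change ‖w - m‖ ^ 2 * ‖A.toFun k x (w - m)‖ ^ 2 ≤ _ * ‖A.toFun k x (w - m)‖ ^ 2
    nlinarith

theorem eq_zero_of_mem_unstableCone_of_mem_stableCone (hΛ : IsCompactInvariant ψ Λ)
    (hJ : IsStrictlyPositiveFor A J) (hJc : Continuous (fiberForm (F := F) J)) {x : B} {v : E x}
    (hv : (⟨x, v⟩ : TotalSpace F E) ∈ unstableCone A J Λ)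
    (hv' : (⟨x, v⟩ : TotalSpace F E) ∈ stableCone A J Λ) : v = 0 := by
  obtain ⟨a, ha, h⟩ := exists_mul_sq_le_of_mem_unstableCone hΛ hJ hJc
  have h1 := h _ hv
  have h2 := stableCone_nonpos hv'
  by_contra h0
  have h3 : 0 < fiberNorm (⟨x, v⟩ : TotalSpace F E) := fiberNorm_pos_iff.2 h0
  have : 0 < a * fiberNorm (⟨x, v⟩ : TotalSpace F E) ^ 2 := by positivity
  linarith

/-- Over each point of `Λ`, the unstable and the stable cones are complementary subspaces. -/
theorem exists_isCompl_submodules (hΛ : IsCompactInvariant ψ Λ)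
    (hJ : IsStrictlyPositiveFor A J) (hJc : Continuous (fiberForm (F := F) J)) {p q : ℕ}
    (hp : ∀ x ∈ Λ, ∃ P : Submodule ℝ (E x), Module.finrank ℝ P = p ∧ ∀ v ∈ P, 0 ≤ J x v)
    (hq : ∀ x ∈ Λ, ∃ N : Submodule ℝ (E x), Module.finrank ℝ N = q ∧ ∀ v ∈ N, J x v ≤ 0)
    (hpq : p + q = Module.finrank ℝ F) {x : B} (hx : x ∈ Λ) :
    ∃ M L : Submodule ℝ (E x), Module.finrank ℝ M = q ∧ Module.finrank ℝ L = p ∧ IsCompl M L ∧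
      (∀ v, v ∈ M ↔ (⟨x, v⟩ : TotalSpace F E) ∈ stableCone A J Λ) ∧
      ∀ v, v ∈ L ↔ (⟨x, v⟩ : TotalSpace F E) ∈ unstableCone A J Λ := by
  have := finiteDimensional_fiber F (E := E) x
  obtain ⟨L, hL, hLC⟩ := exists_submodule_subset_unstableCone hΛ hJ hJc hp hx
  obtain ⟨M, hM, hMC⟩ := exists_submodule_subset_stableCone hΛ hJ hJc hq hx
  have hdisj : Disjoint M L := by
    rw [Submodule.disjoint_def]
    intro v hvM hvL
    exact eq_zero_of_mem_unstableCone_of_mem_stableCone hΛ hJ hJc (hLC v hvL) (hMC v hvM)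
  have hcompl : IsCompl M L := by
    refine ⟨hdisj, ?_⟩
    rw [codisjoint_iff]
    apply Submodule.eq_top_of_finrank_eq
    have h1 := Submodule.finrank_sup_add_finrank_inf_eq M L
    rw [hdisj.eq_bot, finrank_bot] at h1
    rw [finrank_fiber (F := F) x]
    omega
  have hdec : ∀ v : E x, ∃ m ∈ M, ∃ l ∈ L, m + l = v := by
    intro v
    have : v ∈ M ⊔ L := by rw [hcompl.sup_eq_top]; trivial
    exact Submodule.mem_sup.1 this
  refine ⟨M, L, hM, hL, hcompl, fun v => ⟨hMC v, fun hv => ?_⟩, fun v => ⟨hLC v, fun hv => ?_⟩⟩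
  · obtain ⟨m, hm, l, hl, rfl⟩ := hdec v
    rw [eq_of_sub_mem_unstableCone hΛ hJ hJc hv (hMC m hm) (by simpa using hLC l hl)]
    exact hm
  · obtain ⟨m, hm, l, hl, rfl⟩ := hdec v
    rw [eq_of_sub_mem_stableCone hΛ hJ hJc hv (hLC l hl) (by simpa using hMC m hm)]
    exact hl

/-- The bounded parts of the stable cone are compact. -/
theorem isCompact_stableCone_inter (hΛ : IsCompactInvariant ψ Λ)
    (hJc : Continuous (fiberForm (F := F) J)) (R : ℝ) :
    IsCompact (stableCone A J Λ ∩ {v | fiberNorm v ≤ R}) := by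
  refine (isCompact_ball_over (F := F) (E := E) hΛ.isCompact R).of_isClosed_subset ?_
    fun v hv => ⟨hv.1.1, hv.2⟩
  refine IsClosed.inter ?_ (isClosed_le continuous_norm_snd continuous_const)
  refine (hΛ.isCompact.isClosed.preimage (FiberBundle.continuous_proj F E)).inter ?_
  change IsClosed {v : TotalSpace F E | ∀ t, fiberForm J (A.totalFlow t v) ≤ 0}
  rw [ofPred_forall]
  exact isClosed_iInter fun t => isClosed_le (continuous_fiberForm_totalFlow hJc t) continuous_const

/-- The bounded parts of the unstable cone are compact. -/
theorem isCompact_unstableCone_inter (hΛ : IsCompactInvariant ψ Λ)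
    (hJc : Continuous (fiberForm (F := F) J)) (R : ℝ) :
    IsCompact (unstableCone A J Λ ∩ {v | fiberNorm v ≤ R}) := by
  have := t2Space_totalSpace (F := F) (E := E)
  refine (isCompact_ball_over (F := F) (E := E) hΛ.isCompact R).of_isClosed_subset ?_
    fun v hv => ⟨hv.1.1, hv.2⟩
  have hb := fun t : ℝ≥0 => A.exists_norm_bounds hΛ.isCompact t
  choose m C hm hC hb using hb
  -- at time `-t` the vectors of norm at most `R` come from vectors of norm at most `R / m t`
  have heq : unstableCone A J Λ ∩ {v | fiberNorm v ≤ R} = ⋂ t : ℝ≥0, (A.totalFlow t ''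
      ({u | u.1 ∈ Λ ∧ fiberNorm u ≤ R / m t} ∩ {u | 0 ≤ fiberForm J u}) ∩
        {v | fiberNorm v ≤ R}) := by
    ext v
    simp only [mem_iInter]
    constructor
    · rintro ⟨hv, hvR⟩ t
      obtain ⟨u, hu, rfl⟩ := hΛ.exists_totalFlow_eq A t hv.1
      refine ⟨⟨u, ⟨⟨hu, ?_⟩, hv.2 t u hu rfl⟩, rfl⟩, hvR⟩
      rw [le_div_iff₀ (hm t), mul_comm]
      exact ((hb t t le_rfl u hu).1).trans hvR
    · intro h
      refine ⟨⟨?_, fun t u hu hut => ?_⟩, (h 0).2⟩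
      · obtain ⟨u, ⟨⟨hu, -⟩, -⟩, huv⟩ := (h 0).1
        rw [← huv]
        exact hΛ.map_mem 0 _ hu
      · obtain ⟨u', ⟨-, hu'⟩, huv⟩ := (h t).1
        rw [A.totalFlow_injective (hΛ.injective t) (hut.trans huv.symm)]
        exact hu'
  rw [heq]
  refine isClosed_iInter fun t => IsClosed.inter (IsCompact.isClosed ?_)
    (isClosed_le continuous_norm_snd continuous_const)
  exact ((isCompact_ball_over hΛ.isCompact _).inter_right
    (isClosed_le continuous_const hJc)).image (A.totalFlow.continuous_toFun t)

/-- A family of subspaces of constant dimension over a compact set, whose bounded parts are compact,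
is a continuous subbundle. A frame near `x₀` is given by the vectors whose projections to the fibre
over `x₀` form a fixed basis of the subspace there. -/
theorem isContinuousSubbundleOn_of_isCompact
    {W : ∀ x : B, Submodule ℝ (E x)} {d : ℕ} (hd : ∀ x ∈ Λ, Module.finrank ℝ (W x) = d)
    (hW : ∀ R : ℝ, IsCompact {v : TotalSpace F E | v.1 ∈ Λ ∧ v.2 ∈ W v.1 ∧ fiberNorm v ≤ R}) :
    IsContinuousSubbundleOn F Λ W := by
  intro x₀ hx₀
  have := t2Space_totalSpace (F := F) (E := E)
  have hfd := fun x => finiteDimensional_fiber F (E := E) x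
  obtain ⟨N, hN, hxN, L, -, hL⟩ := exists_local_coordinates F E x₀
  -- `G` is the projection of the nearby fibres to the subspace over `x₀`
  set G : ∀ x, E x →ₗ[ℝ] W x₀ := fun x =>
    ((W x₀).orthogonalProjectionOnto : E x₀ →ₗ[ℝ] W x₀) ∘ₗ
      ((L x).symm.trans (L x₀) : E x →ₗ[ℝ] E x₀) with hG
  have hGcont : ContinuousOn (fun v : TotalSpace F E => G v.1 v.2) {v | v.1 ∈ N} :=
    ((W x₀).orthogonalProjectionOnto.continuous.comp (L x₀).continuous).comp_continuousOn hL
  obtain ⟨N₁, hN₁, hN₁N, hN₁c⟩ := local_compact_nhds (hN.mem_nhds hxN)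
  have hclN : IsClosed {v : TotalSpace F E | v.1 ∈ N₁} :=
    hN₁c.isClosed.preimage (FiberBundle.continuous_proj F E)
  have hunit : IsClosed {v : TotalSpace F E | fiberNorm v = 1} :=
    isClosed_eq continuous_norm_snd continuous_const
  set S : Set (TotalSpace F E) := {v | v.1 ∈ Λ ∧ v.2 ∈ W v.1 ∧ fiberNorm v ≤ 1} ∩
    ({v | v.1 ∈ N₁} ∩ {v | fiberNorm v = 1}) with hS
  have hScomp : IsCompact S := (hW 1).inter_right (hclN.inter hunit)
  have hGS : ContinuousOn (fun v : TotalSpace F E => ‖G v.1 v.2‖) S :=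
    (hGcont.mono fun v hv => hN₁N hv.2.1).norm
  have hev := eventually_forall_pos_of_isCompact hScomp hGS (x₀ := x₀) (by
    rintro ⟨x, v⟩ ⟨⟨-, hvW, -⟩, -, hv1⟩ hx
    obtain rfl : x = x₀ := hx
    have : G x v = ⟨v, hvW⟩ := by
      simp only [hG, LinearMap.comp_apply]
      have : ((L x).symm.trans (L x) : E x →ₗ[ℝ] E x) v = v := by simp
      rw [this]
      exact Submodule.orthogonalProjectionOnto_mem_subspace_eq_self (K := W x) ⟨v, hvW⟩
    simp only [this]
    have h1 : ‖(⟨v, hvW⟩ : W x)‖ = 1 := hv1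
    rw [h1]
    exact one_pos)
  obtain ⟨N₂, hN₂, hN₂sub, hN₂c⟩ := local_compact_nhds (Filter.inter_mem hN₁ hev)
  have hclN₂ : IsClosed {v : TotalSpace F E | v.1 ∈ N₂} :=
    hN₂c.isClosed.preimage (FiberBundle.continuous_proj F E)
  obtain ⟨c, hc, hmin⟩ := (hScomp.inter_right hclN₂).exists_forall_le' (a := 0)
    (hGS.mono inter_subset_left) (fun v hv => (hN₂sub hv.2).2 v hv.1 rfl)
  have hbound : ∀ x ∈ Λ ∩ N₂, ∀ v ∈ W x, c * ‖v‖ ≤ ‖G x v‖ := by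
    rintro x ⟨hx, hxN₂⟩ v hv
    rcases eq_or_ne v 0 with rfl | hv0
    · simp
    · have hpos : 0 < ‖v‖ := norm_pos_iff.2 hv0
      have hn : ‖‖v‖⁻¹ • v‖ = 1 := by
        rw [norm_smul, norm_inv, norm_norm, inv_mul_cancel₀ hpos.ne']
      have h1 : c ≤ ‖G x (‖v‖⁻¹ • v)‖ := hmin ⟨x, ‖v‖⁻¹ • v⟩
        ⟨⟨⟨hx, (W x).smul_mem _ hv, hn.le⟩, (hN₂sub hxN₂).1, hn⟩, hxN₂⟩
      rw [map_smul, norm_smul, norm_inv, norm_norm, inv_mul_eq_div, le_div_iff₀ hpos] at h1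
      exact h1
  have hinj : ∀ x ∈ Λ ∩ N₂, ∀ v ∈ W x, G x v = 0 → v = 0 := by
    intro x hx v hv h0
    have := hbound x hx v hv
    rw [h0, norm_zero] at this
    by_contra hv0
    have : 0 < c * ‖v‖ := mul_pos hc (norm_pos_iff.2 hv0)
    linarith
  have hsurj : ∀ x ∈ Λ ∩ N₂, ∀ b : W x₀, ∃ v ∈ W x, G x v = b := by
    intro x hx b
    have h1 : Function.Injective ((G x).domRestrict (W x)) := by
      rw [← LinearMap.ker_eq_bot, LinearMap.ker_eq_bot']
      intro v hv
      exact Subtype.ext (hinj x hx v v.2 hv)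
    have h2 := (LinearMap.injective_iff_surjective_of_finrank_eq_finrank
      ((hd x hx.1).trans (hd x₀ hx₀).symm)).1 h1
    obtain ⟨v, hv⟩ := h2 b
    exact ⟨v, v.2, hv⟩
  set b := Module.finBasisOfFinrankEq ℝ (W x₀) (hd x₀ hx₀) with hb
  have hσ : ∀ (i : Fin d) (x : B), ∃ v : E x, x ∈ Λ ∩ N₂ → v ∈ W x ∧ G x v = b i := by
    intro i x
    by_cases hx : x ∈ Λ ∩ N₂
    · obtain ⟨v, hv, hv'⟩ := hsurj x hx (b i)
      exact ⟨v, fun _ => ⟨hv, hv'⟩⟩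
    · exact ⟨0, fun h => absurd h hx⟩
  choose σ hσ using hσ
  refine ⟨Λ ∩ N₂, Filter.inter_mem self_mem_nhdsWithin (mem_nhdsWithin_of_mem_nhds hN₂), d, σ,
    fun i => ?_, fun y hy => ?_⟩
  · -- the frame is the inverse of the continuous injective map `(π, G)` on a compact set
    rw [continuousOn_iff_isClosed]
    intro C hC
    set T : Set (TotalSpace F E) :=
      ({v | v.1 ∈ Λ ∧ v.2 ∈ W v.1 ∧ fiberNorm v ≤ ‖b i‖ / c} ∩ {v | v.1 ∈ N₂}) ∩ C with hT
    have hTc : IsCompact T := ((hW _).inter_right hclN₂).inter_right hC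
    have hTG : ContinuousOn (fun v : TotalSpace F E => (v.1, G v.1 v.2)) T :=
      (FiberBundle.continuous_proj F E).continuousOn.prodMk
        (hGcont.mono fun v hv => hN₁N (hN₂sub hv.1.2).1)
    refine ⟨(fun y => (y, b i)) ⁻¹' ((fun v : TotalSpace F E => (v.1, G v.1 v.2)) '' T),
      (hTc.image_of_continuousOn hTG).isClosed.preimage (by fun_prop), ?_⟩
    ext y
    constructor
    · rintro ⟨hyC, hy⟩
      obtain ⟨h1, h2⟩ := hσ i y hy
      refine ⟨⟨⟨y, σ i y⟩, ⟨⟨⟨hy.1, h1, ?_⟩, hy.2⟩, hyC⟩, by simp only [h2]⟩, hy⟩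
      have h3 := hbound y hy _ h1
      rw [h2] at h3
      rw [le_div_iff₀ hc, mul_comm]
      exact h3
    · rintro ⟨⟨⟨z, v⟩, ⟨⟨⟨-, hvW, -⟩, -⟩, hvC⟩, hvy⟩, hy⟩
      obtain ⟨h1, h2⟩ := hσ i y hy
      simp only [Prod.mk.injEq] at hvy
      obtain ⟨rfl, hvb⟩ := hvy
      have : σ i z = v := by
        refine sub_eq_zero.1 (hinj z hy _ ((W z).sub_mem h1 hvW) ?_)
        rw [map_sub, h2, hvb, sub_self]
      refine ⟨?_, hy⟩
      change (⟨z, σ i z⟩ : TotalSpace F E) ∈ C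
      rw [this]
      exact hvC
  · have hli : LinearIndependent ℝ fun i => σ i y := by
      refine LinearIndependent.of_comp (G y) ?_
      have : (G y ∘ fun i => σ i y) = b := by
        ext1 i
        exact (hσ i y hy).2
      rw [this]
      exact b.linearIndependent
    refine ⟨hli, Submodule.eq_of_le_of_finrank_eq ?_ ?_⟩
    · rw [Submodule.span_le]
      rintro _ ⟨i, rfl⟩
      exact (hσ i y hy).1
    · rw [finrank_span_eq_card hli, hd y hy.1, Fintype.card_fin]

theorem opNorm_mul_opNorm_le {V V' W W' : Type*} [NormedAddCommGroup V] [NormedSpace ℝ V]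
    [NormedAddCommGroup V'] [NormedSpace ℝ V'] [NormedAddCommGroup W] [NormedSpace ℝ W]
    [NormedAddCommGroup W'] [NormedSpace ℝ W'] (f : V →L[ℝ] V') (g : W →L[ℝ] W') {C : ℝ}
    (hC : 0 ≤ C) (h : ∀ v w, ‖f v‖ * ‖g w‖ ≤ C * (‖v‖ * ‖w‖)) : ‖f‖ * ‖g‖ ≤ C := by
  have h1 : ∀ w, ‖g w‖ * ‖f‖ ≤ C * ‖w‖ := by
    intro w
    have : ‖‖g w‖ • f‖ ≤ C * ‖w‖ := by
      refine ContinuousLinearMap.opNorm_le_bound _ (by positivity) fun v => ?_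
      rw [smul_apply, norm_smul, norm_norm]
      linarith [h v w]
    rwa [norm_smul, norm_norm] at this
  have : ‖‖f‖ • g‖ ≤ C := by
    refine ContinuousLinearMap.opNorm_le_bound _ hC fun w => ?_
    rw [smul_apply, norm_smul, norm_norm]
    linarith [h1 w]
  rwa [norm_smul, norm_norm] at this

/-- A strictly separated cocycle has a dominated splitting, into its stable and unstable cones. -/
theorem exists_isDominatedSplittingOn (hΛ : IsCompactInvariant ψ Λ)
    (hJ : IsStrictlyPositiveFor A J) (hJc : Continuous (fiberForm (F := F) J)) {p q : ℕ}
    (hp : ∀ x ∈ Λ, ∃ P : Submodule ℝ (E x), Module.finrank ℝ P = p ∧ ∀ v ∈ P, 0 ≤ J x v)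
    (hq : ∀ x ∈ Λ, ∃ N : Submodule ℝ (E x), Module.finrank ℝ N = q ∧ ∀ v ∈ N, J x v ≤ 0)
    (hpq : p + q = Module.finrank ℝ F) (hp0 : 0 < p) (hq0 : 0 < q) :
    ∃ Fm Fp : ∀ x : B, Submodule ℝ (E x), A.IsDominatedSplittingOn Λ Fm Fp ∧
      ∀ x ∈ Λ, Module.finrank ℝ (Fm x) = q ∧ Module.finrank ℝ (Fp x) = p := by
  have hex : ∀ x, ∃ M L : Submodule ℝ (E x), x ∈ Λ →
      Module.finrank ℝ M = q ∧ Module.finrank ℝ L = p ∧ IsCompl M L ∧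
      (∀ v, v ∈ M ↔ (⟨x, v⟩ : TotalSpace F E) ∈ stableCone A J Λ) ∧
      ∀ v, v ∈ L ↔ (⟨x, v⟩ : TotalSpace F E) ∈ unstableCone A J Λ := by
    intro x
    by_cases hx : x ∈ Λ
    · obtain ⟨M, L, h⟩ := exists_isCompl_submodules hΛ hJ hJc hp hq hpq hx
      exact ⟨M, L, fun _ => h⟩
    · exact ⟨⊥, ⊥, fun h => absurd h hx⟩
  choose Fm Fp hF using hex
  have hm : ∀ x ∈ Λ, ∀ v, v ∈ Fm x ↔ (⟨x, v⟩ : TotalSpace F E) ∈ stableCone A J Λ :=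
    fun x hx => (hF x hx).2.2.2.1
  have hpl : ∀ x ∈ Λ, ∀ v, v ∈ Fp x ↔ (⟨x, v⟩ : TotalSpace F E) ∈ unstableCone A J Λ :=
    fun x hx => (hF x hx).2.2.2.2
  obtain ⟨C, lam, hC, hlam, hdom⟩ := exists_domination hΛ hJ hJc
  refine ⟨Fm, Fp, ⟨fun x hx => (hF x hx).2.2.1, fun x hx h => ?_, fun x hx h => ?_, ?_, ?_,
    fun x hx t => ?_, fun x hx t => ?_, C + 1, lam, by positivity, hlam, fun x hx t ht => ?_⟩,
    fun x hx => ⟨(hF x hx).1, (hF x hx).2.1⟩⟩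
  · have := (hF x hx).1
    rw [h, finrank_bot] at this
    omega
  · have := (hF x hx).2.1
    rw [h, finrank_bot] at this
    omega
  · refine isContinuousSubbundleOn_of_isCompact (fun x hx => (hF x hx).1) fun R => ?_
    convert isCompact_stableCone_inter (A := A) hΛ hJc R using 1
    ext v
    constructor
    · rintro ⟨h1, h2, h3⟩
      exact ⟨(hm _ h1 _).1 h2, h3⟩
    · rintro ⟨h1, h2⟩
      exact ⟨h1.1, (hm _ h1.1 _).2 h1, h2⟩
  · refine isContinuousSubbundleOn_of_isCompact (fun x hx => (hF x hx).2.1) fun R => ?_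
    convert isCompact_unstableCone_inter (A := A) hΛ hJc R using 1
    ext v
    constructor
    · rintro ⟨h1, h2, h3⟩
      exact ⟨(hpl _ h1 _).1 h2, h3⟩
    · rintro ⟨h1, h2⟩
      exact ⟨h1.1, (hpl _ h1.1 _).2 h1, h2⟩
  · ext v
    obtain ⟨u, rfl⟩ := (A.toFun t x).surjective v
    rw [(A.toFun t x).injective.mem_set_image, SetLike.mem_coe, SetLike.mem_coe, hm x hx,
      hm _ (hΛ.map_mem t x hx)]
    exact (totalFlow_mem_stableCone_iff hΛ hJ t (v := ⟨x, u⟩) hx).symm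
  · ext v
    obtain ⟨u, rfl⟩ := (A.toFun t x).surjective v
    rw [(A.toFun t x).injective.mem_set_image, SetLike.mem_coe, SetLike.mem_coe, hpl x hx,
      hpl _ (hΛ.map_mem t x hx)]
    exact (totalFlow_mem_unstableCone_iff hΛ hJ t (v := ⟨x, u⟩) hx).symm
  · refine lt_of_le_of_lt (opNorm_mul_opNorm_le _ _ (C := C * Real.exp (-lam * t)) (by positivity)
      ?_) (mul_lt_mul_of_pos_right (lt_add_one C) (Real.exp_pos _))
    rintro ⟨w, hw⟩ ⟨v, hv⟩
    obtain ⟨u, rfl⟩ := (A.toFun t x).surjective v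
    rw [hpl _ (hΛ.map_mem t x hx)] at hv
    have hu : (⟨x, u⟩ : TotalSpace F E) ∈ unstableCone A J Λ :=
      (totalFlow_mem_unstableCone_iff hΛ hJ t hx).1 hv
    have h1 := hdom t _ hu _ ((hm x hx w).1 hw) rfl
    have h2 : ‖A.toFun t x w‖ * ‖u‖ ≤ C * Real.exp (-lam * t) * (‖A.toFun t x u‖ * ‖w‖) := h1
    simp only [ContinuousLinearMap.comp_apply, Submodule.subtypeL_apply,
      ContinuousLinearEquiv.coe_coe, ContinuousLinearEquiv.symm_apply_apply, Submodule.coe_norm]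
    linarith

end Splitting

/-! ### Growth rates along a dominated splitting -/

section Growth

/-- If the increments of `a` over time `T` are at most `T d(t) - η`, then `a` grows at most like the
primitive of `d - η / T`, up to a bounded error: integrate the inequality, which telescopes to a
comparison of the averages of `a` over `[S, S + T]` and `[0, T]`. -/
theorem sub_le_integral_of_increment_le {a d : ℝ → ℝ} (ha : Continuous a) (hd : Continuous d)
    {T η C : ℝ} (hT : 0 < T) (hinc : ∀ t, 0 ≤ t → a (t + T) - a t ≤ T * d t - η)
    (hC : ∀ t, 0 ≤ t → ∀ s ∈ Icc 0 T, |a (t + s) - a t| ≤ C) {S : ℝ} (hS : 0 ≤ S) :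
    a S - a 0 ≤ (∫ t in 0..S, d t) - η / T * S + 2 * C := by
  have hai : ∀ x y, IntervalIntegrable a MeasureTheory.volume x y := fun x y =>
    ha.intervalIntegrable x y
  have h1 : (∫ t in S..S + T, a t) - ∫ t in 0..T, a t = ∫ t in 0..S, (a (t + T) - a t) := by
    have hshift : Continuous fun t => a (t + T) := by fun_prop
    rw [intervalIntegral.integral_sub (hshift.intervalIntegrable _ _) (hai _ _),
      intervalIntegral.integral_comp_add_right (fun t => a t) T, zero_add]
    have e1 := intervalIntegral.integral_add_adjacent_intervals (hai 0 T) (hai T (S + T))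
    have e2 := intervalIntegral.integral_add_adjacent_intervals (hai 0 S) (hai S (S + T))
    linarith
  have h2 : (∫ t in 0..S, (a (t + T) - a t)) ≤ ∫ t in 0..S, (T * d t - η) := by
    refine intervalIntegral.integral_mono_on hS
      ((Continuous.sub (by fun_prop) ha).intervalIntegrable _ _)
      ((Continuous.intervalIntegrable (by fun_prop)) _ _) fun t ht => hinc t ht.1
  have h3 : (∫ t in 0..S, (T * d t - η)) = T * (∫ t in 0..S, d t) - η * S := by
    rw [intervalIntegral.integral_sub ((hd.const_mul T).intervalIntegrable _ _)
      (continuous_const.intervalIntegrable _ _), intervalIntegral.integral_const_mul,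
      intervalIntegral.integral_const]
    simp [mul_comm]
  have h4 : T * (a S - C) ≤ ∫ t in S..S + T, a t := by
    have : (∫ _ in S..S + T, (a S - C)) ≤ ∫ t in S..S + T, a t := by
      refine intervalIntegral.integral_mono_on (by linarith)
        (continuous_const.intervalIntegrable _ _) (hai _ _) fun t ht => ?_
      have := (abs_le.1 (hC S hS (t - S) ⟨by linarith [ht.1], by linarith [ht.2]⟩)).1
      rw [add_sub_cancel] at this
      linarith
    rw [intervalIntegral.integral_const, smul_eq_mul] at this
    linarith
  have h5 : (∫ t in 0..T, a t) ≤ T * (a 0 + C) := by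
    have : (∫ t in 0..T, a t) ≤ ∫ _ in 0..T, (a 0 + C) := by
      refine intervalIntegral.integral_mono_on hT.le (hai _ _)
        (continuous_const.intervalIntegrable _ _) fun t ht => ?_
      have := (abs_le.1 (hC 0 le_rfl t ht)).2
      rw [zero_add] at this
      linarith
    rw [intervalIntegral.integral_const, smul_eq_mul] at this
    linarith
  have h6 : T * (a S - a 0) ≤ T * ((∫ t in 0..S, d t) - η / T * S + 2 * C) := by
    have : T * ((∫ t in 0..S, d t) - η / T * S + 2 * C) =
        T * (∫ t in 0..S, d t) - η * S + T * (2 * C) := by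
      field_simp
    rw [this]
    linarith
  exact le_of_mul_le_mul_left h6 hT

variable {EM : Type*} [NormedAddCommGroup EM] [NormedSpace ℝ EM]
  {H : Type*} [TopologicalSpace H] {I : ModelWithCorners ℝ EM H}
  {B : Type*} [TopologicalSpace B] [ChartedSpace H B]
  {F : Type*} [NormedAddCommGroup F] [NormedSpace ℝ F]
  {E : B → Type*} [TopologicalSpace (TotalSpace F E)] [∀ x, NormedAddCommGroup (E x)]
  [∀ x, InnerProductSpace ℝ (E x)] [FiberBundle F E]
  {ψ : Flow ℝ≥0 B} {A : LinearCocycle I F E ψ} {Λ : Set B}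
  [VectorBundle ℝ F E] [FiniteDimensional ℝ F] [IsContinuousRiemannianBundle F E]
  [T2Space B] [LocallyCompactSpace B]

variable (F) in
/-- The unit vectors over `Λ` of a family of subspaces. -/
def unitVectors (Λ : Set B) (W : ∀ x : B, Submodule ℝ (E x)) : Set (TotalSpace F E) :=
  {v | v.1 ∈ Λ ∧ v.2 ∈ W v.1 ∧ fiberNorm v = 1}

theorem isCompact_unitVectors (hΛ : IsCompact Λ) {W : ∀ x : B, Submodule ℝ (E x)}
    (hW : IsContinuousSubbundleOn F Λ W) : IsCompact (unitVectors F Λ W) := by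
  suffices h : ∃ C : Set (TotalSpace F E), IsCompact C ∧
      {v | v.1 ∈ Λ ∧ v.2 ∈ W v.1 ∧ fiberNorm v = 1} ⊆ C ∧ C ⊆ unitVectors F Λ W by
    obtain ⟨C, hC, h1, h2⟩ := h
    rwa [← Subset.antisymm h1 h2] at hC
  refine hΛ.induction_on (p := fun s => ∃ C : Set (TotalSpace F E), IsCompact C ∧
      {v | v.1 ∈ s ∧ v.2 ∈ W v.1 ∧ fiberNorm v = 1} ⊆ C ∧ C ⊆ unitVectors F Λ W)
    ⟨∅, isCompact_empty, by rintro v ⟨hv, -⟩; exact hv.elim, empty_subset _⟩ ?_ ?_ ?_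
  · rintro s t hst ⟨C, hC, hsub, hC'⟩
    exact ⟨C, hC, fun v hv => hsub ⟨hst hv.1, hv.2⟩, hC'⟩
  · rintro s t ⟨C, hC, hsub, hCs⟩ ⟨C', hC', hsub', hCs'⟩
    refine ⟨C ∪ C', hC.union hC', ?_, union_subset hCs hCs'⟩
    rintro v ⟨hv | hv, hv'⟩
    · exact Or.inl (hsub ⟨hv, hv'⟩)
    · exact Or.inr (hsub' ⟨hv, hv'⟩)
  intro x hx
  obtain ⟨N, hN, k, σ, hσ, hspan⟩ := hW x hx
  obtain ⟨N₀, hN₀, hxN₀, L, hL, hL'⟩ := exists_local_coordinates F E x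
  obtain ⟨O, hO, hON⟩ := mem_nhdsWithin_iff_exists_mem_nhds_inter.1 hN
  obtain ⟨K, hK, hKsub, hKc⟩ := local_compact_nhds (Filter.inter_mem hO (hN₀.mem_nhds hxN₀))
  have hKΛ : IsCompact (K ∩ Λ) := hKc.inter hΛ
  have hsubN : K ∩ Λ ⊆ N := fun y hy => hON ⟨(hKsub hy.1).1, hy.2⟩
  have hsubN₀ : K ∩ Λ ⊆ N₀ := fun y hy => (hKsub hy.1).2
  set m : B × (Fin k → ℝ) → TotalSpace F E := fun p => ⟨p.1, ∑ i, p.2 i • σ i p.1⟩ with hm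
  have hmc : ContinuousOn m ((K ∩ Λ) ×ˢ univ) := by
    have h1 : ∀ i, ContinuousOn (fun y => (L y).symm (σ i y)) (K ∩ Λ) := fun i =>
      hL'.comp ((hσ i).mono hsubN) fun y hy => hsubN₀ hy
    have h2 : ContinuousOn (fun p : B × (Fin k → ℝ) => (p.1, ∑ i, p.2 i • (L p.1).symm (σ i p.1)))
        ((K ∩ Λ) ×ˢ univ) := by
      refine continuousOn_fst.prodMk (continuousOn_finsetSum _ fun i _ => ?_)
      refine ContinuousOn.smul (by fun_prop) ?_
      exact (h1 i).comp continuousOn_fst fun p hp => hp.1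
    refine (hL.comp h2 fun p hp => ⟨hsubN₀ hp.1, trivial⟩).congr fun p _ => ?_
    simp [hm]
  have hmn : ContinuousOn (fun p => fiberNorm (m p)) ((K ∩ Λ) ×ˢ univ) :=
    continuous_norm_snd.comp_continuousOn hmc
  obtain ⟨c, hc, hmin⟩ := (hKΛ.prod (isCompact_sphere (0 : Fin k → ℝ) 1)).exists_forall_le'
    (hmn.mono (prod_mono le_rfl (subset_univ _))) (a := 0) (by
    rintro ⟨y, a⟩ ⟨hy, ha⟩
    rw [fiberNorm_pos_iff]
    intro h0
    have h1 := Fintype.linearIndependent_iff.1 (hspan y (hsubN hy)).1 a h0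
    have : a = 0 := funext h1
    simp [this] at ha)
  have hcl : ∃ Z, IsCompact Z ∧ Z = ((K ∩ Λ) ×ˢ Metric.closedBall (0 : Fin k → ℝ) (1 / c)) ∩
      (fun p => fiberNorm (m p)) ⁻¹' {1} := by
    refine ⟨_, ?_, rfl⟩
    have hcc := hKΛ.prod (isCompact_closedBall (0 : Fin k → ℝ) (1 / c))
    exact hcc.of_isClosed_subset
      ((hmn.mono (prod_mono le_rfl (subset_univ _))).preimage_isClosed_of_isClosed hcc.isClosed
        isClosed_singleton) inter_subset_left
  obtain ⟨Z, hZ, hZeq⟩ := hcl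
  refine ⟨K ∩ Λ, Filter.inter_mem (mem_nhdsWithin_of_mem_nhds hK) self_mem_nhdsWithin, m '' Z,
    hZ.image_of_continuousOn (hmc.mono ?_), ?_, ?_⟩
  · rw [hZeq]
    rintro p ⟨hp, -⟩
    exact ⟨hp.1, trivial⟩
  · rintro ⟨y, v⟩ ⟨hy, hv, hv1⟩
    have hv' : v ∈ Submodule.span ℝ (range fun i => σ i y) := by
      rw [(hspan y (hsubN hy)).2]
      exact hv
    obtain ⟨a, rfl⟩ := (Submodule.mem_span_range_iff_exists_fun ℝ).1 hv'
    refine ⟨(y, a), ?_, rfl⟩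
    rw [hZeq]
    refine ⟨⟨hy, ?_⟩, hv1⟩
    rw [mem_closedBall_zero_iff]
    rcases eq_or_ne a 0 with rfl | ha
    · rw [norm_zero]
      positivity
    have hpos : 0 < ‖a‖ := norm_pos_iff.2 ha
    have h1 := hmin (y, ‖a‖⁻¹ • a) ⟨hy, by simp [norm_smul, hpos.ne']⟩
    have h2 : m (y, ‖a‖⁻¹ • a) = fiberSMul ‖a‖⁻¹ (m (y, a)) := by
      refine congrArg (TotalSpace.mk y) ?_
      rw [Finset.smul_sum]
      exact Finset.sum_congr rfl fun i _ => mul_smul _ _ _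
    rw [h2, fiberNorm_smul, abs_of_pos (inv_pos.2 hpos), show fiberNorm (m (y, a)) = 1 from hv1,
      mul_one] at h1
    rw [le_div_iff₀ hc]
    calc ‖a‖ * c ≤ ‖a‖ * ‖a‖⁻¹ := mul_le_mul_of_nonneg_left h1 hpos.le
      _ = 1 := mul_inv_cancel₀ hpos.ne'
  · rintro _ ⟨⟨y, a⟩, hZy, rfl⟩
    rw [hZeq] at hZy
    obtain ⟨⟨hy, -⟩, h1⟩ := hZy
    refine ⟨hy.2, ?_, h1⟩
    change ∑ i, a i • σ i y ∈ W y
    rw [← (hspan y (hsubN hy)).2]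
    exact Submodule.sum_mem _ fun i _ => Submodule.smul_mem _ _ (Submodule.subset_span ⟨i, rfl⟩)

end Growth

section Rates

variable {EM : Type*} [NormedAddCommGroup EM] [NormedSpace ℝ EM]
  {H : Type*} [TopologicalSpace H] {I : ModelWithCorners ℝ EM H}
  {B : Type*} [TopologicalSpace B] [ChartedSpace H B]
  {F : Type*} [NormedAddCommGroup F] [NormedSpace ℝ F]
  {E : B → Type*} [TopologicalSpace (TotalSpace F E)] [∀ x, NormedAddCommGroup (E x)]
  [∀ x, InnerProductSpace ℝ (E x)] [FiberBundle F E]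
  {ψ : Flow ℝ≥0 B} {A : LinearCocycle I F E ψ} {Λ : Set B}
  {Fm Fp : ∀ x : B, Submodule ℝ (E x)}

/-- Vectorwise form of the domination inequality. -/
theorem LinearCocycle.IsDominatedSplittingOn.exists_mul_le
    (h : A.IsDominatedSplittingOn Λ Fm Fp) :
    ∃ K lam : ℝ, 0 < lam ∧ ∀ x ∈ Λ, ∀ t : ℝ≥0, 0 < t → ∀ w ∈ Fm x, ∀ v ∈ Fp x,
      ‖A.toFun t x w‖ * ‖v‖ ≤ K * Real.exp (-lam * t) * (‖w‖ * ‖A.toFun t x v‖) := by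
  obtain ⟨K, lam, -, hlam, hdom⟩ := h.dominated
  refine ⟨K, lam, hlam, fun x hx t ht w hw v hv => ?_⟩
  have hv' : A.toFun t x v ∈ Fp (ψ t x) := by
    have : A.toFun t x v ∈ (A.toFun t x : E x → E (ψ t x)) '' (Fp x : Set (E x)) := ⟨v, hv, rfl⟩
    rwa [h.right_invariant x hx t] at this
  have h1 := ((A.toFun t x : E x →L[ℝ] E (ψ t x)).comp (Fm x).subtypeL).le_opNorm ⟨w, hw⟩
  have h2 := (((A.toFun t x).symm : E (ψ t x) →L[ℝ] E x).comp
    (Fp (ψ t x)).subtypeL).le_opNorm ⟨A.toFun t x v, hv'⟩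
  simp only [ContinuousLinearMap.comp_apply, Submodule.subtypeL_apply,
    ContinuousLinearEquiv.coe_coe, ContinuousLinearEquiv.symm_apply_apply,
    Submodule.coe_norm] at h1 h2
  calc ‖A.toFun t x w‖ * ‖v‖ ≤ _ := mul_le_mul h1 h2 (norm_nonneg _) (by positivity)
    _ = (‖(A.toFun t x : E x →L[ℝ] E (ψ t x)).comp (Fm x).subtypeL‖ *
        ‖((A.toFun t x).symm : E (ψ t x) →L[ℝ] E x).comp (Fp (ψ t x)).subtypeL‖) *
        (‖w‖ * ‖A.toFun t x v‖) := by ring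
    _ ≤ _ := mul_le_mul_of_nonneg_right (hdom x hx t ht).le (by positivity)

theorem LinearCocycle.IsDominatedSplittingOn.totalFlow_mem_left
    (h : A.IsDominatedSplittingOn Λ Fm Fp) (t : ℝ≥0) {v : TotalSpace F E} (hv : v.1 ∈ Λ)
    (hv' : v.2 ∈ Fm v.1) : (A.totalFlow t v).2 ∈ Fm (A.totalFlow t v).1 := by
  have : A.toFun t v.1 v.2 ∈ (A.toFun t v.1 : E v.1 → E (ψ t v.1)) '' (Fm v.1 : Set (E v.1)) :=
    ⟨v.2, hv', rfl⟩
  rwa [h.left_invariant v.1 hv t] at this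

theorem LinearCocycle.IsDominatedSplittingOn.totalFlow_mem_right
    (h : A.IsDominatedSplittingOn Λ Fm Fp) (t : ℝ≥0) {v : TotalSpace F E} (hv : v.1 ∈ Λ)
    (hv' : v.2 ∈ Fp v.1) : (A.totalFlow t v).2 ∈ Fp (A.totalFlow t v).1 := by
  have : A.toFun t v.1 v.2 ∈ (A.toFun t v.1 : E v.1 → E (ψ t v.1)) '' (Fp v.1 : Set (E v.1)) :=
    ⟨v.2, hv', rfl⟩
  rwa [h.right_invariant v.1 hv t] at this

variable [VectorBundle ℝ F E] [FiniteDimensional ℝ F] [IsContinuousRiemannianBundle F E]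
  [T2Space B] [LocallyCompactSpace B]

theorem continuous_fiberNorm_totalFlow (t : ℝ≥0) :
    Continuous fun v => fiberNorm (A.totalFlow t v) :=
  continuous_norm_snd.comp (A.totalFlow.continuous_toFun t)

theorem exists_mem_unitVectors {W : ∀ x : B, Submodule ℝ (E x)} {x : B} (hx : x ∈ Λ)
    (hW : W x ≠ ⊥) : ∃ v ∈ unitVectors F Λ W, v.1 = x := by
  obtain ⟨v, hv, hv0⟩ := (W x).exists_mem_ne_zero_of_ne_bot hW
  have hpos : 0 < ‖v‖ := norm_pos_iff.2 hv0
  exact ⟨⟨x, ‖v‖⁻¹ • v⟩, ⟨hx, (W x).smul_mem _ hv,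
    fiberNorm_normalize (F := F) (v := ⟨x, v⟩) hpos⟩, rfl⟩

/-- For a dominated splitting, a continuous function `δ` on the base separates the exponential
growth rates of the two subbundles over a fixed time `T`. Over a single point the rates are
separated by a constant, which also works nearby; the constants are glued by a partition of
unity. -/
theorem LinearCocycle.IsDominatedSplittingOn.exists_rate [ParacompactSpace B]
    (hΛ : IsCompact Λ) (h : A.IsDominatedSplittingOn Λ Fm Fp) :
    ∃ (T : ℝ≥0) (δ : C(B, ℝ)) (η : ℝ), 0 < T ∧ 0 < η ∧
      (∀ v ∈ unitVectors F Λ Fm, Real.log (fiberNorm (A.totalFlow T v)) ≤ T * δ v.1 - η) ∧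
      ∀ v ∈ unitVectors F Λ Fp, T * δ v.1 + η ≤ Real.log (fiberNorm (A.totalFlow T v)) := by
  obtain ⟨K, lam, hlam, hdom⟩ := h.exists_mul_le
  have hKm := isCompact_unitVectors hΛ h.left_continuous
  have hKp := isCompact_unitVectors hΛ h.right_continuous
  obtain ⟨T, hT, hKT⟩ : ∃ T : ℝ≥0, 0 < T ∧ K * Real.exp (-lam * T) < 1 := by
    have h1 : Filter.Tendsto (fun t : ℝ≥0 => K * Real.exp (-lam * t)) Filter.atTop
        (𝓝 (K * 0)) := by
      refine Filter.Tendsto.const_mul K (Real.tendsto_exp_atBot.comp ?_)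
      exact (NNReal.tendsto_coe_atTop.2 Filter.tendsto_id).const_mul_atTop_of_neg (by linarith)
    rw [mul_zero] at h1
    obtain ⟨T, hT1, hT2⟩ := ((h1.eventually (gt_mem_nhds one_pos)).and
      (Filter.eventually_gt_atTop 0)).exists
    exact ⟨T, hT2, hT1⟩
  have hnorm := continuous_fiberNorm_totalFlow (A := A) T
  have hposm : ∀ v : TotalSpace F E, fiberNorm v = 1 → 0 < fiberNorm (A.totalFlow T v) :=
    fun v hv => A.fiberNorm_totalFlow_pos.2 (by rw [hv]; exact one_pos)
  obtain ⟨g, hg⟩ := exists_continuous_forall_mem_convex_of_local_const (X := B) (E := ℝ)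
    (t := fun x => {c |
      (∀ v ∈ unitVectors F Λ Fm, v.1 = x → fiberNorm (A.totalFlow T v) < Real.exp c) ∧
      ∀ v ∈ unitVectors F Λ Fp, v.1 = x → Real.exp c < fiberNorm (A.totalFlow T v)})
    (fun x => Set.OrdConnected.convex ⟨fun a ha b hb c hc =>
      ⟨fun v hv hvx => (ha.1 v hv hvx).trans_le (Real.exp_le_exp.2 hc.1),
        fun v hv hvx => (Real.exp_le_exp.2 hc.2).trans_lt (hb.2 v hv hvx)⟩⟩)
    (fun x => by
      by_cases hx : x ∈ Λ
      · obtain ⟨vm, hvm, hvmx⟩ := exists_mem_unitVectors (F := F) hx (h.left_ne_bot x hx)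
        obtain ⟨vp, hvp, hvpx⟩ := exists_mem_unitVectors (F := F) hx (h.right_ne_bot x hx)
        have hcl : IsClosed {v : TotalSpace F E | v.1 = x} :=
          isClosed_singleton.preimage (FiberBundle.continuous_proj F E)
        obtain ⟨wm, ⟨hwm, hwmx⟩, hmax⟩ := (hKm.inter_right hcl).exists_isMaxOn
          ⟨vm, hvm, hvmx⟩ hnorm.continuousOn
        obtain ⟨wp, ⟨hwp, hwpx⟩, hmin⟩ := (hKp.inter_right hcl).exists_isMinOn
          ⟨vp, hvp, hvpx⟩ hnorm.continuousOn
        have hlt : fiberNorm (A.totalFlow T wm) < fiberNorm (A.totalFlow T wp) := by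
          obtain ⟨y, wm⟩ := wm
          obtain ⟨z, wp⟩ := wp
          obtain rfl : y = x := hwmx
          obtain rfl : z = y := hwpx
          have h1 := hdom z hx T hT wm hwm.2.1 wp hwp.2.1
          have h2 : ‖wm‖ = 1 := hwm.2.2
          have h3 : ‖wp‖ = 1 := hwp.2.2
          rw [h2, h3, mul_one, one_mul] at h1
          have h4 : 0 < ‖A.toFun T z wp‖ := hposm _ hwp.2.2
          change ‖A.toFun T z wm‖ < ‖A.toFun T z wp‖
          nlinarith
        obtain ⟨r, hr1, hr2⟩ := exists_between hlt
        have hr : 0 < r := (hposm _ hwm.2.2).trans hr1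
        refine ⟨Real.log r, ?_⟩
        have e1 := eventually_forall_pos_of_isCompact hKm
          (g := fun v => r - fiberNorm (A.totalFlow T v)) (x₀ := x)
          (continuous_const.sub hnorm).continuousOn
          (fun v hv hvx => sub_pos.2 ((hmax ⟨hv, hvx⟩).trans_lt hr1))
        have e2 := eventually_forall_pos_of_isCompact hKp
          (g := fun v => fiberNorm (A.totalFlow T v) - r) (x₀ := x)
          (hnorm.sub continuous_const).continuousOn
          (fun v hv hvx => sub_pos.2 (hr2.trans_le (hmin ⟨hv, hvx⟩)))
        filter_upwards [e1, e2] with y h1 h2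
        refine ⟨fun v hv hvy => ?_, fun v hv hvy => ?_⟩
        · rw [Real.exp_log hr]
          exact sub_pos.1 (h1 v hv hvy)
        · rw [Real.exp_log hr]
          exact sub_pos.1 (h2 v hv hvy)
      · refine ⟨0, ?_⟩
        filter_upwards [hΛ.isClosed.isOpen_compl.mem_nhds hx] with y hy
        exact ⟨fun v hv hvy => absurd (hvy ▸ hv.1) hy, fun v hv hvy => absurd (hvy ▸ hv.1) hy⟩)
  have hgc : Continuous fun v : TotalSpace F E => g v.1 :=
    g.continuous.comp (FiberBundle.continuous_proj F E)
  have hlog : ∀ W : ∀ x : B, Submodule ℝ (E x),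
      ContinuousOn (fun v => Real.log (fiberNorm (A.totalFlow T v))) (unitVectors F Λ W) :=
    fun W => hnorm.continuousOn.log fun v hv => (hposm v hv.2.2).ne'
  obtain ⟨η₁, hη₁, h1⟩ := hKm.exists_forall_le' (a := 0)
    (hgc.continuousOn.sub (hlog Fm)) (fun v hv => by
      rw [Pi.sub_apply, sub_pos, Real.log_lt_iff_lt_exp (hposm v hv.2.2)]
      exact (hg v.1).1 v hv rfl)
  obtain ⟨η₂, hη₂, h2⟩ := hKp.exists_forall_le' (a := 0)
    ((hlog Fp).sub hgc.continuousOn) (fun v hv => by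
      rw [Pi.sub_apply, sub_pos, Real.lt_log_iff_exp_lt (hposm v hv.2.2)]
      exact (hg v.1).2 v hv rfl)
  have hT' : (T : ℝ) ≠ 0 := by exact_mod_cast hT.ne'
  refine ⟨T, ⟨fun x => (T : ℝ)⁻¹ * g x, by fun_prop⟩, min η₁ η₂, hT, lt_min hη₁ hη₂,
    fun v hv => ?_, fun v hv => ?_⟩
  · have := h1 v hv
    simp only [ContinuousMap.coe_mk, mul_inv_cancel_left₀ hT']
    rw [Pi.sub_apply] at this
    linarith [min_le_left η₁ η₂]
  · have := h2 v hv
    simp only [ContinuousMap.coe_mk, mul_inv_cancel_left₀ hT']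
    rw [Pi.sub_apply] at this
    linarith [min_le_right η₁ η₂]

/-- The integral of `δ` along the orbit of `x` up to time `t`. -/
noncomputable def orbitIntegral (ψ : Flow ℝ≥0 B) (δ : B → ℝ) (x : B) (t : ℝ) : ℝ :=
  ∫ s in 0..t, δ (ψ s.toNNReal x)

/-- Over all times `S`, the two subbundles of a dominated splitting are separated by the
multiplicative cocycle `exp (∫ δ)`, with an exponential gap. -/
theorem LinearCocycle.IsDominatedSplittingOn.exists_orbitIntegral [ParacompactSpace B]
    (hΛ : IsCompact Λ) (hmap : ∀ t, ∀ x ∈ Λ, ψ t x ∈ Λ) (h : A.IsDominatedSplittingOn Λ Fm Fp) :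
    ∃ (δ : C(B, ℝ)) (C κ : ℝ), 0 < C ∧ 0 < κ ∧ ∀ S : ℝ≥0,
      (∀ v ∈ unitVectors F Λ Fm, fiberNorm (A.totalFlow S v) ≤
        C * Real.exp (-κ * S) * Real.exp (orbitIntegral ψ δ v.1 S)) ∧
      ∀ v ∈ unitVectors F Λ Fp, Real.exp (orbitIntegral ψ δ v.1 S) ≤
        C * Real.exp (-κ * S) * fiberNorm (A.totalFlow S v) := by
  obtain ⟨T, δ, η, hT, hη, hm, hp⟩ := h.exists_rate hΛ
  obtain ⟨c, D, hc, hD, hcD⟩ := A.exists_norm_bounds hΛ T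
  obtain ⟨C, hC⟩ : ∃ C, C = max |Real.log c| |Real.log D| := ⟨_, rfl⟩
  have hT' : (0 : ℝ) < T := by exact_mod_cast hT
  refine ⟨δ, Real.exp (2 * C), η / T, Real.exp_pos _, by positivity, fun S => ?_⟩
  -- the logarithm of the norm along an orbit and its increments
  have hpos : ∀ v : TotalSpace F E, fiberNorm v = 1 → ∀ t, 0 < fiberNorm (A.totalFlow t v) :=
    fun v hv t => A.fiberNorm_totalFlow_pos.2 (by rw [hv]; exact one_pos)
  have hcont : ∀ v : TotalSpace F E, fiberNorm v = 1 →
      Continuous fun t : ℝ => Real.log (fiberNorm (A.totalFlow t.toNNReal v)) := by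
    intro v hv
    refine Continuous.log ?_ fun t => (hpos v hv _).ne'
    exact continuous_norm_snd.comp
      (A.totalFlow.continuous continuous_real_toNNReal continuous_const)
  have hδ : ∀ x, Continuous fun t : ℝ => δ (ψ t.toNNReal x) := fun x =>
    δ.continuous.comp (ψ.continuous continuous_real_toNNReal continuous_const)
  have hbdd : ∀ v : TotalSpace F E, v.1 ∈ Λ → fiberNorm v = 1 → ∀ t : ℝ, 0 ≤ t →
      ∀ s ∈ Icc (0 : ℝ) T, |Real.log (fiberNorm (A.totalFlow (t + s).toNNReal v)) -
        Real.log (fiberNorm (A.totalFlow t.toNNReal v))| ≤ C := by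
    intro v hv hv1 t ht s hs
    have h1 := hcD s.toNNReal (Real.toNNReal_le_iff_le_coe.2 hs.2) (A.totalFlow t.toNNReal v)
      (hmap _ _ hv)
    rw [← A.totalFlow.map_add, ← Real.toNNReal_add hs.1 ht, add_comm s t] at h1
    have h2 := hpos v hv1 t.toNNReal
    have h3 := hpos v hv1 (t + s).toNNReal
    rw [abs_le]
    constructor
    · have := Real.log_le_log (mul_pos hc h2) h1.1
      rw [Real.log_mul hc.ne' h2.ne'] at this
      have h4 := (neg_abs_le (Real.log c))
      have h5 := le_max_left |Real.log c| |Real.log D|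
      rw [hC]
      linarith
    · have := Real.log_le_log h3 h1.2
      rw [Real.log_mul hD.ne' h2.ne'] at this
      have h4 := (le_abs_self (Real.log D))
      have h5 := le_max_right |Real.log c| |Real.log D|
      rw [hC]
      linarith
  -- normalizing the vectors along an orbit turns the bounds over time `T` into increments
  have hincr : ∀ v : TotalSpace F E, fiberNorm v = 1 → ∀ t : ℝ, 0 ≤ t →
      Real.log (fiberNorm (A.totalFlow (t + T).toNNReal v)) -
        Real.log (fiberNorm (A.totalFlow t.toNNReal v)) =
      Real.log (fiberNorm (A.totalFlow T (fiberSMul (fiberNorm (A.totalFlow t.toNNReal v))⁻¹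
        (A.totalFlow t.toNNReal v)))) := by
    intro v hv t ht
    have h2 := hpos v hv t.toNNReal
    have h3 := hpos v hv (t + T).toNNReal
    rw [A.totalFlow_smul, fiberNorm_smul, abs_of_pos (inv_pos.2 h2), ← A.totalFlow.map_add]
    have : T + t.toNNReal = (t + T).toNNReal := by
      rw [Real.toNNReal_add ht T.coe_nonneg, add_comm]
      simp
    rw [this, Real.log_mul (inv_ne_zero h2.ne') h3.ne', Real.log_inv]
    ring
  constructor
  · rintro v ⟨hv, hvm, hv1⟩
    have := sub_le_integral_of_increment_le (hcont v hv1) (hδ v.1) hT' (η := η) (C := C)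
      (fun t ht => by
        rw [hincr v hv1 t ht]
        exact hm _ ⟨hmap _ _ hv, Submodule.smul_mem _ _ (h.totalFlow_mem_left _ hv hvm),
          fiberNorm_normalize (hpos v hv1 _)⟩)
      (hbdd v hv hv1) S.2
    simp only [Real.toNNReal_zero, A.totalFlow.map_zero_apply, hv1, Real.log_one, sub_zero] at this
    rw [← Real.log_le_log_iff (hpos v hv1 S) (by positivity), ← Real.exp_add, ← Real.exp_add,
      Real.log_exp]
    have h4 : Real.toNNReal (S : ℝ) = S := Real.toNNReal_coe
    change Real.log (fiberNorm (A.totalFlow (Real.toNNReal (S : ℝ)) v)) ≤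
      (∫ t in (0 : ℝ)..S, δ (ψ t.toNNReal v.1)) - η / T * S + 2 * C at this
    rw [h4] at this
    rw [orbitIntegral]
    linarith
  · rintro v ⟨hv, hvp, hv1⟩
    have := sub_le_integral_of_increment_le (hcont v hv1).neg (hδ v.1).neg hT' (η := η) (C := C)
      (fun t ht => by
        have h5 := hp _ ⟨hmap t.toNNReal _ hv,
          Submodule.smul_mem _ (fiberNorm (A.totalFlow t.toNNReal v))⁻¹
            (h.totalFlow_mem_right t.toNNReal hv hvp),
          fiberNorm_normalize (hpos v hv1 t.toNNReal)⟩
        have h6 := hincr v hv1 t ht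
        change _ ≤ Real.log (fiberNorm (A.totalFlow T
          (fiberSMul (fiberNorm (A.totalFlow t.toNNReal v))⁻¹ (A.totalFlow t.toNNReal v)))) at h5
        rw [← h6] at h5
        change T * δ (ψ t.toNNReal v.1) + η ≤ _ at h5
        simp only [Pi.neg_apply]
        linarith)
      (fun t ht s hs => by
        have := hbdd v hv hv1 t ht s hs
        rw [abs_sub_comm] at this
        simpa only [Pi.neg_apply, neg_sub_neg] using this) S.2
    simp only [Pi.neg_apply, Real.toNNReal_zero, A.totalFlow.map_zero_apply, hv1, Real.log_one,
      sub_zero, neg_zero, intervalIntegral.integral_neg] at this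
    rw [← Real.log_le_log_iff (Real.exp_pos _) (mul_pos (by positivity) (hpos v hv1 S)),
      Real.log_mul (by positivity) (hpos v hv1 S).ne', ← Real.exp_add, Real.log_exp, Real.log_exp]
    have h4 : Real.toNNReal (S : ℝ) = S := Real.toNNReal_coe
    change -Real.log (fiberNorm (A.totalFlow (Real.toNNReal (S : ℝ)) v)) ≤
      -(∫ t in (0 : ℝ)..S, δ (ψ t.toNNReal v.1)) - η / T * S + 2 * C at this
    rw [h4] at this
    rw [orbitIntegral]
    linarith

end Rates

/-! ### A continuous field of forms adapted to a dominated splitting -/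

section AdaptedForm

theorem abs_polar_le {V : Type*} [NormedAddCommGroup V] [NormedSpace ℝ V] (Q : QuadraticForm ℝ V)
    {C : ℝ} (hQ : ∀ u, |Q u| ≤ C * ‖u‖ ^ 2) (v w : V) :
    |QuadraticMap.polar Q v w| ≤ 6 * C * (‖v‖ * ‖w‖) := by
  rcases eq_or_ne v 0 with rfl | hv
  · simp
  rcases eq_or_ne w 0 with rfl | hw
  · simp
  have hunit : ∀ v w : V, ‖v‖ = 1 → ‖w‖ = 1 → |QuadraticMap.polar Q v w| ≤ 6 * C := by
    intro v w hv hw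
    have h1 := hQ v
    have h2 := hQ w
    have h3 := hQ (v + w)
    rw [hv, one_pow, mul_one] at h1
    rw [hw, one_pow, mul_one] at h2
    have h4 : ‖v + w‖ ^ 2 ≤ 2 ^ 2 := by
      refine pow_le_pow_left₀ (norm_nonneg _) ?_ 2
      linarith [norm_add_le v w]
    have hC : 0 ≤ C := (abs_nonneg _).trans h1
    have h5 : |Q (v + w)| ≤ 4 * C := by nlinarith
    rw [QuadraticMap.polar]
    calc |Q (v + w) - Q v - Q w| ≤ |Q (v + w) - Q v| + |Q w| := abs_sub _ _
      _ ≤ |Q (v + w)| + |Q v| + |Q w| := by linarith [abs_sub (Q (v + w)) (Q v)]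
      _ ≤ 6 * C := by linarith
  have hv' : 0 < ‖v‖ := norm_pos_iff.2 hv
  have hw' : 0 < ‖w‖ := norm_pos_iff.2 hw
  have h := hunit (‖v‖⁻¹ • v) (‖w‖⁻¹ • w)
    (by rw [norm_smul, norm_inv, norm_norm, inv_mul_cancel₀ hv'.ne'])
    (by rw [norm_smul, norm_inv, norm_norm, inv_mul_cancel₀ hw'.ne'])
  rw [QuadraticMap.polar_smul_left, QuadraticMap.polar_smul_right, smul_eq_mul, smul_eq_mul,
    abs_mul, abs_mul, abs_of_pos (inv_pos.2 hv'), abs_of_pos (inv_pos.2 hw')] at h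
  rw [← mul_assoc, inv_mul_eq_div, div_mul_eq_mul_div, inv_mul_eq_div, div_div,
    div_le_iff₀ (by positivity)] at h
  linarith

/-- If `Q'` is positive and `Q` negative in the two expanded and contracted directions, by a factor
`R` large compared with the bounds of the forms, then `Q (v + w) < Q' (v' + w')`. -/
theorem form_add_lt_form_add {V V' : Type*} [NormedAddCommGroup V] [NormedSpace ℝ V]
    [NormedAddCommGroup V'] [NormedSpace ℝ V'] {Q : QuadraticForm ℝ V} {Q' : QuadraticForm ℝ V'}
    {C α R : ℝ} (hα : 0 < α) (hC : 0 < C) (hR : 1 ≤ R) (hRC : 24 * C ≤ α * R)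
    (hQ : ∀ u, |Q u| ≤ C * ‖u‖ ^ 2) (hQ' : ∀ u, |Q' u| ≤ C * ‖u‖ ^ 2)
    {v w : V} {v' w' : V'} (hw : Q w ≤ -(α * ‖w‖ ^ 2)) (hv : α * ‖v'‖ ^ 2 ≤ Q' v')
    (hvv : R * ‖v‖ ≤ ‖v'‖) (hww : R * ‖w'‖ ≤ ‖w‖) (h0 : v' ≠ 0 ∨ w ≠ 0) :
    Q (v + w) < Q' (v' + w') := by
  have p1 := (le_abs_self _).trans (abs_polar_le Q hQ v w)
  have p2 := (neg_abs_le _).trans' (neg_le_neg (abs_polar_le Q' hQ' v' w'))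
  have h1 := (le_abs_self _).trans (hQ v)
  have h2 := (neg_abs_le _).trans' (neg_le_neg (hQ' w'))
  rw [QuadraticMap.map_add Q, QuadraticMap.map_add Q']
  have ha := norm_nonneg v'
  have hb := norm_nonneg w
  have hc := norm_nonneg v
  have hd := norm_nonneg w'
  have hpos : 0 < ‖v'‖ ^ 2 + ‖w‖ ^ 2 := by
    rcases h0 with h | h
    · have := norm_pos_iff.2 h
      positivity
    · have := norm_pos_iff.2 h
      positivity
  generalize ‖v'‖ = a at *
  generalize ‖w‖ = b at *
  generalize ‖v‖ = c at *
  generalize ‖w'‖ = d at *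
  have hR0 : 0 < R := by linarith
  have hc1 : C * c ≤ α / 24 * a := by nlinarith
  have hd1 : C * d ≤ α / 24 * b := by nlinarith
  have hca : c ≤ a := by nlinarith
  have hdb : d ≤ b := by nlinarith
  have k1 : C * c ^ 2 ≤ α / 24 * a ^ 2 := by nlinarith [mul_le_mul hc1 hca hc (by positivity)]
  have k2 : C * d ^ 2 ≤ α / 24 * b ^ 2 := by nlinarith [mul_le_mul hd1 hdb hd (by positivity)]
  have k3 : 6 * C * (c * b) ≤ α / 4 * (a * b) := by nlinarith [mul_le_mul_of_nonneg_right hc1 hb]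
  have k4 : 6 * C * (a * d) ≤ α / 4 * (a * b) := by nlinarith [mul_le_mul_of_nonneg_right hd1 ha]
  have k5 : a * b ≤ (a ^ 2 + b ^ 2) / 2 := by nlinarith [sq_nonneg (a - b)]
  have k6 : 0 < α * (a ^ 2 + b ^ 2) := mul_pos hα hpos
  nlinarith

variable {EM : Type*} [NormedAddCommGroup EM] [NormedSpace ℝ EM]
  {H : Type*} [TopologicalSpace H] {I : ModelWithCorners ℝ EM H}
  {B : Type*} [TopologicalSpace B] [ChartedSpace H B]
  {F : Type*} [NormedAddCommGroup F] [NormedSpace ℝ F]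
  {E : B → Type*} [TopologicalSpace (TotalSpace F E)] [∀ x, NormedAddCommGroup (E x)]
  [∀ x, InnerProductSpace ℝ (E x)] [FiberBundle F E]
  {ψ : Flow ℝ≥0 B} {A : LinearCocycle I F E ψ} {Λ : Set B}
  {Fm Fp : ∀ x : B, Submodule ℝ (E x)}
  [VectorBundle ℝ F E] [FiniteDimensional ℝ F] [IsContinuousRiemannianBundle F E]
  [T2Space B] [LocallyCompactSpace B]

/-- The form `‖v₊‖² - ‖v₋‖²` attached to a splitting of an inner product space. -/
theorem exists_form_of_isCompl {V : Type*} [NormedAddCommGroup V] [InnerProductSpace ℝ V]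
    {M L : Submodule ℝ V} (h : IsCompl M L) :
    ∃ Q : QuadraticForm ℝ V, (∀ v ∈ M, Q v = -‖v‖ ^ 2) ∧ ∀ v ∈ L, Q v = ‖v‖ ^ 2 := by
  refine ⟨(LinearMap.BilinMap.toQuadraticMap (innerₗ L)).comp (L.projectionOnto M h.symm) -
    (LinearMap.BilinMap.toQuadraticMap (innerₗ M)).comp (M.projectionOnto L h),
    fun v hv => ?_, fun v hv => ?_⟩
  · have h1 : L.projectionOnto M h.symm v = 0 := (Submodule.projectionOnto_apply_eq_zero_iff _).2 hv
    have h2 : M.projectionOnto L h v = ⟨v, hv⟩ := Submodule.projectionOnto_apply_left h ⟨v, hv⟩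
    simp [h1, h2]
  · have h1 : M.projectionOnto L h v = 0 := (Submodule.projectionOnto_apply_eq_zero_iff _).2 hv
    have h2 : L.projectionOnto M h.symm v = ⟨v, hv⟩ :=
      Submodule.projectionOnto_apply_left h.symm ⟨v, hv⟩
    simp [h1, h2]

/-- A continuous field of forms over the whole base, negative on `Fm` and positive on `Fp` over `Λ`:
locally constant fields have this property near a given point, and it is stable under sums. -/
theorem exists_adapted_form [NormalSpace B] (hΛ : IsCompact Λ)
    (hm : IsCompact (unitVectors F Λ Fm)) (hp : IsCompact (unitVectors F Λ Fp))
    (hcompl : ∀ x ∈ Λ, IsCompl (Fm x) (Fp x)) :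
    ∃ J : ∀ x : B, QuadraticForm ℝ (E x), Continuous (fiberForm (F := F) J) ∧
      (∀ v ∈ unitVectors F Λ Fm, fiberForm J v < 0) ∧
      ∀ v ∈ unitVectors F Λ Fp, 0 < fiberForm J v := by
  suffices h : ∃ J : ∀ x : B, QuadraticForm ℝ (E x), Continuous (fiberForm (F := F) J) ∧
      (∀ v ∈ unitVectors F Λ Fm, fiberForm J v ≤ 0 ∧ (v.1 ∈ Λ → fiberForm J v < 0)) ∧
      ∀ v ∈ unitVectors F Λ Fp, 0 ≤ fiberForm J v ∧ (v.1 ∈ Λ → 0 < fiberForm J v) by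
    obtain ⟨J, hJ, h1, h2⟩ := h
    exact ⟨J, hJ, fun v hv => (h1 v hv).2 hv.1, fun v hv => (h2 v hv).2 hv.1⟩
  refine hΛ.induction_on (p := fun s => ∃ J : ∀ x : B, QuadraticForm ℝ (E x),
      Continuous (fiberForm (F := F) J) ∧
      (∀ v ∈ unitVectors F Λ Fm, fiberForm J v ≤ 0 ∧ (v.1 ∈ s → fiberForm J v < 0)) ∧
      ∀ v ∈ unitVectors F Λ Fp, 0 ≤ fiberForm J v ∧ (v.1 ∈ s → 0 < fiberForm J v)) ?_ ?_ ?_ ?_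
  · exact ⟨fun _ => 0, continuous_const, fun v _ => ⟨le_rfl, fun h => h.elim⟩,
      fun v _ => ⟨le_rfl, fun h => h.elim⟩⟩
  · rintro s t hst ⟨J, hJ, h1, h2⟩
    exact ⟨J, hJ, fun v hv => ⟨(h1 v hv).1, fun h => (h1 v hv).2 (hst h)⟩,
      fun v hv => ⟨(h2 v hv).1, fun h => (h2 v hv).2 (hst h)⟩⟩
  · rintro s t ⟨J, hJ, h1, h2⟩ ⟨J', hJ', h1', h2'⟩
    refine ⟨fun x => J x + J' x, hJ.add hJ', fun v hv => ?_, fun v hv => ?_⟩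
    · obtain ⟨a, b⟩ := h1 v hv
      obtain ⟨a', b'⟩ := h1' v hv
      change fiberForm J v + fiberForm J' v ≤ 0 ∧ (_ → fiberForm J v + fiberForm J' v < 0)
      refine ⟨by linarith, ?_⟩
      rintro (h | h)
      · linarith [b h]
      · linarith [b' h]
    · obtain ⟨a, b⟩ := h2 v hv
      obtain ⟨a', b'⟩ := h2' v hv
      change 0 ≤ fiberForm J v + fiberForm J' v ∧ (_ → 0 < fiberForm J v + fiberForm J' v)
      refine ⟨by linarith, ?_⟩
      rintro (h | h)
      · linarith [b h]
      · linarith [b' h]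
  intro x hx
  have hfd := finiteDimensional_fiber F (E := E) x
  obtain ⟨Q, hQm, hQp⟩ := exists_form_of_isCompl (hcompl x hx)
  have hQc : Continuous Q := by
    have : ∀ v, Q v = LinearMap.toContinuousLinearMap
        (LinearMap.toContinuousLinearMap.toLinearMap ∘ₗ
          (QuadraticMap.associated (R := ℝ) Q)) v v := by
      intro v
      exact (QuadraticMap.associated_eq_self_apply ℝ Q v).symm
    rw [show (Q : E x → ℝ) = _ from funext this]
    fun_prop
  obtain ⟨N, hN, hxN, L, -, hL⟩ := exists_local_coordinates F E x
  set G : ∀ y, QuadraticForm ℝ (E y) := fun y =>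
    Q.comp ((L y).symm.trans (L x) : E y →ₗ[ℝ] E x) with hG
  have hGc : ContinuousOn (fiberForm (F := F) G) {v | v.1 ∈ N} :=
    (hQc.comp (L x).continuous).comp_continuousOn hL
  have hGx : ∀ v : E x, fiberForm G (⟨x, v⟩ : TotalSpace F E) = Q v := by
    intro v
    simp [fiberForm, hG]
  obtain ⟨N₁, hN₁, hN₁N, hN₁c⟩ := local_compact_nhds (hN.mem_nhds hxN)
  have hcl₁ : IsClosed {v : TotalSpace F E | v.1 ∈ N₁} :=
    hN₁c.isClosed.preimage (FiberBundle.continuous_proj F E)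
  have e1 := eventually_forall_pos_of_isCompact (hm.inter_right hcl₁)
    (g := fun v => -fiberForm G v) (x₀ := x) (hGc.neg.mono fun v hv => hN₁N hv.2) (by
      rintro ⟨y, v⟩ ⟨⟨-, hv, hv1⟩, -⟩ hy
      obtain rfl : y = x := hy
      have h1 : ‖v‖ = 1 := hv1
      rw [hGx, hQm v hv, h1]
      norm_num)
  have e2 := eventually_forall_pos_of_isCompact (hp.inter_right hcl₁)
    (g := fun v => fiberForm G v) (x₀ := x) (hGc.mono fun v hv => hN₁N hv.2) (by
      rintro ⟨y, v⟩ ⟨⟨-, hv, hv1⟩, -⟩ hy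
      obtain rfl : y = x := hy
      have h1 : ‖v‖ = 1 := hv1
      rw [hGx, hQp v hv, h1]
      norm_num)
  obtain ⟨N₂, hN₂, hN₂sub, hN₂c⟩ := local_compact_nhds (Filter.inter_mem hN₁ (e1.and e2))
  obtain ⟨f, hf0, hf1, hf⟩ := exists_continuous_zero_one_of_isClosed
    (isOpen_interior (s := N₂)).isClosed_compl (isClosed_singleton (x := x))
    (disjoint_singleton_right.2 fun h => h (mem_interior_iff_mem_nhds.2 hN₂))
  have hfN₂ : ∀ y, y ∉ N₂ → f y = 0 := fun y hy => hf0 fun h => hy (interior_subset h)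
  have hfx : f x = 1 := hf1 rfl
  have hval : ∀ v : TotalSpace F E, fiberForm (fun y => f y • G y) v = f v.1 * fiberForm G v :=
    fun v => rfl
  refine ⟨{y | 0 < f y} ∩ Λ, ?_, fun y => f y • G y, ?_, fun v hv => ?_, fun v hv => ?_⟩
  · refine Filter.inter_mem (mem_nhdsWithin_of_mem_nhds ?_) self_mem_nhdsWithin
    refine (isOpen_lt continuous_const f.continuous).mem_nhds ?_
    change 0 < f x
    rw [hfx]
    exact one_pos
  · rw [continuous_iff_continuousAt]
    intro v
    have hev : fiberForm (fun y => f y • G y) =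
        fun v : TotalSpace F E => f v.1 * fiberForm G v := funext hval
    rw [hev]
    by_cases hv : v.1 ∈ N₂
    · have hvN : v.1 ∈ N := hN₁N (hN₂sub hv).1
      exact (f.continuous.comp (FiberBundle.continuous_proj F E)).continuousAt.mul
        (hGc.continuousAt ((hN.preimage (FiberBundle.continuous_proj F E)).mem_nhds hvN))
    · refine ContinuousAt.congr (f := fun _ => (0 : ℝ)) continuousAt_const ?_
      have hopen : IsOpen {u : TotalSpace F E | u.1 ∈ N₂ᶜ} :=
        hN₂c.isClosed.isOpen_compl.preimage (FiberBundle.continuous_proj F E)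
      filter_upwards [hopen.mem_nhds hv] with u hu
      rw [hfN₂ u.1 hu, zero_mul]
  · rw [hval]
    by_cases hvN : v.1 ∈ N₂
    · have h1 := (hN₂sub hvN).2.1 v ⟨hv, (hN₂sub hvN).1⟩ rfl
      refine ⟨mul_nonpos_of_nonneg_of_nonpos (hf _).1 (by linarith), fun h => ?_⟩
      exact mul_neg_of_pos_of_neg h.1 (by linarith)
    · rw [hfN₂ _ hvN, zero_mul]
      refine ⟨le_rfl, fun h => ?_⟩
      have h1 : 0 < f v.1 := h.1
      rw [hfN₂ _ hvN] at h1
      exact absurd h1 (lt_irrefl _)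
  · rw [hval]
    by_cases hvN : v.1 ∈ N₂
    · have h1 := (hN₂sub hvN).2.2 v ⟨hv, (hN₂sub hvN).1⟩ rfl
      exact ⟨mul_nonneg (hf _).1 h1.le, fun h => mul_pos h.1 h1⟩
    · rw [hfN₂ _ hvN, zero_mul]
      refine ⟨le_rfl, fun h => ?_⟩
      have h1 : 0 < f v.1 := h.1
      rw [hfN₂ _ hvN] at h1
      exact absurd h1 (lt_irrefl _)

end AdaptedForm

/-! ### Averaging a form along the cocycle -/

section AveragedForm

variable {EM : Type*} [NormedAddCommGroup EM] [NormedSpace ℝ EM]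
  {H : Type*} [TopologicalSpace H] {I : ModelWithCorners ℝ EM H}
  {B : Type*} [TopologicalSpace B] [ChartedSpace H B]
  {F : Type*} [NormedAddCommGroup F] [NormedSpace ℝ F]
  {E : B → Type*} [TopologicalSpace (TotalSpace F E)] [∀ x, NormedAddCommGroup (E x)]
  [∀ x, InnerProductSpace ℝ (E x)] [FiberBundle F E]
  {ψ : Flow ℝ≥0 B} {A : LinearCocycle I F E ψ} {Λ : Set B}
  {Fm Fp : ∀ x : B, Submodule ℝ (E x)}

section Expansion

variable [VectorBundle ℝ F E] [FiniteDimensional ℝ F] [IsContinuousRiemannianBundle F E]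
  [T2Space B] [LocallyCompactSpace B]

theorem fiberNorm_le_of_unitVectors {W : ∀ x : B, Submodule ℝ (E x)} {t : ℝ≥0} {v : TotalSpace F E}
    {c : ℝ} (h : ∀ u ∈ unitVectors F Λ W, u.1 = v.1 → fiberNorm (A.totalFlow t u) ≤ c)
    (hv : v.1 ∈ Λ) (hvW : v.2 ∈ W v.1) : fiberNorm (A.totalFlow t v) ≤ c * fiberNorm v := by
  rcases (fiberNorm_nonneg v).eq_or_lt with h0 | h0
  · rw [← h0, mul_zero]
    refine not_lt.1 fun h1 => ?_
    exact h0.not_lt (A.fiberNorm_totalFlow_pos.1 h1)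
  · have := h (fiberSMul (fiberNorm v)⁻¹ v) ⟨hv, Submodule.smul_mem _ _ hvW, fiberNorm_normalize h0⟩
      rfl
    rw [A.totalFlow_smul, fiberNorm_smul, abs_of_pos (inv_pos.2 h0), inv_mul_eq_div,
      div_le_iff₀ h0] at this
    exact this

theorem le_fiberNorm_of_unitVectors {W : ∀ x : B, Submodule ℝ (E x)} {t : ℝ≥0} {v : TotalSpace F E}
    {c : ℝ} (h : ∀ u ∈ unitVectors F Λ W, u.1 = v.1 → c ≤ fiberNorm (A.totalFlow t u))
    (hv : v.1 ∈ Λ) (hvW : v.2 ∈ W v.1) : c * fiberNorm v ≤ fiberNorm (A.totalFlow t v) := by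
  rcases (fiberNorm_nonneg v).eq_or_lt with h0 | h0
  · rw [← h0, mul_zero]
    exact fiberNorm_nonneg _
  · have := h (fiberSMul (fiberNorm v)⁻¹ v) ⟨hv, Submodule.smul_mem _ _ hvW, fiberNorm_normalize h0⟩
      rfl
    rw [A.totalFlow_smul, fiberNorm_smul, abs_of_pos (inv_pos.2 h0), inv_mul_eq_div,
      le_div_iff₀ h0] at this
    exact this

/-- The adapted form increases strictly over a sufficiently large time `S` on `Λ`, after rescaling
the cocycle by the separating rate `δ`. -/
theorem LinearCocycle.IsDominatedSplittingOn.exists_form_lt [ParacompactSpace B]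
    (hΛ : IsCompact Λ) (hmap : ∀ t, ∀ x ∈ Λ, ψ t x ∈ Λ) (h : A.IsDominatedSplittingOn Λ Fm Fp) :
    ∃ (J : ∀ x : B, QuadraticForm ℝ (E x)) (δ : C(B, ℝ)) (S : ℝ≥0), 0 < S ∧
      Continuous (fiberForm (F := F) J) ∧
      (∀ v ∈ unitVectors F Λ Fm, fiberForm J v < 0) ∧
      (∀ v ∈ unitVectors F Λ Fp, 0 < fiberForm J v) ∧
      ∀ v : TotalSpace F E, v.1 ∈ Λ → 0 < fiberNorm v →
        fiberForm J v < Real.exp (-2 * orbitIntegral ψ δ v.1 S) *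
          fiberForm J (A.totalFlow S v) := by
  have hKm := isCompact_unitVectors hΛ h.left_continuous
  have hKp := isCompact_unitVectors hΛ h.right_continuous
  have := t2Space_totalSpace (F := F) (E := E)
  obtain ⟨J, hJ, hJm, hJp⟩ := exists_adapted_form hΛ hKm hKp h.isCompl
  obtain ⟨C, hC, hCb⟩ := exists_abs_le_mul_sq hΛ hJ (fiberForm_smul J)
  have hunit : ∀ W : ∀ x : B, Submodule ℝ (E x),
      {v : TotalSpace F E | v.2 ∈ W v.1} ∩ sphereOver F E Λ = unitVectors F Λ W := fun W =>
    Set.ext fun v => ⟨fun hv => ⟨hv.2.1, hv.1, hv.2.2⟩, fun hv => ⟨hv.2.1, hv.1, hv.2.2⟩⟩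
  have hpos : ∀ (g : TotalSpace F E → ℝ), (∀ c v, g (fiberSMul c v) = c ^ 2 * g v) →
      ∀ W : ∀ x : B, Submodule ℝ (E x), (∀ v ∈ unitVectors F Λ W, 0 < g v) →
      ∀ v ∈ {v : TotalSpace F E | v.2 ∈ W v.1}, v.1 ∈ Λ → 0 < fiberNorm v → 0 < g v := by
    intro g hom W hg v hv hvΛ h0
    have := hg (fiberSMul (fiberNorm v)⁻¹ v)
      ⟨hvΛ, Submodule.smul_mem _ _ hv, fiberNorm_normalize h0⟩
    rw [hom] at this
    exact pos_of_mul_pos_right this (by positivity)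
  obtain ⟨α₁, hα₁, h₁⟩ := exists_mul_sq_le hΛ (g := fun v => -fiberForm J v) hJ.neg
    (fun c v => by rw [fiberForm_smul]; ring) (S := {v | v.2 ∈ Fm v.1})
    (by rw [hunit]; exact hKm.isClosed) (fun v hv c _ => Submodule.smul_mem _ _ hv)
    (hpos _ (fun c v => by rw [fiberForm_smul]; ring) Fm fun v hv => neg_pos.2 (hJm v hv))
  obtain ⟨α₂, hα₂, h₂⟩ := exists_mul_sq_le hΛ (g := fun v => fiberForm J v) hJ
    (fiberForm_smul J) (S := {v | v.2 ∈ Fp v.1})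
    (by rw [hunit]; exact hKp.isClosed) (fun v hv c _ => Submodule.smul_mem _ _ hv)
    (hpos _ (fiberForm_smul J) Fp hJp)
  obtain ⟨α, hα, hαm, hαp⟩ : ∃ α, 0 < α ∧ α ≤ α₁ ∧ α ≤ α₂ :=
    ⟨min α₁ α₂, lt_min hα₁ hα₂, min_le_left _ _, min_le_right _ _⟩
  obtain ⟨δ, D, κ, hD, hκ, hrate⟩ := h.exists_orbitIntegral hΛ hmap
  -- the expansion factor `(D exp (-κ S))⁻¹` is as large as desired
  obtain ⟨S, hS, hS1, hS2⟩ : ∃ S : ℝ≥0, 0 < S ∧ D * Real.exp (-κ * S) ≤ 1 ∧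
      24 * C * (D * Real.exp (-κ * S)) ≤ α := by
    have h1 : Filter.Tendsto (fun t : ℝ≥0 => D * Real.exp (-κ * t)) Filter.atTop (𝓝 (D * 0)) := by
      refine Filter.Tendsto.const_mul D (Real.tendsto_exp_atBot.comp ?_)
      exact (NNReal.tendsto_coe_atTop.2 Filter.tendsto_id).const_mul_atTop_of_neg (by linarith)
    have h2 := h1.const_mul (24 * C)
    rw [mul_zero] at h1 h2
    rw [mul_zero] at h2
    obtain ⟨S, ⟨h3, h4⟩, h5⟩ := (((h1.eventually (gt_mem_nhds one_pos)).and
      (h2.eventually (gt_mem_nhds hα))).and (Filter.eventually_gt_atTop 0)).exists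
    exact ⟨S, h5, h3.le, h4.le⟩
  refine ⟨J, δ, S, hS, hJ, hJm, hJp, ?_⟩
  rintro ⟨x, u⟩ hx hu
  obtain ⟨ε, hε⟩ : ∃ ε, ε = D * Real.exp (-κ * S) := ⟨_, rfl⟩
  have hε0 : 0 < ε := by rw [hε]; positivity
  rw [← hε] at hS1 hS2
  obtain ⟨d, hd⟩ : ∃ d, d = orbitIntegral ψ δ x S := ⟨_, rfl⟩
  have hu' : u ∈ Fm x ⊔ Fp x := by rw [(h.isCompl x hx).sup_eq_top]; trivial
  obtain ⟨m, hm, l, hl, rfl⟩ := Submodule.mem_sup.1 hu'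
  have gm : ‖A.toFun S x m‖ ≤ ε * Real.exp d * ‖m‖ :=
    fiberNorm_le_of_unitVectors (A := A) (v := ⟨x, m⟩) (fun v hv hvx => by
      have := (hrate S).1 v hv
      rw [hvx] at this
      rwa [hε, hd]) hx hm
  have gl : (Real.exp d / ε) * ‖l‖ ≤ ‖A.toFun S x l‖ :=
    le_fiberNorm_of_unitVectors (A := A) (v := ⟨x, l⟩) (fun v hv hvx => by
      have := (hrate S).2 v hv
      rw [hvx, ← hε, ← hd] at this
      rw [div_le_iff₀ hε0]
      linarith) hx hl
  have hne : l ≠ 0 ∨ m ≠ 0 := by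
    by_contra hcon
    simp only [ne_eq, not_or, not_not] at hcon
    rw [fiberNorm_pos_iff] at hu
    exact hu (by simp [hcon.1, hcon.2])
  have hexp : 0 < Real.exp (-d) := Real.exp_pos _
  have hexp' : Real.exp (-d) * Real.exp d = 1 := by rw [← Real.exp_add]; simp
  have key := form_add_lt_form_add (Q := J x) (Q' := J (ψ S x)) (C := C) (α := α) (R := ε⁻¹)
    (v := l) (w := m) (v' := Real.exp (-d) • A.toFun S x l) (w' := Real.exp (-d) • A.toFun S x m)
    hα hC ((one_le_inv₀ hε0).2 hS1) (by
      rw [← div_eq_mul_inv, le_div_iff₀ hε0]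
      exact hS2) (fun u => hCb ⟨x, u⟩ hx) (fun u => hCb ⟨ψ S x, u⟩ (hmap S x hx))
    (by
      have h3 : α₁ * ‖m‖ ^ 2 ≤ -J x m := h₁ ⟨x, m⟩ hm hx
      have := mul_le_mul_of_nonneg_right hαm (sq_nonneg ‖m‖)
      linarith)
    (by
      have hmem : Real.exp (-d) • A.toFun S x l ∈ Fp (ψ S x) :=
        Submodule.smul_mem _ _ (h.totalFlow_mem_right S (v := ⟨x, l⟩) hx hl)
      have h3 : α₂ * ‖Real.exp (-d) • A.toFun S x l‖ ^ 2 ≤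
          J (ψ S x) (Real.exp (-d) • A.toFun S x l) :=
        h₂ ⟨ψ S x, Real.exp (-d) • A.toFun S x l⟩ hmem (hmap S x hx)
      exact (mul_le_mul_of_nonneg_right hαp (sq_nonneg _)).trans h3)
    (by
      rw [norm_smul, Real.norm_of_nonneg hexp.le]
      have := mul_le_mul_of_nonneg_left gl hexp.le
      calc ε⁻¹ * ‖l‖ = (Real.exp (-d) * Real.exp d) * (ε⁻¹ * ‖l‖) := by rw [hexp', one_mul]
        _ = Real.exp (-d) * (Real.exp d / ε * ‖l‖) := by ring
        _ ≤ _ := this)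
    (by
      rw [norm_smul, Real.norm_of_nonneg hexp.le]
      have := mul_le_mul_of_nonneg_left gm hexp.le
      rw [inv_mul_le_iff₀ hε0]
      calc Real.exp (-d) * ‖A.toFun S x m‖ ≤ Real.exp (-d) * (ε * Real.exp d * ‖m‖) := this
        _ = (Real.exp (-d) * Real.exp d) * (ε * ‖m‖) := by ring
        _ = ε * ‖m‖ := by rw [hexp', one_mul])
    (by
      rcases hne with hne | hne
      · exact Or.inl (smul_ne_zero hexp.ne' ((A.toFun S x).map_ne_zero_iff.2 hne))
      · exact Or.inr hne)
  rw [← smul_add, ← (A.toFun S x).map_add, QuadraticMap.map_smul, add_comm l m,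
    smul_eq_mul, ← Real.exp_add] at key
  change J x (m + l) < Real.exp (-2 * orbitIntegral ψ δ x S) * J (ψ S x) (A.toFun S x (m + l))
  rw [← hd]
  convert key using 3
  ring

end Expansion

/-- The form `J` pulled back by the time-`s` map of the cocycle, rescaled by the rate `δ`. -/
noncomputable def pulledForm (A : LinearCocycle I F E ψ) (δ : B → ℝ)
    (J : ∀ x : B, QuadraticForm ℝ (E x)) (s : ℝ) (v : TotalSpace F E) : ℝ :=
  Real.exp (-2 * orbitIntegral ψ δ v.1 s) * fiberForm J (A.totalFlow s.toNNReal v)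

variable {J : ∀ x : B, QuadraticForm ℝ (E x)} {δ : C(B, ℝ)}

theorem continuous_orbitIntegral :
    Continuous fun p : B × ℝ => orbitIntegral ψ δ p.1 p.2 := by
  refine intervalIntegral.continuous_parametric_intervalIntegral_of_continuous
    (f := fun (p : B × ℝ) s => δ (ψ s.toNNReal p.1)) ?_ continuous_snd
  exact δ.continuous.comp (ψ.continuous (continuous_real_toNNReal.comp continuous_snd)
    (continuous_fst.comp continuous_fst))

theorem continuous_pulledForm (hJ : Continuous (fiberForm (F := F) J)) :
    Continuous fun p : TotalSpace F E × ℝ => pulledForm A δ J p.2 p.1 := by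
  refine Continuous.mul (Real.continuous_exp.comp (continuous_const.mul ?_)) (hJ.comp ?_)
  · exact continuous_orbitIntegral.comp
      (((FiberBundle.continuous_proj F E).comp continuous_fst).prodMk continuous_snd)
  · exact A.totalFlow.continuous (continuous_real_toNNReal.comp continuous_snd) continuous_fst

theorem continuous_pulledForm_left (hJ : Continuous (fiberForm (F := F) J)) (v : TotalSpace F E) :
    Continuous fun s => pulledForm A δ J s v :=
  (continuous_pulledForm hJ).comp (by fun_prop : Continuous fun s : ℝ => (v, s))

theorem pulledForm_smul (s c : ℝ) (v : TotalSpace F E) :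
    pulledForm A δ J s (fiberSMul c v) = c ^ 2 * pulledForm A δ J s v := by
  rw [pulledForm, A.totalFlow_smul, fiberForm_smul, mul_left_comm]
  rfl

theorem orbitIntegral_flow (x : B) (t : ℝ≥0) {s : ℝ} (hs : 0 ≤ s) :
    orbitIntegral ψ δ (ψ t x) s = orbitIntegral ψ δ x (s + t) - orbitIntegral ψ δ x t := by
  have hc : Continuous fun r : ℝ => δ (ψ r.toNNReal x) :=
    δ.continuous.comp (ψ.continuous continuous_real_toNNReal continuous_const)
  have h1 : orbitIntegral ψ δ (ψ t x) s = ∫ r in (t : ℝ)..(s + t), δ (ψ r.toNNReal x) := by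
    have h2 := intervalIntegral.integral_comp_add_right (fun r : ℝ => δ (ψ r.toNNReal x)) (t : ℝ)
      (a := 0) (b := s)
    rw [zero_add] at h2
    rw [← h2, orbitIntegral]
    refine intervalIntegral.integral_congr fun r hr => ?_
    rw [uIcc_of_le hs] at hr
    rw [← ψ.map_add, Real.toNNReal_add hr.1 t.coe_nonneg, Real.toNNReal_coe]
  rw [h1, orbitIntegral, orbitIntegral, intervalIntegral.integral_interval_sub_left
    (hc.intervalIntegrable _ _) (hc.intervalIntegrable _ _)]

/-- The pulled back forms follow the cocycle up to a positive factor. -/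
theorem pulledForm_totalFlow (v : TotalSpace F E) (t : ℝ≥0) {s : ℝ} (hs : 0 ≤ s) :
    pulledForm A δ J s (A.totalFlow t v) =
      Real.exp (2 * orbitIntegral ψ δ v.1 t) * pulledForm A δ J (s + t) v := by
  rw [pulledForm, pulledForm, A.totalFlow_proj, orbitIntegral_flow v.1 t hs, ← mul_assoc,
    ← Real.exp_add, ← A.totalFlow.map_add, Real.toNNReal_add hs t.coe_nonneg, Real.toNNReal_coe]
  congr 2
  ring

/-- The average over times between `a` and `b` of the rescaled pull-backs of `J`. -/
noncomputable def averagedForm (A : LinearCocycle I F E ψ) (δ : C(B, ℝ))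
    {J : ∀ x : B, QuadraticForm ℝ (E x)} (hJ : Continuous (fiberForm (F := F) J)) (a b : ℝ)
    (x : B) : QuadraticForm ℝ (E x) :=
  have hint : ∀ v : E x, IntervalIntegrable (fun s => pulledForm A δ J s ⟨x, v⟩)
      MeasureTheory.volume a b := fun v =>
    (continuous_pulledForm_left hJ ⟨x, v⟩).intervalIntegrable _ _
  have hpolar : ∀ v w : E x,
      QuadraticMap.polar (fun v : E x => ∫ s in a..b, pulledForm A δ J s ⟨x, v⟩) v w =
        ∫ s in a..b, Real.exp (-2 * orbitIntegral ψ δ x s) * QuadraticMap.polar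
          (J (ψ s.toNNReal x)) (A.toFun s.toNNReal x v) (A.toFun s.toNNReal x w) := by
    intro v w
    rw [QuadraticMap.polar, ← intervalIntegral.integral_sub (hint _) (hint _),
      ← intervalIntegral.integral_sub ((hint _).sub (hint _)) (hint _)]
    refine intervalIntegral.integral_congr fun s _ => ?_
    simp only [pulledForm, fiberForm, A.totalFlow_mk, QuadraticMap.polar, map_add, mul_sub]
    rfl
  have hint' : ∀ v w : E x, IntervalIntegrable (fun s => Real.exp (-2 * orbitIntegral ψ δ x s) *
        QuadraticMap.polar (J (ψ s.toNNReal x)) (A.toFun s.toNNReal x v) (A.toFun s.toNNReal x w))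
      MeasureTheory.volume a b := by
    intro v w
    refine (((hint (v + w)).sub (hint v)).sub (hint w)).congr fun s _ => ?_
    simp only [pulledForm, fiberForm, A.totalFlow_mk, QuadraticMap.polar, map_add, mul_sub]
    rfl
  QuadraticMap.ofPolar (fun v => ∫ s in a..b, pulledForm A δ J s ⟨x, v⟩)
    (fun c v => by
      rw [smul_eq_mul, ← sq, ← intervalIntegral.integral_const_mul]
      exact intervalIntegral.integral_congr fun s _ => pulledForm_smul s c ⟨x, v⟩)
    (fun v v' w => by
      rw [hpolar, hpolar, hpolar, ← intervalIntegral.integral_add (hint' _ _) (hint' _ _)]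
      refine intervalIntegral.integral_congr fun s _ => ?_
      simp only [map_add, QuadraticMap.polar_add_left]
      ring)
    (fun c v w => by
      rw [hpolar, hpolar, smul_eq_mul, ← intervalIntegral.integral_const_mul]
      refine intervalIntegral.integral_congr fun s _ => ?_
      simp only [map_smul, QuadraticMap.polar_smul_left, smul_eq_mul]
      ring)

theorem averagedForm_apply (hJ : Continuous (fiberForm (F := F) J)) (a b : ℝ) (x : B) (v : E x) :
    averagedForm A δ hJ a b x v = ∫ s in a..b, pulledForm A δ J s ⟨x, v⟩ := rfl

theorem continuous_averagedForm (hJ : Continuous (fiberForm (F := F) J)) (a b : ℝ) :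
    Continuous (fiberForm (F := F) (averagedForm A δ hJ a b)) :=
  intervalIntegral.continuous_parametric_intervalIntegral_of_continuous'
    (f := fun (v : TotalSpace F E) s => pulledForm A δ J s v) (continuous_pulledForm hJ) a b

end AveragedForm

/-! ### Signature and strict growth of the averaged form -/

section Signature

theorem HasSignature.of_mul_eq {V : Type*} [AddCommGroup V] [Module ℝ V]
    {Q Q' : QuadraticForm ℝ V} {p q : ℕ} (h : HasSignature Q p q) {c : ℝ} (hc : 0 < c)
    (hQ : ∀ v, Q v = c * Q' v) : HasSignature Q' p q := by
  obtain ⟨⟨P, hP, hP'⟩, N, hN, hN'⟩ := h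
  refine ⟨⟨P, hP, fun v hv h0 => ?_⟩, N, hN, fun v hv h0 => ?_⟩
  · have := hP' v hv h0
    rw [hQ] at this
    exact pos_of_mul_pos_right this hc.le
  · have := hN' v hv h0
    rw [hQ] at this
    exact neg_of_mul_neg_right this hc.le

section Bundle

variable {B : Type*} [TopologicalSpace B]
  {F : Type*} [NormedAddCommGroup F] [NormedSpace ℝ F]
  {E : B → Type*} [TopologicalSpace (TotalSpace F E)] [∀ x, NormedAddCommGroup (E x)]
  [∀ x, InnerProductSpace ℝ (E x)] [FiberBundle F E] [VectorBundle ℝ F E] [FiniteDimensional ℝ F]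

/-- Positive definiteness on a subspace of one fibre propagates to the subspaces of the nearby
fibres that correspond to it in local coordinates. -/
theorem eventually_exists_posDef {J : ∀ x : B, QuadraticForm ℝ (E x)}
    (hJ : Continuous (fiberForm (F := F) J)) {x₀ : B} {P : Submodule ℝ (E x₀)}
    (hP : ∀ v ∈ P, v ≠ 0 → 0 < J x₀ v) :
    ∀ᶠ x in 𝓝 x₀, ∃ P' : Submodule ℝ (E x), Module.finrank ℝ P' = Module.finrank ℝ P ∧
      ∀ v ∈ P', v ≠ 0 → 0 < J x v := by
  obtain ⟨N, hN, hxN, L, hL, -⟩ := exists_local_coordinates F E x₀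
  let P₀ : Submodule ℝ F := P.map ((L x₀).symm.toLinearEquiv : E x₀ →ₗ[ℝ] F)
  have hcomp : IsCompact (Metric.sphere (0 : F) 1 ∩ P₀) :=
    (isCompact_sphere 0 1).inter_right P₀.closed_of_finiteDimensional
  have hev : ∀ᶠ x in 𝓝 x₀, ∀ y ∈ Metric.sphere (0 : F) 1 ∩ P₀, 0 < J x (L x y) := by
    refine hcomp.eventually_forall_of_forall_eventually (P := fun x y => 0 < J x (L x y)) ?_
    rintro y ⟨hy, v, hv, rfl⟩
    have hc : ContinuousAt (fun z : B × F => fiberForm J (⟨z.1, L z.1 z.2⟩ : TotalSpace F E))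
        (x₀, (L x₀).symm v) :=
      (hJ.comp_continuousOn hL).continuousAt ((hN.prod isOpen_univ).mem_nhds ⟨hxN, trivial⟩)
    refine hc.eventually (lt_mem_nhds ?_)
    have hv0 : v ≠ 0 := by
      rintro rfl
      simp at hy
    simpa [fiberForm] using hP v hv hv0
  filter_upwards [hev] with x hx
  refine ⟨P₀.map ((L x).toLinearEquiv : F →ₗ[ℝ] E x), ?_, ?_⟩
  · rw [LinearEquiv.finrank_map_eq, LinearEquiv.finrank_map_eq]
  · rintro _ ⟨y, hy, rfl⟩ h0
    have hy0 : y ≠ 0 := by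
      rintro rfl
      simp at h0
    have hn : 0 < ‖y‖ := norm_pos_iff.2 hy0
    have := hx (‖y‖⁻¹ • y) ⟨by simp [norm_smul, hn.ne'], P₀.smul_mem _ hy⟩
    rw [map_smul, QuadraticMap.map_smul, smul_eq_mul] at this
    exact pos_of_mul_pos_right this (by positivity)

theorem eventually_hasSignature {J : ∀ x : B, QuadraticForm ℝ (E x)}
    (hJ : Continuous (fiberForm (F := F) J)) {x₀ : B} {p q : ℕ} (h : HasSignature (J x₀) p q) :
    ∀ᶠ x in 𝓝 x₀, HasSignature (J x) p q := by
  obtain ⟨⟨P, hP, hP'⟩, N, hN, hN'⟩ := h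
  have hJn : Continuous (fiberForm (F := F) fun x => -J x) := hJ.neg
  filter_upwards [eventually_exists_posDef hJ hP',
    eventually_exists_posDef (P := N) hJn fun v hv h0 => neg_pos.2 (hN' v hv h0)] with x h1 h2
  obtain ⟨P₁, h3, h4⟩ := h1
  obtain ⟨N₁, h5, h6⟩ := h2
  exact ⟨⟨P₁, h3.trans hP, h4⟩, N₁, h5.trans hN, fun v hv h0 => neg_pos.1 (h6 v hv h0)⟩

end Bundle

variable {EM : Type*} [NormedAddCommGroup EM] [NormedSpace ℝ EM]
  {H : Type*} [TopologicalSpace H] {I : ModelWithCorners ℝ EM H}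
  {B : Type*} [TopologicalSpace B] [ChartedSpace H B]
  {F : Type*} [NormedAddCommGroup F] [NormedSpace ℝ F]
  {E : B → Type*} [TopologicalSpace (TotalSpace F E)] [∀ x, NormedAddCommGroup (E x)]
  [∀ x, InnerProductSpace ℝ (E x)] [FiberBundle F E]
  {ψ : Flow ℝ≥0 B} {A : LinearCocycle I F E ψ} {Λ : Set B}
  {Fm Fp : ∀ x : B, Submodule ℝ (E x)}
  {J : ∀ x : B, QuadraticForm ℝ (E x)} {δ : C(B, ℝ)}

/-- Along an orbit of the cocycle, averaging over a time window amounts to shifting the window. -/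
theorem averagedForm_totalFlow (hJ : Continuous (fiberForm (F := F) J)) {a b : ℝ} (ha : 0 ≤ a)
    (hab : a ≤ b) (t : ℝ≥0) (v : TotalSpace F E) :
    fiberForm (averagedForm A δ hJ a b) (A.totalFlow t v) =
      Real.exp (2 * orbitIntegral ψ δ v.1 t) * ∫ s in (a + t)..(b + t), pulledForm A δ J s v := by
  have h1 : fiberForm (averagedForm A δ hJ a b) (A.totalFlow t v) =
      ∫ s in a..b, Real.exp (2 * orbitIntegral ψ δ v.1 t) * pulledForm A δ J (s + t) v := by
    refine intervalIntegral.integral_congr fun s hs => ?_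
    rw [uIcc_of_le hab] at hs
    exact pulledForm_totalFlow v t (ha.trans hs.1)
  rw [h1, intervalIntegral.integral_const_mul,
    intervalIntegral.integral_comp_add_right (fun s => pulledForm A δ J s v)]

/-- If `J` increases over time `S` at the points of an orbit after time `τ`, then its pull-backs
increase along the orbit from each time `s ≥ τ` to `s + S`. -/
theorem pulledForm_lt_pulledForm_add {v : TotalSpace F E} {S τ : ℝ≥0}
    (h : ∀ t, τ ≤ t → fiberForm J (A.totalFlow t v) < pulledForm A δ J S (A.totalFlow t v))
    {s : ℝ} (hs : τ ≤ s) : pulledForm A δ J s v < pulledForm A δ J (s + S) v := by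
  have hs0 : 0 ≤ s := τ.coe_nonneg.trans hs
  have h1 := h s.toNNReal (NNReal.le_toNNReal_of_coe_le hs)
  rw [pulledForm_totalFlow v _ S.coe_nonneg, Real.coe_toNNReal s hs0, add_comm (S : ℝ)] at h1
  have h2 : Real.exp (-2 * orbitIntegral ψ δ v.1 s) *
      Real.exp (2 * orbitIntegral ψ δ v.1 s) = 1 := by
    rw [← Real.exp_add, neg_mul, neg_add_cancel, Real.exp_zero]
  calc pulledForm A δ J s v
      < Real.exp (-2 * orbitIntegral ψ δ v.1 s) *
          (Real.exp (2 * orbitIntegral ψ δ v.1 s) * pulledForm A δ J (s + S) v) :=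
        mul_lt_mul_of_pos_left h1 (Real.exp_pos _)
    _ = _ := by rw [← mul_assoc, h2, one_mul]

/-- The average over `[τ, τ + S]` increases strictly along the cocycle: the derivative of
`∫ s in t..(t + S), h s` is `h (t + S) - h t`. -/
theorem averagedForm_lt (hJ : Continuous (fiberForm (F := F) J)) {v : TotalSpace F E} {S τ : ℝ≥0}
    (h : ∀ t, τ ≤ t → fiberForm J (A.totalFlow t v) < pulledForm A δ J S (A.totalFlow t v))
    {t : ℝ≥0} (ht : 0 < t) :
    Real.exp (2 * orbitIntegral ψ δ v.1 t) * fiberForm (averagedForm A δ hJ τ (τ + S)) v <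
      fiberForm (averagedForm A δ hJ τ (τ + S)) (A.totalFlow t v) := by
  rw [averagedForm_totalFlow hJ τ.coe_nonneg (le_add_of_nonneg_right S.coe_nonneg)]
  refine mul_lt_mul_of_pos_left ?_ (Real.exp_pos _)
  change ∫ s in (τ : ℝ)..(τ + S), pulledForm A δ J s v < _
  have hc := continuous_pulledForm_left (A := A) (δ := δ) hJ v
  have hi : ∀ a b : ℝ, IntervalIntegrable (fun s => pulledForm A δ J s v)
    MeasureTheory.volume a b := fun a b => hc.intervalIntegrable _ _
  have h1 : ∫ s in (τ : ℝ)..(τ + t), pulledForm A δ J s v <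
      ∫ s in (τ : ℝ)..(τ + t), pulledForm A δ J (s + S) v := by
    refine intervalIntegral.integral_lt_integral_of_continuousOn_of_le_of_exists_lt
      (by simpa using ht) hc.continuousOn
      (hc.comp (continuous_add_const (S : ℝ))).continuousOn
      (fun s hs => (pulledForm_lt_pulledForm_add h hs.1.le).le)
      ⟨τ, ⟨le_rfl, by simp⟩, pulledForm_lt_pulledForm_add h le_rfl⟩
  rw [intervalIntegral.integral_comp_add_right (fun s => pulledForm A δ J s v)] at h1
  have h2 := intervalIntegral.integral_add_adjacent_intervals (hi τ (τ + t))
    (hi (τ + t) (τ + S + t))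
  have h3 := intervalIntegral.integral_add_adjacent_intervals (hi τ (τ + S))
    (hi (τ + S) (τ + S + t))
  rw [add_right_comm (τ : ℝ) t S] at h1
  linarith

variable [VectorBundle ℝ F E] [FiniteDimensional ℝ F] [IsContinuousRiemannianBundle F E]
  [T2Space B] [LocallyCompactSpace B]

theorem pulledForm_pos_of_unitVectors {W : ∀ x : B, Submodule ℝ (E x)}
    (hW : ∀ t, ∀ v : TotalSpace F E, v.1 ∈ Λ → v.2 ∈ W v.1 →
      (A.totalFlow t v).1 ∈ Λ ∧ (A.totalFlow t v).2 ∈ W (A.totalFlow t v).1)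
    (hJ : ∀ v ∈ unitVectors F Λ W, 0 < fiberForm J v) (s : ℝ) {x : B} (hx : x ∈ Λ) {v : E x}
    (hv : v ∈ W x) (h0 : v ≠ 0) : 0 < pulledForm A δ J s ⟨x, v⟩ := by
  refine mul_pos (Real.exp_pos _) ?_
  obtain ⟨h1, h2⟩ := hW s.toNNReal ⟨x, v⟩ hx hv
  have h3 : 0 < fiberNorm (A.totalFlow s.toNNReal ⟨x, v⟩) :=
    A.fiberNorm_totalFlow_pos.2 (fiberNorm_pos_iff.2 h0)
  have := hJ (fiberSMul (fiberNorm _)⁻¹ (A.totalFlow s.toNNReal ⟨x, v⟩))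
    ⟨h1, Submodule.smul_mem _ _ h2, fiberNorm_normalize h3⟩
  rw [fiberForm_smul] at this
  exact pos_of_mul_pos_right this (by positivity)

/-- A dominated splitting over an absorbing set gives a continuous field `J` such that the averages
of its rescaled pull-backs over a suitable time window have constant signature and increase strictly
along the cocycle. -/
theorem LinearCocycle.IsDominatedSplittingOn.exists_averagedForm [ParacompactSpace B]
    (h : A.IsDominatedSplittingOn Λ Fm Fp) (hΛ : IsCompact Λ) (hmap : ∀ t, ∀ x ∈ Λ, ψ t x ∈ Λ)
    (habs : ∀ V : Set B, IsOpen V → Λ ⊆ V → ∃ τ : ℝ≥0, ∀ t, τ ≤ t → ∀ x, ψ t x ∈ V) {p q : ℕ}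
    (hdim : ∀ x ∈ Λ, Module.finrank ℝ (Fm x) = q ∧ Module.finrank ℝ (Fp x) = p) :
    ∃ (J : ∀ x : B, QuadraticForm ℝ (E x)) (hJ : Continuous (fiberForm (F := F) J)) (δ : C(B, ℝ))
      (a b : ℝ), 0 ≤ a ∧ a ≤ b ∧ (∀ x, HasSignature (averagedForm A δ hJ a b x) p q) ∧
      A.IsStrictlySeparated (averagedForm A δ hJ a b) := by
  obtain ⟨J, δ, S, hS, hJ, hJm, hJp, hlt⟩ := h.exists_form_lt hΛ hmap
  have hsig : ∀ x ∈ Λ, HasSignature (averagedForm A δ hJ 0 S x) p q := by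
    intro x hx
    refine ⟨⟨Fp x, (hdim x hx).2, fun v hv h0 => ?_⟩, Fm x, (hdim x hx).1, fun v hv h0 => ?_⟩
    · refine intervalIntegral.intervalIntegral_pos_of_pos_on
        ((continuous_pulledForm_left hJ _).intervalIntegrable _ _) (fun s _ => ?_)
        (by simpa using hS)
      exact pulledForm_pos_of_unitVectors
        (fun t v h1 h2 => ⟨hmap t _ h1, h.totalFlow_mem_right t h1 h2⟩) hJp s hx hv h0
    · rw [averagedForm_apply, ← neg_pos, ← intervalIntegral.integral_neg]
      refine intervalIntegral.intervalIntegral_pos_of_pos_on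
        ((continuous_pulledForm_left hJ _).neg.intervalIntegrable _ _) (fun s _ => ?_)
        (by simpa using hS)
      have := pulledForm_pos_of_unitVectors (A := A) (δ := δ) (J := fun x => -J x)
        (fun t v h1 h2 => ⟨hmap t _ h1, h.totalFlow_mem_left t h1 h2⟩)
        (fun v hv => neg_pos.2 (hJm v hv)) s hx hv h0
      refine this.trans_eq ?_
      simp [pulledForm, fiberForm]
  have hcont : Continuous fun v : TotalSpace F E => pulledForm A δ J S v - fiberForm J v :=
    ((continuous_pulledForm hJ).comp (by fun_prop : Continuous fun v : TotalSpace F E =>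
      (v, (S : ℝ)))).sub hJ
  have hev : ∀ x ∈ Λ, ∀ᶠ y in 𝓝 x, HasSignature (averagedForm A δ hJ 0 S y) p q ∧
      ∀ v : E y, ‖v‖ = 1 → 0 < pulledForm A δ J S ⟨y, v⟩ - fiberForm (F := F) J ⟨y, v⟩ := by
    intro x hx
    refine (eventually_hasSignature (continuous_averagedForm hJ 0 S) (hsig x hx)).and
      (eventually_forall_pos hcont fun v hv => ?_)
    have := hlt ⟨x, v⟩ hx (by change 0 < ‖v‖; rw [hv]; exact one_pos)
    rw [sub_pos, pulledForm, Real.toNNReal_coe]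
    exact this
  obtain ⟨τ, hτ⟩ := habs _ isOpen_interior fun x hx => mem_interior_iff_mem_nhds.2 (hev x hx)
  have hV := fun t ht x => interior_subset (hτ t ht x)
  refine ⟨J, hJ, δ, τ, τ + S, τ.coe_nonneg, le_add_of_nonneg_right S.coe_nonneg, fun x => ?_, ?_⟩
  · refine ((hV τ le_rfl x).1.comp_equiv (A.toFun τ x).toLinearEquiv).of_mul_eq
      (Real.exp_pos (2 * orbitIntegral ψ δ x τ)) fun v => ?_
    have h1 := averagedForm_totalFlow (A := A) (δ := δ) hJ le_rfl S.coe_nonneg τ ⟨x, v⟩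
    rw [zero_add, add_comm] at h1
    exact h1
  · rw [A.isStrictlySeparated_iff]
    intro t ht v hv hv0
    refine lt_of_le_of_lt (mul_nonneg (Real.exp_pos (2 * orbitIntegral ψ δ v.1 t)).le hv0)
      (averagedForm_lt hJ (fun s hs => ?_) ht)
    have h1 : 0 < fiberNorm (A.totalFlow s v) := A.fiberNorm_totalFlow_pos.2 hv
    have h2 := (hV s hs v.1).2 ((fiberNorm (A.totalFlow s v))⁻¹ • (A.totalFlow s v).2)
      (fiberNorm_normalize h1)
    have h3 : 0 < pulledForm A δ J S (fiberSMul (fiberNorm (A.totalFlow s v))⁻¹ (A.totalFlow s v)) -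
      fiberForm J (fiberSMul (fiberNorm (A.totalFlow s v))⁻¹ (A.totalFlow s v)) := h2
    rw [pulledForm_smul, fiberForm_smul, ← mul_sub] at h3
    exact sub_pos.1 (pos_of_mul_pos_right h3 (by positivity))

end Signature

/-! ### Differentiability along the flow -/

section Differentiability

theorem contDiff_integral {h : ℝ → ℝ} (hh : Continuous h) :
    ContDiff ℝ 1 fun u => ∫ s in (0 : ℝ)..u, h s := by
  refine contDiff_one_iff_deriv.2 ⟨fun u => ?_, ?_⟩
  · exact (hh.integral_hasStrictDerivAt 0 u).hasDerivAt.differentiableAt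
  · simpa only [funext (hh.deriv_integral h 0)] using hh

theorem contDiff_integral_add {h : ℝ → ℝ} (hh : Continuous h) (a b : ℝ) :
    ContDiff ℝ 1 fun t => ∫ s in (a + t)..(b + t), h s := by
  have h2 : (fun t => ∫ s in (a + t)..(b + t), h s) =
      fun t => (∫ s in (0 : ℝ)..(b + t), h s) - ∫ s in (0 : ℝ)..(a + t), h s := by
    funext t
    rw [intervalIntegral.integral_interval_sub_left (hh.intervalIntegrable _ _)
      (hh.intervalIntegrable _ _)]
  rw [h2]
  exact ((contDiff_integral hh).comp (contDiff_const.add contDiff_id)).sub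
    ((contDiff_integral hh).comp (contDiff_const.add contDiff_id))

/-- A family of quadratic forms that is `C¹` at every fixed vector is `C¹` along every `C¹`
curve. -/
theorem contDiffOn_quadraticForm {V : Type*} [NormedAddCommGroup V] [NormedSpace ℝ V]
    [FiniteDimensional ℝ V] {Q : ℝ → QuadraticForm ℝ V} (hQ : ∀ v, ContDiff ℝ 1 fun t => Q t v)
    {z : ℝ → V} {s : Set ℝ} (hz : ContDiffOn ℝ 1 z s) : ContDiffOn ℝ 1 (fun t => Q t (z t)) s := by
  let b := Module.finBasis ℝ V
  have hcoord : ∀ i, ContDiffOn ℝ 1 (fun t => b.repr (z t) i) s := fun i =>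
    (b.coord i).toContinuousLinearMap.contDiff.comp_contDiffOn hz
  have hpolar : ∀ v w, ContDiff ℝ 1 fun t => QuadraticMap.polar (Q t) v w := fun v w =>
    ((hQ (v + w)).sub (hQ v)).sub (hQ w)
  have hsum : ∀ t, Q t (z t) = 2⁻¹ * ∑ i, ∑ j,
      b.repr (z t) i * (b.repr (z t) j * QuadraticMap.polar (Q t) (b i) (b j)) := by
    intro t
    have h1 := LinearMap.sum_repr_mul_repr_mul b b (B := QuadraticMap.polarBilin (Q t)) (z t) (z t)
    rw [QuadraticMap.polarBilin_apply_apply, QuadraticMap.polar_self, nsmul_eq_mul,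
      Nat.cast_ofNat] at h1
    rw [eq_inv_mul_iff_mul_eq₀ two_ne_zero, ← h1, Finsupp.sum_fintype _ _ (by simp)]
    refine Finset.sum_congr rfl fun i _ => ?_
    rw [Finsupp.sum_fintype _ _ (by simp)]
    rfl
  simp only [hsum]
  exact contDiffOn_const.mul (ContDiffOn.sum fun i _ => ContDiffOn.sum fun j _ =>
    (hcoord i).mul ((hcoord j).mul (hpolar _ _).contDiffOn))

variable {EM : Type*} [NormedAddCommGroup EM] [NormedSpace ℝ EM]
  {H : Type*} [TopologicalSpace H] {I : ModelWithCorners ℝ EM H}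
  {B : Type*} [TopologicalSpace B] [ChartedSpace H B]
  {F : Type*} [NormedAddCommGroup F] [NormedSpace ℝ F]
  {E : B → Type*} [TopologicalSpace (TotalSpace F E)] [∀ x, NormedAddCommGroup (E x)]
  [∀ x, InnerProductSpace ℝ (E x)] [FiberBundle F E]
  {ψ : Flow ℝ≥0 B} {A : LinearCocycle I F E ψ}
  {J : ∀ x : B, QuadraticForm ℝ (E x)} {δ : C(B, ℝ)}
  [VectorBundle ℝ F E] [FiniteDimensional ℝ F] [ContMDiffVectorBundle 1 F E I]

/-- A `C¹` section, transported back along an orbit by the cocycle, is a `C¹` curve in the fibre at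
the starting point: in a local trivialization, the cocycle is a `C¹` family of invertible linear
maps. -/
theorem LinearCocycle.contDiffOn_symm_section (A : LinearCocycle I F E ψ) {Z : ∀ x : B, E x}
    (hZ : ContMDiff I (I.prod 𝓘(ℝ, F)) 1 (fun x : B => (⟨x, Z x⟩ : TotalSpace F E))) (x : B) :
    ContDiffOn ℝ 1
      (fun t : ℝ => (A.toFun t.toNNReal x).symm (Z (ψ t.toNNReal x))) (Ici 0) := by
  have := finiteDimensional_fiber F (E := E) x
  have hcomplete : CompleteSpace (E x) := FiniteDimensional.complete ℝ (E x)
  intro t₀ ht₀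
  obtain ⟨e, he⟩ : ∃ e, e = trivializationAt F E (ψ t₀.toNNReal x) := ⟨_, rfl⟩
  have hmem : MemTrivializationAtlas e := by rw [he]; infer_instance
  have horb : Continuous fun t : ℝ => ψ t.toNNReal x :=
    ψ.continuous continuous_real_toNNReal continuous_const
  have hO : IsOpen ((fun t : ℝ => ψ t.toNNReal x) ⁻¹' e.baseSet) := e.open_baseSet.preimage horb
  have ht₀O : t₀ ∈ (fun t : ℝ => ψ t.toNNReal x) ⁻¹' e.baseSet := by
    rw [he]
    exact FiberBundle.mem_baseSet_trivializationAt' _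
  obtain ⟨s, hs⟩ : ∃ s, s = Ici (0 : ℝ) ∩ (fun t : ℝ => ψ t.toNNReal x) ⁻¹' e.baseSet := ⟨_, rfl⟩
  have hsource : ∀ t ∈ s, ∀ v : E (ψ t.toNNReal x),
      (⟨ψ t.toNNReal x, v⟩ : TotalSpace F E) ∈ e.source := by
    intro t ht v
    rw [hs] at ht
    rw [e.mem_source]
    exact ht.2
  obtain ⟨a, ha⟩ : ∃ a : ℝ → (E x →L[ℝ] F), a = fun t =>
    (e.continuousLinearMapAt ℝ (ψ t.toNNReal x)).comp
      (A.toFun t.toNNReal x : E x →L[ℝ] E (ψ t.toNNReal x)) := ⟨_, rfl⟩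
  have heq : ∀ t ∈ s, ∀ v : E (ψ t.toNNReal x),
      e.continuousLinearMapAt ℝ (ψ t.toNNReal x) v = (e ⟨ψ t.toNNReal x, v⟩).2 := by
    intro t ht v
    rw [hs] at ht
    rw [e.continuousLinearMapAt_apply ℝ, e.coe_linearMapAt_of_mem ht.2]
  have hlocal : ∀ γ : ℝ → TotalSpace F E, ContMDiffOn 𝓘(ℝ, ℝ) (I.prod 𝓘(ℝ, F)) 1 γ s →
      (∀ t ∈ s, γ t ∈ e.source) → ContDiffOn ℝ 1 (fun t => (e (γ t)).2) s :=
    fun γ hγ hγs t ht => contMDiffWithinAt_iff_contDiffWithinAt.1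
      ((e.contMDiffWithinAt_iff (hγs t ht)).1 (hγ t ht)).2
  have hcurve : ∀ v, ContMDiffOn 𝓘(ℝ, ℝ) (I.prod 𝓘(ℝ, F)) 1
      (fun t : ℝ => (⟨ψ t.toNNReal x, A.toFun t.toNNReal x v⟩ : TotalSpace F E)) s := fun v =>
    (A.contMDiffOn_time x v).mono (hs ▸ inter_subset_left)
  have hasm : ContDiffOn ℝ 1 a s := by
    refine contDiffOn_clm_apply.2 fun v => ?_
    refine (hlocal _ (hcurve v) fun t ht => hsource t ht _).congr fun t ht => ?_
    rw [ha]
    exact heq t ht _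
  have hZs : ContDiffOn ℝ 1 (fun t : ℝ => (e ⟨ψ t.toNNReal x, Z (ψ t.toNNReal x)⟩).2) s := by
    refine hlocal (fun t => ⟨ψ t.toNNReal x, Z (ψ t.toNNReal x)⟩) ?_ fun t ht => hsource t ht _
    exact hZ.comp_contMDiffOn ((contMDiff_proj E).comp_contMDiffOn (hcurve 0))
  have hmain : ContDiffOn ℝ 1
      (fun t : ℝ => (A.toFun t.toNNReal x).symm (Z (ψ t.toNNReal x))) s := by
    have hequiv : ∀ t (ht : t ∈ s), a t = ((A.toFun t.toNNReal x).trans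
        (e.continuousLinearEquivAt ℝ (ψ t.toNNReal x) (hs ▸ ht).2) : E x →L[ℝ] F) := by
      intro t ht
      ext v
      rw [ha]
      simp [e.coe_continuousLinearEquivAt_eq]
    have hinv : ContDiffOn ℝ 1 (fun t => (a t).inverse) s := by
      intro t ht
      have h5 : ContDiffAt ℝ 1 ContinuousLinearMap.inverse (a t) := by
        rw [hequiv t ht]
        exact contDiffAt_map_inverse _
      exact h5.comp_contDiffWithinAt t (hasm t ht)
    refine (hinv.clm_apply hZs).congr fun t ht => ?_
    rw [hequiv t ht, ContinuousLinearMap.inverse_equiv, ← heq t ht]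
    have h6 : t ∈ Ici (0 : ℝ) ∩ (fun t : ℝ => ψ t.toNNReal x) ⁻¹' e.baseSet := hs ▸ ht
    symm
    rw [← e.coe_continuousLinearEquivAt_eq h6.2]
    exact congrArg (A.toFun t.toNNReal x).symm 
      ((e.continuousLinearEquivAt ℝ (ψ t.toNNReal x) h6.2).symm_apply_apply _)
  have h4 := hmain t₀ (hs ▸ ⟨ht₀, ht₀O⟩)
  rw [hs] at h4
  exact (contDiffWithinAt_inter (hO.mem_nhds ht₀O)).1 h4

/-- The averaged form is `C¹` along the flow, although `J` is only continuous: along an orbit, time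
enters through the end points of the integral. -/
theorem contDiffOn_averagedForm (hJ : Continuous (fiberForm (F := F) J)) {a b : ℝ} (ha : 0 ≤ a)
    (hab : a ≤ b) {Z : ∀ x : B, E x}
    (hZ : ContMDiff I (I.prod 𝓘(ℝ, F)) 1 (fun x : B => (⟨x, Z x⟩ : TotalSpace F E))) (x : B) :
    ContDiffOn ℝ 1 (fun t : ℝ => averagedForm A δ hJ a b (ψ t.toNNReal x) (Z (ψ t.toNNReal x)))
      (Ici 0) := by
  have := finiteDimensional_fiber F (E := E) x
  have h1 : ContDiff ℝ 1 fun t => Real.exp (2 * orbitIntegral ψ δ x t) := by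
    refine Real.contDiff_exp.comp (contDiff_const.mul ?_)
    exact contDiff_integral (h := fun s => δ (ψ s.toNNReal x))
      (δ.continuous.comp (ψ.continuous continuous_real_toNNReal continuous_const))
  have h3 := contDiffOn_quadraticForm (Q := fun t => averagedForm A δ hJ (a + t) (b + t) x)
    (fun v => contDiff_integral_add (continuous_pulledForm_left hJ ⟨x, v⟩) a b)
    (A.contDiffOn_symm_section hZ x)
  refine (h1.contDiffOn.mul h3).congr fun t ht => ?_
  have h4 := averagedForm_totalFlow (A := A) (δ := δ) hJ ha hab t.toNNReal
    ⟨x, (A.toFun t.toNNReal x).symm (Z (ψ t.toNNReal x))⟩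
  rw [A.totalFlow_mk, ContinuousLinearEquiv.apply_symm_apply, Real.coe_toNNReal t ht] at h4
  exact h4

end Differentiability

/-! ### The equivalence over a trapping region -/

section TrappingRegion

theorem locallyCompactSpace_opens {EM : Type*} [NormedAddCommGroup EM] [NormedSpace ℝ EM]
    [FiniteDimensional ℝ EM] {H : Type*} [TopologicalSpace H] (I : ModelWithCorners ℝ EM H)
    {M : Type*} [TopologicalSpace M] [ChartedSpace H M] (U : Opens M) : LocallyCompactSpace U :=
  have := Manifold.locallyCompact_of_finiteDimensional (M := M) I
  U.isOpen.locallyCompactSpace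

theorem paracompactSpace_opens {EM : Type*} [NormedAddCommGroup EM] [NormedSpace ℝ EM]
    [FiniteDimensional ℝ EM] {H : Type*} [TopologicalSpace H] (I : ModelWithCorners ℝ EM H)
    {M : Type*} [TopologicalSpace M] [ChartedSpace H M] [T2Space M] [CompactSpace M]
    (U : Opens M) : ParacompactSpace U := by
  have : SecondCountableTopology H := I.isClosedEmbedding.isEmbedding.secondCountableTopology
  have : SecondCountableTopology M := ChartedSpace.secondCountable_of_sigmaCompact H M
  have := locallyCompactSpace_opens I U
  infer_instance

variable {M : Type*} [TopologicalSpace M] [T2Space M] [CompactSpace M]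
  {φ : Flow ℝ≥0 M} {U : Opens M}

theorem IsTrappingRegion.isCompactInvariant (hU : IsTrappingRegion φ U)
    (hinj : ∀ t, Function.Injective (φ t)) :
    IsCompactInvariant hU.flow {x : U | (x : M) ∈ maximalInvariantSet φ U} where
  isCompact := hU.isCompact_preimage
  map_mem t x hx := maximalInvariantSet_map_mem hU t hx
  exists_map_eq t x hx := by
    obtain ⟨y, hy, hyx⟩ := exists_map_eq_of_mem_maximalInvariantSet (hinj t) hx
    exact ⟨⟨y, hU.maximalInvariantSet_subset hy⟩, hy, Subtype.ext hyx⟩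
  injective t x y h := Subtype.ext (hinj t (congrArg Subtype.val h))

end TrappingRegion

end JSeparation

theorem mainTheorem5
    {EM : Type*} [NormedAddCommGroup EM] [NormedSpace ℝ EM] [FiniteDimensional ℝ EM]
    {H : Type*} [TopologicalSpace H] (I : ModelWithCorners ℝ EM H)
    {M : Type*} [TopologicalSpace M] [ChartedSpace H M] [IsManifold I ∞ M]
    [T2Space M] [CompactSpace M]
    (X : (x : M) → TangentSpace I x)
    (hX : ContMDiff I I.tangent 1 (fun x => (⟨x, X x⟩ : TangentBundle I M)))
    (φ : Flow ℝ≥0 M) (hφ : JSeparation.IsFlowOf I X φ)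
    (U : Opens M) (hU : JSeparation.IsTrappingRegion φ U)
    (F : Type*) [NormedAddCommGroup F] [NormedSpace ℝ F] [FiniteDimensional ℝ F]
    (E : U → Type*) [TopologicalSpace (TotalSpace F E)] [∀ x, NormedAddCommGroup (E x)]
    [∀ x, InnerProductSpace ℝ (E x)] [FiberBundle F E] [VectorBundle ℝ F E]
    [ContMDiffVectorBundle 1 F E I] [IsContinuousRiemannianBundle F E]
    (A : JSeparation.LinearCocycle I F E hU.flow)
    (p q : ℕ) (hq : 0 < q) (hp : 0 < p) (hpq : p + q = Module.finrank ℝ F) :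
    (∃ J : ∀ x : U, QuadraticForm ℝ (E x),
        JSeparation.IsQuadraticFormField I F E hU.flow J q ∧ A.IsStrictlySeparated J) ↔
      ∃ Fm Fp : ∀ x : U, Submodule ℝ (E x),
        A.IsDominatedSplittingOn
          {x : U | (x : M) ∈ JSeparation.maximalInvariantSet φ U} Fm Fp ∧
        ∀ x : U, (x : M) ∈ JSeparation.maximalInvariantSet φ U →
          Module.finrank ℝ (Fm x) = q ∧ Module.finrank ℝ (Fp x) = p := by
  have hloc := JSeparation.locallyCompactSpace_opens I U
  have hpara := JSeparation.paracompactSpace_opens I U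
  have hΛ := hU.isCompactInvariant hφ.injective
  have hfin := JSeparation.finiteDimensional_fiber F (E := E)
  have hfinrank : ∀ x : U, p + q = Module.finrank ℝ (E x) := fun x =>
    hpq.trans (JSeparation.finrank_fiber (F := F) x).symm
  constructor
  · rintro ⟨J, hJ, hsep⟩
    refine JSeparation.exists_isDominatedSplittingOn hΛ (A.isStrictlySeparated_iff.1 hsep)
      hJ.continuous (fun x _ => ?_)
      (fun x _ => ?_) hpq hp hq
    · obtain ⟨P, hP, hP'⟩ := JSeparation.exists_posDef_of_isGreatest (hJ.nondegenerate x)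
        (hJ.index_eq x) (hfinrank x)
      refine ⟨P, hP, fun v hv => ?_⟩
      rcases eq_or_ne v 0 with rfl | h0
      · simp
      · exact (hP' v hv h0).le
    · obtain ⟨W, hW, hWq⟩ := (hJ.index_eq x).1
      exact ⟨W, hWq, hW⟩
  · rintro ⟨Fm, Fp, h, hdim⟩
    obtain ⟨J, hJ, δ, a, b, ha, hab, hsig, hsep⟩ := h.exists_averagedForm hΛ.isCompact hΛ.map_mem
      (fun V hV hVΛ => hU.exists_forall_flow_mem hV hVΛ) hdim
    refine ⟨_, ⟨JSeparation.continuous_averagedForm hJ a b,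
      fun x => (hsig x).nondegenerate (hfinrank x), fun x => (hsig x).isGreatest (hfinrank x),
      fun Z hZ x => JSeparation.contDiffOn_averagedForm hJ ha hab hZ x⟩, hsep⟩
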